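/- **Setting.** Let $M$ be a smooth, Hausdorff, second countable, connected manifold of dimension $n\ge 2$, let $g$ be a locally Lipschitz Lorentzian metric on $M$ (signature $(-,+,\dots,+)$), time-oriented by a smooth $g$-timelike vector field $T$, and let $\Sigma\subseteq M$ be a smooth (embedded) $g$-spacelike hypersurface. *Regularisation.* Let $(U_\alpha,\psi_\alpha)_{\alpha\in\mathbb N}$ be a locally finite family of relatively compact charts covering $M$, $(\xi_\alpha)$ a smooth partition of unity with $\operatorname{supp}\xi_\alpha\subseteq U_\alpha$, $\chi_\alpha\in C_c^\infty(U_\alpha)$ equal to $1$ near $\operatorname{supp}\xi_\alpha$, $\rho\in C^\infty_c(B_1(0))$, $\rho\ge 0$, $\int\rho=1$, $\rho_\varepsilon(x)=\varepsilon^{-n}\rho(x/\varepsilon)$, and put $$\mathcal T\star_M\rho_\varepsilon:=\sum_\alpha \chi_\alpha\,\psi_\alpha^*\big[\big((\psi_\alpha)_*(\xi_\alpha\mathcal T)\big)*\rho_\varepsilon\big]$$ (componentwise convolution in the chart). Let $(\check g_\varepsilon)_{\varepsilon\in(0,1]}$ be smooth Lorentzian metrics such that $\check g_\varepsilon\prec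 g$ (i.e. $\check g_\varepsilon(v,v)\le 0$, $v\ne0$, implies $g(v,v)<0$) and $\check g_\varepsilon-g\star_M\rho_\varepsilon\to0$ in $C^\infty_{\mathrm{loc}}(M)$ as $\varepsilon\to 0$. Let $\varepsilon_k\in(0,1]$, $\varepsilon_k\to0$, and $g_k:=\check g_{\varepsilon_k}$. A $\check g_\varepsilon$-timelike vector is called future directed if it is so for $g$. *Admissible sets.* For a smooth $g$-timelike vector field $X$ on $M$, an open part $\Sigma'$ of $\Sigma$ and a metric $g'$, let $\Phi$ be the flow-out of $\Sigma$ along $X$, defined on $\mathcal O\subseteq\Sigma\times\mathbb R$. An open set $\mathcal A\subseteq\mathcal O\cap(\Sigma'\times\mathbb R)$ containing $\Sigma'\times\{0\}$ (or its image $A=\Phi(\mathcal A)$) is admissible for $\Sigma'$ with respect to $X$ and $g'$ if $\Phi|_{\mathcal A}$ is a diffeomorphism onto its image $A$, $X$ is $g'$-timelike on $A$, and $g'$ induces a Riemannian metric on each leaf $\Sigma'_t=\Phi((\Sigma'\times\{t\})\cap\mathcal A)$. On $A$ the $X$-slab mean curvature is $$\mathcal H^X[g']=-\sum_{i,j=1}^{n-1}G^{ij}\,g'(\nabla_{X_i}X_j,N),$$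 where $(X_i)$ is a local frame of smooth vector fields tangent to the leaves, $(G^{ij})$ is the inverse of $(g'(X_i,X_j))$, $\nabla$ is the Levi-Civita connection of $g'$, and $N$ is the future directed $g'$-unit normal of the leaves; for $g'=g$ it is defined almost everywhere. Write $\mathcal H[g]<b$ if there are a smooth $g$-timelike $X$ and an $A$ admissible for $\Sigma$ with respect to $X$ and $g$ such that $\operatorname{ess\,sup}_A\mathcal H^X[g]<b$. $H_{\Sigma'}[g']$ denotes the mean curvature (same formula and sign, with respect to the future directed unit normal) of a $g'$-spacelike $\Sigma'$ for smooth $g'$. **Lemma (Local convergence of the mean curvature).** Let $\tilde\Sigma$ be open and relatively compact in $\Sigma$. 1. Let $X$ be a smooth $g$-timelike vector field on $M$. There exist sets $A_\Sigma$ that are admissible for $\Sigma$ with respect to $X$ and $g$. For every such $A_\Sigma$ one has $\mathcal H^X[g]\in L^\infty_{\mathrm{loc}}(A_\Sigma)$, and there are $k_0\in\mathbb N$ and an open neighbourhood $A_{\tilde\Sigma}\subseteq A_\Sigma$ of $\tilde\Sigma$ in $M$ which is admissible for $\tilde\Sigma$ with respect to $X$ for $g$ and for every $g_k$ with $k\ge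 k_0$, and such that $$\big\|\mathcal H^X[g_k]-\mathcal H^X[g]\star_M\rho_{\varepsilon_k}\big\|_{L^\infty(A_{\tilde\Sigma})}\to0\qquad(k\to\infty),$$ where $\mathcal H^X[g]$ is taken on $A_\Sigma$ and extended by $0$ to $M$ before convolving (the functions whose norm is taken are defined everywhere, and the convergence is uniform on $A_{\tilde\Sigma}$). 2. If $\mathcal H[g]<b$ for some $b\in\mathbb R$, then for all sufficiently large $k$ the hypersurface $\tilde\Sigma$ is $g_k$-spacelike and $H_{\tilde\Sigma}[g_k]<b$ on $\tilde\Sigma$. -/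

import Mathlib

open Set Filter Topology MeasureTheory
open scoped Manifold ContDiff

namespace LipschitzSlab

noncomputable section

/-- `ℝᵈ` with its Euclidean structure. -/
abbrev Euc (d : ℕ) := EuclideanSpace ℝ (Fin d)

/-! ### Tensor fields on an `n`-dimensional manifold and their components in charts -/

section Tensors

variable {n : ℕ} {M : Type*} [TopologicalSpace M] [ChartedSpace (Euc n) M]

/-- A (not necessarily continuous) vector field. -/
abbrev VectorField (n : ℕ) (M : Type*) [TopologicalSpace M] [ChartedSpace (Euc n) M] :=
  (p : M) → TangentSpace (𝓡 n) p

/-- A field of bilinear forms on the tangent spaces, i.e. a `(0,2)`-tensor field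
without any regularity. -/
abbrev BilinField (n : ℕ) (M : Type*) [TopologicalSpace M] [ChartedSpace (Euc n) M] :=
  (p : M) → TangentSpace (𝓡 n) p →ₗ[ℝ] TangentSpace (𝓡 n) p →ₗ[ℝ] ℝ

/-- The vector field `X` is smooth. -/
def IsSmoothVectorField [IsManifold (𝓡 n) ∞ M] (X : VectorField n M) : Prop :=
  ContMDiff (𝓡 n) (𝓡 n).tangent ∞ (fun p => (⟨p, X p⟩ : TangentBundle (𝓡 n) M))

/-- The components in the chart `φ` of a field `t` of functions of two tangent vectors: the value
at `y ∈ φ.target` on the vectors with components `v` and `w`, that is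
`((φ⁻¹)^* t)_y (v, w)`. -/
def components (φ : OpenPartialHomeomorph M (Euc n))
    (t : (p : M) → TangentSpace (𝓡 n) p → TangentSpace (𝓡 n) p → ℝ)
    (y v w : Euc n) : ℝ :=
  t (φ.symm y) (mfderiv (𝓡 n) (𝓡 n) φ.symm y v) (mfderiv (𝓡 n) (𝓡 n) φ.symm y w)

/-- `g` is pointwise a Lorentzian scalar product, of signature `(-,+,…,+)`: it is symmetric, and
there is a vector `u` with `g(u,u) < 0` such that `g` is positive definite on `u^⊥`. -/
def IsLorentzian (g : BilinField n M) : Prop :=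
  ∀ p : M, (∀ v w, g p v w = g p w v) ∧
    ∃ u, g p u u < 0 ∧ ∀ w, g p u w = 0 → w ≠ 0 → 0 < g p w w

/-- `g` is locally Lipschitz continuous (in every chart of the smooth structure). -/
def IsLocallyLipschitz (g : BilinField n M) : Prop :=
  ∀ φ ∈ IsManifold.maximalAtlas (𝓡 n) ∞ M, ∀ v w : Euc n,
    LocallyLipschitzOn φ.target (fun y => components φ (fun p a b => g p a b) y v w)

/-- `g` is smooth (in every chart of the smooth structure). -/
def IsSmoothBilin (g : BilinField n M) : Prop :=
  ∀ φ ∈ IsManifold.maximalAtlas (𝓡 n) ∞ M, ∀ v w : Euc n,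
    ContDiffOn ℝ ∞ (fun y => components φ (fun p a b => g p a b) y v w) φ.target

/-- The vector field `X` is `g`-timelike at every point. -/
def IsTimelike (g : BilinField n M) (X : VectorField n M) : Prop :=
  ∀ p : M, g p (X p) (X p) < 0

/-- `g₁ ≺ g₂`: `g₁` has strictly narrower light cones than `g₂`. -/
def StrictlyNarrower (g₁ g₂ : BilinField n M) : Prop :=
  ∀ (p : M) (v : TangentSpace (𝓡 n) p), v ≠ 0 → g₁ p v v ≤ 0 → g₂ p v v < 0

/-- A subset of the manifold has measure zero: its image in every chart is Lebesgue-null. -/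
def IsNullSet (n : ℕ) {M : Type*} [TopologicalSpace M] [ChartedSpace (Euc n) M]
    (N : Set M) : Prop :=
  ∀ φ ∈ IsManifold.maximalAtlas (𝓡 n) ∞ M, volume (φ '' (N ∩ φ.source)) = 0

/-- `f ∈ L^∞_loc(A)` (for `A` open). -/
def MemLinftyLoc (n : ℕ) {M : Type*} [TopologicalSpace M] [ChartedSpace (Euc n) M]
    (f : M → ℝ) (A : Set M) : Prop :=
  (∀ φ ∈ IsManifold.maximalAtlas (𝓡 n) ∞ M,
    AEStronglyMeasurable (fun y => f (φ.symm y))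
      (volume.restrict (φ.target ∩ φ.symm ⁻¹' A))) ∧
  ∀ K ⊆ A, IsCompact K → ∃ C : ℝ, IsNullSet n {p ∈ K | C < |f p|}

end Tensors

/-! ### Regularisation by manifold convolution -/

section Regularisation

variable {n : ℕ} {M : Type*} [TopologicalSpace M] [ChartedSpace (Euc n) M]

/-- The data entering the manifold convolution: a countable locally finite family of relatively
compact chart domains covering `M`, a subordinate partition of unity `ξ`, cut-off functions `χ`
equal to `1` near the supports of the `ξ α`, and a mollifier `ρ ∈ 𝒟(B₁(0))`. -/
structure RegularisationData (n : ℕ) (M : Type*) [TopologicalSpace M]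
    [ChartedSpace (Euc n) M] where
  chart : ℕ → OpenPartialHomeomorph M (Euc n)
  chart_mem : ∀ α, chart α ∈ IsManifold.maximalAtlas (𝓡 n) ∞ M
  locallyFinite : LocallyFinite fun α => (chart α).source
  relativelyCompact : ∀ α, IsCompact (closure (chart α).source)
  covers : ⋃ α, (chart α).source = univ
  ξ : SmoothPartitionOfUnity ℕ (𝓡 n) M univ
  ξ_subordinate : ξ.IsSubordinate fun α => (chart α).source
  χ : ℕ → M → ℝ
  χ_smooth : ∀ α, ContMDiff (𝓡 n) 𝓘(ℝ, ℝ) ∞ (χ α)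
  χ_compact : ∀ α, HasCompactSupport (χ α)
  χ_support : ∀ α, tsupport (χ α) ⊆ (chart α).source
  χ_eq_one : ∀ α, ∀ᶠ p in 𝓝ˢ (tsupport (ξ α)), χ α p = 1
  ρ : Euc n → ℝ
  ρ_smooth : ContDiff ℝ ∞ ρ
  ρ_support : tsupport ρ ⊆ Metric.ball 0 1
  ρ_nonneg : ∀ x, 0 ≤ ρ x
  ρ_integral : ∫ x, ρ x = 1

namespace RegularisationData

/-- The scaled mollifier `ρ_ε(x) = ε⁻ⁿ ρ(x/ε)`. -/
def mollifier (D : RegularisationData n M) (ε : ℝ) (x : Euc n) : ℝ :=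
  (ε ^ n)⁻¹ * D.ρ (ε⁻¹ • x)

/-- The manifold convolution `f ⋆_M ρ_ε` of a (locally integrable) function. -/
def conv (D : RegularisationData n M) (f : M → ℝ) (ε : ℝ) (p : M) : ℝ :=
  ∑ᶠ α, D.χ α p * ∫ y in (D.chart α).target,
    D.ξ α ((D.chart α).symm y) * f ((D.chart α).symm y) * D.mollifier ε (D.chart α p - y)

/-- The manifold convolution `g ⋆_M ρ_ε` of a `(0,2)`-tensor field, evaluated on two tangent
vectors `v, w` at `p`: in each chart, the components of `ξ_α g` are convolved with `ρ_ε`, and the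
result is pulled back. -/
def convBilin (D : RegularisationData n M) (g : BilinField n M) (ε : ℝ)
    (p : M) (v w : TangentSpace (𝓡 n) p) : ℝ :=
  ∑ᶠ α, D.χ α p * ∫ y in (D.chart α).target,
    D.ξ α ((D.chart α).symm y) *
      components (D.chart α) (fun q a b => g q a b) y
        (mfderiv (𝓡 n) (𝓡 n) (D.chart α) p v) (mfderiv (𝓡 n) (𝓡 n) (D.chart α) p w) *
      D.mollifier ε (D.chart α p - y)

end RegularisationData

/-- `gc ε` (for `ε ∈ (0,1]`) is a family of smooth Lorentzian metrics with `gc ε ≺ g` and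
`gc ε - g ⋆_M ρ_ε → 0` in `C^∞_loc(M)` as `ε → 0`: in every chart, all derivatives of all
components converge to zero uniformly on compact sets. -/
structure IsNarrowApproximation (D : RegularisationData n M) (g : BilinField n M)
    (gc : ℝ → BilinField n M) : Prop where
  smooth : ∀ ε ∈ Ioc (0 : ℝ) 1, IsSmoothBilin (gc ε)
  lorentzian : ∀ ε ∈ Ioc (0 : ℝ) 1, IsLorentzian (gc ε)
  narrower : ∀ ε ∈ Ioc (0 : ℝ) 1, StrictlyNarrower (gc ε) g
  tendsto : ∀ φ ∈ IsManifold.maximalAtlas (𝓡 n) ∞ M, ∀ (v w : Euc n) (j : ℕ),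
    ∀ K ⊆ φ.target, IsCompact K →
      TendstoUniformlyOn
        (fun ε => iteratedFDeriv ℝ j
          (fun y => components φ (fun p a b => gc ε p a b - D.convBilin g ε p a b) y v w))
        0 (𝓝[>] 0) K

end Regularisation

/-! ### Mean curvature of hypersurfaces and slabs

`S` is an `m`-dimensional manifold mapped into the `n`-dimensional manifold `M`. -/

section MeanCurvature

variable {m n : ℕ} {M : Type*} [TopologicalSpace M] [ChartedSpace (Euc n) M]
  {S : Type*} [TopologicalSpace S] [ChartedSpace (Euc m) S]

/-- The Christoffel symbol of the first kind of `g` in the chart `φ` at `y`,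
`Γ(a, b; c) = ½ (∂_a g(b,c) + ∂_b g(a,c) - ∂_c g(a,b))` for constant vectors `a, b, c`.
For locally Lipschitz `g` the derivatives exist almost everywhere. -/
def christoffel (φ : OpenPartialHomeomorph M (Euc n)) (g : BilinField n M)
    (y a b c : Euc n) : ℝ :=
  (fderiv ℝ (fun y' => components φ (fun p u v => g p u v) y' b c) y a
    + fderiv ℝ (fun y' => components φ (fun p u v => g p u v) y' a c) y b
    - fderiv ℝ (fun y' => components φ (fun p u v => g p u v) y' a b) y c) / 2

/-- `g(∇_v Z, w)` at the point `F z`, where `∇` is the Levi-Civita connection of `g`, `v` is a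
tangent vector of `S` at `z` (identified with its image under `F`), `Z` is a vector field along
the map `F : S → M`, and `w` is a tangent vector of `M` at `F z`. It is computed in a chart `φ` of
`M` around `F z` as `g(∂_v Z, w) + Γ(dF v, Z; w)`. -/
def innerCovDeriv (g : BilinField n M) (F : S → M) (Z : (z : S) → TangentSpace (𝓡 n) (F z))
    (z : S) (v : TangentSpace (𝓡 m) z) (w : TangentSpace (𝓡 n) (F z)) : ℝ :=
  let φ : OpenPartialHomeomorph M (Euc n) := chartAt (Euc n) (F z)
  let Zφ : S → Euc n := fun z' => mfderiv (𝓡 n) (𝓡 n) φ (F z') (Z z')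
  let dZ : Euc n := mfderiv (𝓡 m) (𝓡 n) Zφ z v
  let a : Euc n := mfderiv (𝓡 n) (𝓡 n) φ (F z) (mfderiv (𝓡 m) (𝓡 n) F z v)
  let c : Euc n := mfderiv (𝓡 n) (𝓡 n) φ (F z) w
  components φ (fun p u v => g p u v) (φ (F z)) dZ c + christoffel φ g (φ (F z)) a (Zφ z) c

/-- `ν` is a future directed `g`-unit vector at `F z`, `g`-normal to the hypersurface
parametrised by `F`. A `g`-timelike vector is future directed if it is so for the
time-oriented metric `(g₀, T)`, that is, `g₀(ν, T) < 0`; here `g = g₀` or `g ≺ g₀`. -/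
def IsFutureUnitNormal (g g₀ : BilinField n M) (T : VectorField n M) (F : S → M) (z : S)
    (ν : TangentSpace (𝓡 n) (F z)) : Prop :=
  g (F z) ν ν = -1 ∧ (∀ v, g (F z) ν (mfderiv (𝓡 m) (𝓡 n) F z v) = 0) ∧
    g₀ (F z) ν (T (F z)) < 0

open Classical in
/-- The future directed unit normal (junk value `0` if there is none; it is unique if `g` is
Lorentzian and `F` parametrises a spacelike hypersurface). -/
def unitNormal (g g₀ : BilinField n M) (T : VectorField n M) (F : S → M) (z : S) :
    TangentSpace (𝓡 n) (F z) :=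
  if h : ∃ ν, IsFutureUnitNormal (m := m) g g₀ T F z ν then h.choose else 0

/-- The `i`-th coordinate vector field on `S` of the chart `ψ`. -/
def coordField (ψ : OpenPartialHomeomorph S (Euc m)) (i : Fin m) (z : S) :
    TangentSpace (𝓡 m) z :=
  (mfderiv (𝓡 m) (𝓡 m) ψ z).inverse (EuclideanSpace.single i (1 : ℝ) : Euc m)

/-- The mean curvature at `z` of the spacelike hypersurface parametrised by `F : S → M`, with
respect to the metric `g` and the future directed unit normal `N`:
`-∑_{i,j} G^{ij} g(∇_{X_i} X_j, N)`, where `X_i = dF(V_i)` for the coordinate frame `V_i` of a chart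
of `S` around `z`, and `G^{ij}` is the inverse of the matrix `g(X_i, X_j)`. -/
def meanCurvature (m : ℕ) {n : ℕ} {M : Type*} [TopologicalSpace M] [ChartedSpace (Euc n) M]
    {S : Type*} [TopologicalSpace S] [ChartedSpace (Euc m) S]
    (g g₀ : BilinField n M) (T : VectorField n M) (F : S → M) (z : S) : ℝ :=
  let V : Fin m → (z' : S) → TangentSpace (𝓡 m) z' := coordField (chartAt (Euc m) z)
  let X : Fin m → (z' : S) → TangentSpace (𝓡 n) (F z') :=
    fun i z' => mfderiv (𝓡 m) (𝓡 n) F z' (V i z')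
  let G : Matrix (Fin m) (Fin m) ℝ := Matrix.of fun i j => g (F z) (X i z) (X j z)
  (-1) * ∑ i, ∑ j, G⁻¹ i j *
    innerCovDeriv g F (X j) z (V i z) (unitNormal (m := m) g g₀ T F z)

/-- The flow of `X` takes the point `p` to the point `q` in time `t`. -/
def FlowsTo (X : VectorField n M) (p : M) (t : ℝ) (q : M) : Prop :=
  ∃ (γ : ℝ → M) (a b : ℝ), 0 ∈ Ioo a b ∧ t ∈ Ioo a b ∧
    IsMIntegralCurveOn (I := 𝓡 n) γ X (Ioo a b) ∧ γ 0 = p ∧ γ t = q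

/-- The domain `𝒪 ⊆ S × ℝ` of the flow-out of the hypersurface `ι : S → M` along `X`. -/
def flowOutDomain (X : VectorField n M) (ι : S → M) : Set (S × ℝ) :=
  {w | ∃ q, FlowsTo X (ι w.1) w.2 q}

open Classical in
/-- The flow-out `Φ(z, t)` of the hypersurface `ι : S → M` along `X` (junk outside its
domain). -/
def flowOut (X : VectorField n M) (ι : S → M) (w : S × ℝ) : M :=
  if h : ∃ q, FlowsTo X (ι w.1) w.2 q then h.choose else ι w.1

/-- The open set `𝒜 ⊆ S × ℝ` (and likewise `A = Φ(𝒜) ⊆ M`) is admissible with respect to `X` and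
`g` for the open part `U` of the hypersurface `ι : S → M`. -/
structure IsAdmissible (m : ℕ) {n : ℕ} {M : Type*} [TopologicalSpace M]
    [ChartedSpace (Euc n) M] {S : Type*} [TopologicalSpace S] [ChartedSpace (Euc m) S]
    (g : BilinField n M) (X : VectorField n M) (ι : S → M) (U : Set S) (𝒜 : Set (S × ℝ)) :
    Prop where
  isOpen : IsOpen 𝒜
  subset_domain : 𝒜 ⊆ flowOutDomain X ι ∩ U ×ˢ univ
  zero_mem : U ×ˢ {(0 : ℝ)} ⊆ 𝒜
  /-- `Φ` restricted to `𝒜` is a diffeomorphism onto its (open) image. -/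
  injOn : InjOn (flowOut X ι) 𝒜
  isLocalDiffeomorphOn :
    IsLocalDiffeomorphOn ((𝓡 m).prod 𝓘(ℝ, ℝ)) (𝓡 n) ∞ (flowOut X ι) 𝒜
  /-- `X` is `g`-timelike on `A`. -/
  timelike : ∀ p ∈ flowOut X ι '' 𝒜, g p (X p) (X p) < 0
  /-- The metric induced by `g` on each leaf `Σ_t = Φ((U × {t}) ∩ 𝒜)` is Riemannian. -/
  leaves_spacelike : ∀ w ∈ 𝒜, ∀ v : TangentSpace (𝓡 m) w.1, v ≠ 0 →
    0 < g (flowOut X ι (w.1, w.2))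
      (mfderiv (𝓡 m) (𝓡 n) (fun z => flowOut X ι (z, w.2)) w.1 v)
      (mfderiv (𝓡 m) (𝓡 n) (fun z => flowOut X ι (z, w.2)) w.1 v)

open Classical in
/-- The `X`-slab mean curvature on `A = Φ(𝒜)`, with respect to the metric `g`: its value at
`Φ(z, t)` is `-∑_{i,j} G^{ij} g(∇_{X_i} X_j, N)` for the tangential frame `X_i = TΦ(V_i, 0)`, where
`V_i` is a coordinate frame on `S` around `z`, and for the future directed normal `N` to the leaf
`Σ_t`. (It is extended by `0` to `M`. For locally Lipschitz `g` only the almost everywhere class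
of this function on `A` is meaningful.) -/
def slabMeanCurvature (m : ℕ) {n : ℕ} {M : Type*} [TopologicalSpace M]
    [ChartedSpace (Euc n) M] {S : Type*} [TopologicalSpace S] [ChartedSpace (Euc m) S]
    (g g₀ : BilinField n M) (T X : VectorField n M) (ι : S → M) (𝒜 : Set (S × ℝ))
    (p : M) : ℝ :=
  if h : ∃ w ∈ 𝒜, flowOut X ι w = p then
    meanCurvature m g g₀ T (fun z => flowOut X ι (z, h.choose.2)) h.choose.1
  else 0

/-- `ℋ[g] < b`: for some smooth timelike `X` and some admissible `𝒜`, the essential supremum over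
`A = Φ(𝒜)` of the `X`-slab mean curvature of the hypersurface `ι : S → M` is `< b`. -/
def SlabMeanCurvatureLT (m : ℕ) {n : ℕ} {M : Type*} [TopologicalSpace M]
    [ChartedSpace (Euc n) M] [IsManifold (𝓡 n) ∞ M] {S : Type*} [TopologicalSpace S] [ChartedSpace (Euc m) S]
    (g : BilinField n M) (T : VectorField n M) (ι : S → M) (b : ℝ) : Prop :=
  ∃ X : VectorField n M, IsSmoothVectorField X ∧ IsTimelike g X ∧
    ∃ 𝒜 : Set (S × ℝ), IsAdmissible m g X ι univ 𝒜 ∧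
      ∃ c < b, IsNullSet n {p ∈ flowOut X ι '' 𝒜 | c < slabMeanCurvature m g g T X ι 𝒜 p}

/-- At the points of `U`, the hypersurface `ι : S → M` is `g`-spacelike. -/
def IsSpacelikeOn (m : ℕ) {n : ℕ} {M : Type*} [TopologicalSpace M]
    [ChartedSpace (Euc n) M] {S : Type*} [TopologicalSpace S] [ChartedSpace (Euc m) S]
    (g : BilinField n M) (ι : S → M) (U : Set S) : Prop :=
  ∀ z ∈ U, ∀ v : TangentSpace (𝓡 m) z, v ≠ 0 →
    0 < g (ι z) (mfderiv (𝓡 m) (𝓡 n) ι z v) (mfderiv (𝓡 m) (𝓡 n) ι z v)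

end MeanCurvature

end

end LipschitzSlab

open LipschitzSlab

set_option linter.unusedSectionVars false

namespace LipschitzSlab

/-! In a chart in which the leaves are parallel hyperplanes, the mean curvature of a leaf is a
finite sum Σ c_r Γ_r (`IsAdaptedChart.meanCurvature_eq`). The Γ_r are Christoffel symbols of the
first kind, hence linear in the first derivatives of the metric. The c_r are continuous functions of
the metric components and of T alone. The derivative of the tangential frame does not contribute,
since it is itself tangential in such a chart and the normal annihilates it. For a locally Lipschitz
metric the Γ_r exist almost everywhere by Rademacher's theorem and are locally bounded; this gives
the L^∞_loc statement.

Under regularisation the components of g converge locally uniformly, but their derivatives do not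
converge. What remains true is that ∂(g ⋆_M ρ_ε) and (∂g) ⋆_M ρ_ε differ by o(1)
(`tendsto_fderiv_components_convBilin`). Each summand of the manifold convolution is a Euclidean
convolution of ξ_α g, read through a change of coordinates and multiplied by χ_α. Moving a smooth
coefficient across the convolution of a bounded function costs only o(1). The zeroth order terms
which this leaves are g(v,w) ∂_a(χ_α ξ_α), and they add up to zero because Σ χ_α ξ_α = 1. Since the
approximating metrics are C^∞_loc-close to g ⋆_M ρ_ε, their Γ_r agree up to o(1) with (Γ_r[g]) ⋆_M
ρ_ε. Freezing the continuous coefficients c_r at a point, against bounded factors, gives the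
convergence of the mean curvatures (`IsNarrowApproximation.tendsto_sum_curvCoeffAt_sub`).

All these limits are taken jointly, for (ε, p) → (0+, p₀). By compactness
(`eventually_forall_of_isCompact`) they become uniform on a tube U × (-δ, δ) with compact closure
inside the given admissible set. An essential upper bound survives the convolution asymptotically,
because ρ and the ξ_α are nonnegative and convolutions of constants tend to the constants; this
yields the second assertion.

Admissible sets exist because along the hypersurface the differential of the flow-out maps the
hypersurface directions to spacelike vectors and the time direction to a timelike one. It is
therefore injective, and the inverse function theorem gives flow boxes. Shrinking the boxes
according to a metric on M makes their union injective. Smoothness of the flow itself is obtained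
from the inverse function theorem in a Banach space of curves (`exists_contDiffOn_flow`). -/

/-- A family `ρ ε`, `ε > 0`, of continuous nonnegative functions of integral one, supported in the
balls of radius `ε`. -/
structure IsMollifierFamily {d : ℕ} (ρ : ℝ → Euc d → ℝ) : Prop where
  continuous : ∀ ε > 0, Continuous (ρ ε)
  nonneg : ∀ ε > 0, ∀ x, 0 ≤ ρ ε x
  eq_zero : ∀ ε > 0, ∀ x, ε ≤ ‖x‖ → ρ ε x = 0
  integral_eq_one : ∀ ε > 0, ∫ x, ρ ε x = 1

/-- The average of `F` over the open set `T` against a mollifier centred at `x`. -/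
noncomputable def mollAverage {d : ℕ} (ρ : ℝ → Euc d → ℝ) (T : Set (Euc d)) (F : Euc d → ℝ)
    (ε : ℝ) (x : Euc d) : ℝ :=
  ∫ y in T, F y * ρ ε (x - y)

/-- `F` is almost everywhere measurable and almost everywhere bounded near `x`. -/
structure LocEssBounded {d : ℕ} (F : Euc d → ℝ) (x : Euc d) : Prop where
  meas : StronglyMeasurableAtFilter F (𝓝 x)
  bdd : ∃ C, ∀ᶠ y in 𝓝 x ⊓ ae volume, |F y| ≤ C

/-! ### Averages of essentially bounded functions against mollifiers. -/

section Averages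

variable {d : ℕ} {ρ : ℝ → Euc d → ℝ} {T : Set (Euc d)} {F G : Euc d → ℝ} {x₀ : Euc d}

theorem RegularisationData.isMollifierFamily {M : Type*} [TopologicalSpace M]
    [ChartedSpace (Euc d) M] (D : RegularisationData d M) :
    IsMollifierFamily D.mollifier where
  continuous ε _ := by
    unfold RegularisationData.mollifier
    exact continuous_const.mul (D.ρ_smooth.continuous.comp (continuous_const_smul _))
  nonneg ε hε x := mul_nonneg (by positivity) (D.ρ_nonneg _)
  eq_zero ε hε x hx := by
    unfold RegularisationData.mollifier
    have h : ε⁻¹ • x ∉ tsupport D.ρ := fun h => by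
      have := D.ρ_support h
      rw [mem_ball_zero_iff, norm_smul, norm_inv, Real.norm_of_nonneg hε.le,
        inv_mul_lt_iff₀ hε] at this
      linarith
    rw [image_eq_zero_of_notMem_tsupport h, mul_zero]
  integral_eq_one ε hε := by
    unfold RegularisationData.mollifier
    rw [integral_const_mul, Measure.integral_comp_smul, D.ρ_integral, finrank_euclideanSpace,
      Fintype.card_fin, inv_pow, inv_inv, abs_of_pos (by positivity), smul_eq_mul, mul_one,
      inv_mul_cancel₀ (by positivity)]

/-- The joint filter `𝓝[>] 0 ×ˢ 𝓝 x₀` lets the scale shrink while the centre moves. Along it only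
the values of a function near `x₀` enter an average. -/
theorem eventually_ball_subset {T : Set (Euc d)} (hT : T ∈ 𝓝 x₀) :
    ∀ᶠ q : ℝ × Euc d in 𝓝[>] 0 ×ˢ 𝓝 x₀, 0 < q.1 ∧ Metric.ball q.2 q.1 ⊆ T := by
  obtain ⟨r, hr, hrT⟩ := Metric.mem_nhds_iff.1 hT
  have h1 : ∀ᶠ ε : ℝ in 𝓝[>] 0, 0 < ε ∧ ε < r / 2 :=
    (eventually_mem_nhdsWithin).and
      (mem_nhdsWithin_of_mem_nhds (Iio_mem_nhds (by positivity)))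
  have h2 : ∀ᶠ x in 𝓝 x₀, x ∈ Metric.ball x₀ (r / 2) := Metric.ball_mem_nhds _ (by positivity)
  filter_upwards [h1.prod_mk h2] with q hq
  refine ⟨hq.1.1, fun y hy => hrT ?_⟩
  rw [Metric.mem_ball] at *
  have := dist_triangle y q.2 x₀
  linarith [hq.1.2, hq.2]

namespace IsMollifierFamily

theorem integrable (hρ : IsMollifierFamily ρ) {ε : ℝ} (hε : 0 < ε) : Integrable (ρ ε) :=
  integrable_of_integral_eq_one (hρ.integral_eq_one ε hε)

theorem integrable_sub (hρ : IsMollifierFamily ρ) {ε : ℝ} (hε : 0 < ε) (x : Euc d) :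
    Integrable (fun y => ρ ε (x - y)) :=
  (hρ.integrable hε).comp_sub_left x

theorem setIntegral_eq_one (hρ : IsMollifierFamily ρ) {ε : ℝ} (hε : 0 < ε) {x : Euc d}
    (hx : Metric.ball x ε ⊆ T) : ∫ y in T, ρ ε (x - y) = 1 := by
  rw [setIntegral_eq_integral_of_forall_compl_eq_zero, integral_sub_left_eq_self (ρ ε),
    hρ.integral_eq_one ε hε]
  intro y hy
  refine hρ.eq_zero ε hε _ (not_lt.1 fun h => hy (hx ?_))
  rwa [Metric.mem_ball, dist_comm, dist_eq_norm]

/-- Only the values of `F` in the ball of radius `ε` around `x` enter the average. -/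
theorem abs_mollAverage_le (hρ : IsMollifierFamily ρ) {ε : ℝ} (hε : 0 < ε) {x : Euc d}
    (hx : Metric.ball x ε ⊆ T) {C : ℝ}
    (hF : ∀ᵐ y ∂(volume : Measure (Euc d)), y ∈ Metric.ball x ε → |F y| ≤ C) :
    |mollAverage ρ T F ε x| ≤ C := by
  -- Measurability of `F` is not needed here: only the dominating function has to be integrable.
  have h := norm_integral_le_of_norm_le (μ := volume.restrict T)
    (f := fun y => F y * ρ ε (x - y)) (g := fun y => C * ρ ε (x - y))
    (((hρ.integrable_sub hε x).const_mul C).restrict) ?_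
  · rw [integral_const_mul, hρ.setIntegral_eq_one hε hx, mul_one] at h
    exact h
  · filter_upwards [ae_restrict_of_ae hF] with y hy
    by_cases hyb : y ∈ Metric.ball x ε
    · rw [norm_mul, Real.norm_eq_abs, Real.norm_of_nonneg (hρ.nonneg ε hε _)]
      exact mul_le_mul_of_nonneg_right (hy hyb) (hρ.nonneg ε hε _)
    · rw [hρ.eq_zero ε hε (x - y)]
      · simp
      · rwa [Metric.mem_ball, not_lt, dist_comm, dist_eq_norm] at hyb

theorem eventually_abs_mollAverage_le (hρ : IsMollifierFamily ρ) (hT : IsOpen T) (hx₀ : x₀ ∈ T)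
    {C : ℝ} (hF : ∀ᶠ y in 𝓝 x₀ ⊓ ae volume, |F y| ≤ C) :
    ∀ᶠ q : ℝ × Euc d in 𝓝[>] 0 ×ˢ 𝓝 x₀, |mollAverage ρ T F q.1 q.2| ≤ C := by
  obtain ⟨s, hs, t, ht, hst⟩ := hF
  have hst' : ∀ y, y ∈ s → y ∈ t → |F y| ≤ C := fun y h1 h2 => by
    have : y ∈ s ∩ t := ⟨h1, h2⟩
    rw [← hst] at this; exact this
  filter_upwards [eventually_ball_subset (inter_mem hs (hT.mem_nhds hx₀))] with q hq
  refine hρ.abs_mollAverage_le hq.1 (fun y hy => (hq.2 hy).2) ?_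
  filter_upwards [ht] with y hy hyb
  exact hst' y (hq.2 hyb).1 hy

theorem tendsto_mollAverage_zero (hρ : IsMollifierFamily ρ) (hT : IsOpen T) (hx₀ : x₀ ∈ T)
    (hF : Tendsto F (𝓝 x₀ ⊓ ae volume) (𝓝 0)) :
    Tendsto (fun q : ℝ × Euc d => mollAverage ρ T F q.1 q.2) (𝓝[>] 0 ×ˢ 𝓝 x₀) (𝓝 0) := by
  rw [Metric.tendsto_nhds]
  intro η hη
  have h : ∀ᶠ y in 𝓝 x₀ ⊓ ae volume, |F y| ≤ η / 2 := by
    have := Metric.tendsto_nhds.1 hF (η / 2) (by positivity)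
    filter_upwards [this] with y hy
    rw [Real.dist_0_eq_abs] at hy; exact hy.le
  filter_upwards [hρ.eventually_abs_mollAverage_le hT hx₀ h] with q hq
  rw [Real.dist_0_eq_abs]; linarith

end IsMollifierFamily

/-- The filter `𝓝 x₀ ⊓ ae volume` encodes "almost everywhere near `x₀`", so that limits which ignore
null sets can be handled by the ordinary filter calculus. -/
theorem eventually_inf_ae_iff {p : Euc d → Prop} :
    (∀ᶠ y in 𝓝 x₀ ⊓ ae volume, p y) ↔ ∃ r > 0, ∀ᵐ y, y ∈ Metric.ball x₀ r → p y := by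
  constructor
  · rintro ⟨s, hs, t, ht, hst⟩
    obtain ⟨r, hr, hrs⟩ := Metric.mem_nhds_iff.1 hs
    refine ⟨r, hr, ?_⟩
    filter_upwards [ht] with y hy hyr
    have : y ∈ s ∩ t := ⟨hrs hyr, hy⟩
    rw [← hst] at this; exact this
  · rintro ⟨r, hr, h⟩
    have h1 : ∀ᶠ y in 𝓝 x₀ ⊓ ae volume, y ∈ Metric.ball x₀ r :=
      mem_inf_of_left (Metric.ball_mem_nhds _ hr)
    have h2 : ∀ᶠ y in 𝓝 x₀ ⊓ ae volume, y ∈ Metric.ball x₀ r → p y := mem_inf_of_right h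
    filter_upwards [h1, h2] with y hy hy' using hy' hy

theorem ae_of_eventually_inf_ae {μ : Measure (Euc d)} {r : ℝ} {p : Euc d → Prop}
    (h : ∀ᵐ y ∂μ, y ∈ Metric.ball x₀ r → p y) : ∀ᵐ y ∂(μ.restrict (Metric.ball x₀ r)), p y :=
  (ae_restrict_iff' Metric.isOpen_ball.measurableSet).2 h

namespace LocEssBounded

theorem of_continuousAt (h : ∀ᶠ y in 𝓝 x₀, ContinuousAt F y) : LocEssBounded F x₀ where
  meas := by
    obtain ⟨s, hs, hso, hx⟩ := _root_.mem_nhds_iff.1 h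
    refine ⟨s, hso.mem_nhds hx, ContinuousOn.aestronglyMeasurable ?_ hso.measurableSet⟩
    exact fun y hy => (hs hy).continuousWithinAt
  bdd := by
    refine ⟨|F x₀| + 1, mem_inf_of_left ?_⟩
    have := h.self_of_nhds.abs.eventually (gt_mem_nhds (lt_add_one |F x₀|))
    filter_upwards [this] with y hy using hy.le

theorem const (c : ℝ) : LocEssBounded (fun _ => c) x₀ :=
  of_continuousAt (Eventually.of_forall fun _ => continuousAt_const)

theorem congr (hF : LocEssBounded F x₀) (h : F =ᶠ[𝓝 x₀ ⊓ ae volume] G) : LocEssBounded G x₀ where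
  meas := by
    obtain ⟨s, hs, hsm⟩ := hF.meas
    obtain ⟨r, hr, hr'⟩ := eventually_inf_ae_iff.1 h
    refine ⟨s ∩ Metric.ball x₀ r, inter_mem hs (Metric.ball_mem_nhds _ hr), ?_⟩
    refine (hsm.mono_measure (Measure.restrict_mono inter_subset_left le_rfl)).congr ?_
    exact ae_mono (Measure.restrict_mono inter_subset_right le_rfl) (ae_of_eventually_inf_ae hr')
  bdd := by
    obtain ⟨C, hC⟩ := hF.bdd
    refine ⟨C, ?_⟩
    filter_upwards [hC, h] with y h1 h2
    rwa [← h2]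

theorem add (hF : LocEssBounded F x₀) (hG : LocEssBounded G x₀) :
    LocEssBounded (fun y => F y + G y) x₀ where
  meas := by
    obtain ⟨s, hs, hsm⟩ := hF.meas
    obtain ⟨t, ht, htm⟩ := hG.meas
    exact ⟨s ∩ t, inter_mem hs ht,
      (hsm.mono_measure (Measure.restrict_mono inter_subset_left le_rfl)).add
      (htm.mono_measure (Measure.restrict_mono inter_subset_right le_rfl))⟩
  bdd := by
    obtain ⟨C, hC⟩ := hF.bdd
    obtain ⟨C', hC'⟩ := hG.bdd
    refine ⟨C + C', ?_⟩
    filter_upwards [hC, hC'] with y h1 h2 using (abs_add_le _ _).trans (add_le_add h1 h2)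

theorem mul (hF : LocEssBounded F x₀) (hG : LocEssBounded G x₀) :
    LocEssBounded (fun y => F y * G y) x₀ where
  meas := by
    obtain ⟨s, hs, hsm⟩ := hF.meas
    obtain ⟨t, ht, htm⟩ := hG.meas
    exact ⟨s ∩ t, inter_mem hs ht,
      (hsm.mono_measure (Measure.restrict_mono inter_subset_left le_rfl)).mul
      (htm.mono_measure (Measure.restrict_mono inter_subset_right le_rfl))⟩
  bdd := by
    obtain ⟨C, hC⟩ := hF.bdd
    obtain ⟨C', hC'⟩ := hG.bdd
    refine ⟨C * C', ?_⟩
    filter_upwards [hC, hC'] with y h1 h2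
    rw [abs_mul]
    exact mul_le_mul h1 h2 (abs_nonneg _) ((abs_nonneg _).trans h1)

theorem const_mul (hF : LocEssBounded F x₀) (c : ℝ) : LocEssBounded (fun y => c * F y) x₀ :=
  (const c).mul hF

theorem sum {κ : Type*} (s : Finset κ) {F : κ → Euc d → ℝ}
    (hF : ∀ i ∈ s, LocEssBounded (F i) x₀) : LocEssBounded (fun y => ∑ i ∈ s, F i y) x₀ := by
  classical
  induction s using Finset.induction_on with
  | empty => simpa using const (x₀ := x₀) 0
  | insert a s ha ih =>
    simp only [Finset.sum_insert ha]
    exact (hF a (Finset.mem_insert_self a s)).add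
      (ih fun i hi => hF i (Finset.mem_insert_of_mem hi))

/-- The products with the mollifiers are integrable, for points close to `x₀`. -/
theorem eventually_integrable (hF : LocEssBounded F x₀) (hρ : IsMollifierFamily ρ) :
    ∀ᶠ q : ℝ × Euc d in 𝓝[>] 0 ×ˢ 𝓝 x₀, Integrable (fun y => F y * ρ q.1 (q.2 - y)) := by
  obtain ⟨s, hs, hsm⟩ := hF.meas
  obtain ⟨C, hC⟩ := hF.bdd
  obtain ⟨r, hr, hr'⟩ := eventually_inf_ae_iff.1 hC
  filter_upwards [eventually_ball_subset (inter_mem hs (Metric.ball_mem_nhds x₀ hr))] with q hq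
  have hcont : Continuous fun y => ρ q.1 (q.2 - y) :=
    (hρ.continuous _ hq.1).comp (continuous_const.sub continuous_id)
  have h0 : ∀ y ∉ Metric.ball q.2 q.1, F y * ρ q.1 (q.2 - y) = 0 := by
    intro y hy
    rw [hρ.eq_zero _ hq.1, mul_zero]
    rwa [Metric.mem_ball, not_lt, dist_comm, dist_eq_norm] at hy
  rw [← integrableOn_iff_integrable_of_support_subset
    (s := Metric.ball q.2 q.1) (Function.support_subset_iff'.2 h0)]
  refine Integrable.mono' (((hρ.integrable_sub hq.1 q.2).const_mul C).restrict) ?_ ?_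
  · exact (hsm.mono_measure (Measure.restrict_mono (hq.2.trans inter_subset_left) le_rfl)).mul
      hcont.aestronglyMeasurable
  · refine (ae_restrict_iff' Metric.isOpen_ball.measurableSet).2 ?_
    filter_upwards [hr'] with y hy hyb
    rw [norm_mul, Real.norm_eq_abs, Real.norm_of_nonneg (hρ.nonneg _ hq.1 _)]
    exact mul_le_mul_of_nonneg_right (hy (hq.2 hyb).2) (hρ.nonneg _ hq.1 _)

theorem eventually_mollAverage_add (hF : LocEssBounded F x₀) (hG : LocEssBounded G x₀)
    (hρ : IsMollifierFamily ρ) :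
    ∀ᶠ q : ℝ × Euc d in 𝓝[>] 0 ×ˢ 𝓝 x₀,
      mollAverage ρ T (fun y => F y + G y) q.1 q.2 =
        mollAverage ρ T F q.1 q.2 + mollAverage ρ T G q.1 q.2 := by
  filter_upwards [hF.eventually_integrable hρ, hG.eventually_integrable hρ] with q h1 h2
  unfold mollAverage
  rw [← integral_add h1.restrict h2.restrict]
  simp only [add_mul]

end LocEssBounded

theorem mollAverage_const_mul (c : ℝ) (ε : ℝ) (x : Euc d) :
    mollAverage ρ T (fun y => c * F y) ε x = c * mollAverage ρ T F ε x := by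
  unfold mollAverage
  rw [← integral_const_mul]
  simp only [mul_assoc]

/-- If `F - G` tends to zero at `x₀` almost everywhere, so does the difference of the averages. -/
theorem IsMollifierFamily.tendsto_mollAverage_sub (hρ : IsMollifierFamily ρ) (hT : IsOpen T)
    (hx₀ : x₀ ∈ T) (hF : LocEssBounded F x₀) (hG : LocEssBounded G x₀)
    (h : Tendsto (fun y => F y - G y) (𝓝 x₀ ⊓ ae volume) (𝓝 0)) :
    Tendsto (fun q : ℝ × Euc d => mollAverage ρ T F q.1 q.2 - mollAverage ρ T G q.1 q.2)
      (𝓝[>] 0 ×ˢ 𝓝 x₀) (𝓝 0) := by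
  refine (hρ.tendsto_mollAverage_zero hT hx₀ h).congr' ?_
  filter_upwards [hF.eventually_mollAverage_add (T := T) (hG.const_mul (-1)) hρ] with q hq
  rw [mollAverage_const_mul] at hq
  rw [show mollAverage ρ T (fun y => F y - G y) q.1 q.2 =
    mollAverage ρ T (fun y => F y + (-1) * G y) q.1 q.2 by congr 1; ext y; ring, hq]
  ring

theorem IsMollifierFamily.eventually_mollAverage_const (hρ : IsMollifierFamily ρ) (hT : IsOpen T)
    (hx₀ : x₀ ∈ T) (c : ℝ) :
    ∀ᶠ q : ℝ × Euc d in 𝓝[>] 0 ×ˢ 𝓝 x₀, mollAverage ρ T (fun _ => c) q.1 q.2 = c := by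
  filter_upwards [eventually_ball_subset (hT.mem_nhds hx₀)] with q hq
  unfold mollAverage
  rw [integral_const_mul, hρ.setIntegral_eq_one hq.1 hq.2, mul_one]

/-- Near `x₀` and at small scales constants are reproduced exactly, so it suffices to subtract `c`
and use that averages of a function tending to zero tend to zero. -/
theorem IsMollifierFamily.tendsto_mollAverage (hρ : IsMollifierFamily ρ) (hT : IsOpen T)
    (hx₀ : x₀ ∈ T) (hF : LocEssBounded F x₀) {c : ℝ}
    (h : Tendsto F (𝓝 x₀ ⊓ ae volume) (𝓝 c)) :
    Tendsto (fun q : ℝ × Euc d => mollAverage ρ T F q.1 q.2) (𝓝[>] 0 ×ˢ 𝓝 x₀) (𝓝 c) := by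
  have h1 := hρ.tendsto_mollAverage_sub hT hx₀ hF (LocEssBounded.const c)
    (by simpa using h.sub_const c)
  have h2 := h1.add_const c
  rw [zero_add] at h2
  refine h2.congr' ?_
  filter_upwards [hρ.eventually_mollAverage_const hT hx₀ c] with q hq
  rw [hq]; ring

theorem IsMollifierFamily.tendsto_mollAverage_of_continuousAt (hρ : IsMollifierFamily ρ)
    (hT : IsOpen T) (hx₀ : x₀ ∈ T) (hF : ∀ᶠ y in 𝓝 x₀, ContinuousAt F y) :
    Tendsto (fun q : ℝ × Euc d => mollAverage ρ T F q.1 q.2) (𝓝[>] 0 ×ˢ 𝓝 x₀) (𝓝 (F x₀)) :=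
  hρ.tendsto_mollAverage hT hx₀ (.of_continuousAt hF)
    (hF.self_of_nhds.tendsto.mono_left inf_le_left)

/-- A function which is almost everywhere `≤ c` near `x₀` has averages `≤ c`. -/
theorem IsMollifierFamily.eventually_mollAverage_mono (hρ : IsMollifierFamily ρ)
    (hF : LocEssBounded F x₀) (hG : LocEssBounded G x₀)
    (hT : IsOpen T) (hx₀ : x₀ ∈ T) (h : ∀ᶠ y in 𝓝 x₀ ⊓ ae volume, F y ≤ G y) :
    ∀ᶠ q : ℝ × Euc d in 𝓝[>] 0 ×ˢ 𝓝 x₀, mollAverage ρ T F q.1 q.2 ≤ mollAverage ρ T G q.1 q.2 := by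
  obtain ⟨r, hr, hr'⟩ := eventually_inf_ae_iff.1 h
  filter_upwards [hF.eventually_integrable hρ, hG.eventually_integrable hρ,
    eventually_ball_subset (inter_mem (hT.mem_nhds hx₀) (Metric.ball_mem_nhds x₀ hr))]
    with q h1 h2 hq
  refine integral_mono_ae h1.restrict h2.restrict (ae_restrict_of_ae ?_)
  filter_upwards [hr'] with y hy
  by_cases hyb : y ∈ Metric.ball q.2 q.1
  · exact mul_le_mul_of_nonneg_right (hy (hq.2 hyb).2) (hρ.nonneg _ hq.1 _)
  · have h0 : ρ q.1 (q.2 - y) = 0 := by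
      refine hρ.eq_zero _ hq.1 _ ?_
      rwa [Metric.mem_ball, not_lt, dist_comm, dist_eq_norm] at hyb
    simp [h0]

end Averages

/-- `F` is Lipschitz in a neighbourhood of `x`. -/
def LipschitzNear {d : ℕ} (F : Euc d → ℝ) (x : Euc d) : Prop :=
  ∃ K, ∃ s ∈ 𝓝 x, LipschitzOnWith K F s

/-! ### Differentiating averages of Lipschitz functions. -/

section LipschitzAverages

variable {d : ℕ} {ρ : ℝ → Euc d → ℝ} {T : Set (Euc d)} {F G : Euc d → ℝ} {x₀ : Euc d}

/-- The substitution y = x - z moves the parameter into `G`. The Lipschitz bound dominates the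
difference quotients and Rademacher's theorem gives their limits for almost every z, so the
mollifier need only be continuous. -/
theorem IsMollifierFamily.hasFDerivAt_integral (hρ : IsMollifierFamily ρ) {K : NNReal}
    (hG : LipschitzWith K G) {ε : ℝ} (hε : 0 < ε) (x : Euc d) :
    ∃ L : Euc d →L[ℝ] ℝ, HasFDerivAt (fun x => ∫ y, G y * ρ ε (x - y)) L x ∧
      ∀ v, L v = ∫ y, fderiv ℝ G y v * ρ ε (x - y) := by
  have hcc : HasCompactSupport (ρ ε) :=
    HasCompactSupport.intro (isCompact_closedBall 0 ε) fun y hy => hρ.eq_zero ε hε y <| by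
      rw [mem_closedBall_zero_iff, not_le] at hy; exact hy.le
  have hc := hρ.continuous ε hε
  have hdiff : ∀ᵐ z : Euc d, DifferentiableAt ℝ G (x - z) :=
    (Measure.measurePreserving_sub_left volume x).quasiMeasurePreserving.ae hG.ae_differentiableAt
  have key := hasFDerivAt_integral_of_dominated_loc_of_lip (𝕜 := ℝ) (μ := volume)
    (F := fun x z => G (x - z) * ρ ε z) (x₀ := x) (bound := fun z => K * ρ ε z) (s := univ)
    (F' := fun z => ρ ε z • fderiv ℝ G (x - z)) univ_mem
    (Eventually.of_forall fun x =>
      ((hG.continuous.comp (continuous_const.sub continuous_id)).mul hc).aestronglyMeasurable)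
    (((hG.continuous.comp (continuous_const.sub continuous_id)).mul hc).integrable_of_hasCompactSupport
      hcc.mul_left)
    (hc.measurable.smul ((measurable_fderiv ℝ G).comp
      (measurable_const.sub measurable_id))).aestronglyMeasurable
    (Eventually.of_forall fun z => ?_) ((hρ.integrable hε).const_mul _)
    (by
      filter_upwards [hdiff] with z hz
      have h1 : HasFDerivAt (fun x' : Euc d => G (x' - z)) (fderiv ℝ G (x - z)) x :=
        by
        simpa using! hz.hasFDerivAt.comp x ((hasFDerivAt_id x).sub_const z)
      exact h1.mul_const (ρ ε z))
  · have hsub : ∀ (f : Euc d → ℝ) (x : Euc d),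
        ∫ y, f y * ρ ε (x - y) = ∫ z, f (x - z) * ρ ε z := fun f x => by
      rw [← integral_sub_left_eq_self (fun y => f y * ρ ε (x - y)) volume x]
      simp only [sub_sub_cancel]
    refine ⟨∫ z, ρ ε z • fderiv ℝ G (x - z), ?_, ?_⟩
    · simp only [hsub]
      exact key.2
    · intro v
      rw [ContinuousLinearMap.integral_apply key.1, hsub]
      simp only [smul_eq_mul, FunLike.coe_smul, Pi.smul_apply, mul_comm]
  · refine LipschitzOnWith.of_dist_le_mul fun a _ b _ => ?_
    have h0 := hρ.nonneg ε hε z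
    rw [Real.dist_eq, ← sub_mul, abs_mul, abs_of_nonneg h0, Real.coe_nnabs,
      abs_of_nonneg (a := (K : ℝ) * ρ ε z) (mul_nonneg K.2 h0), mul_right_comm, ← Real.dist_eq]
    refine mul_le_mul_of_nonneg_right ?_ h0
    simpa using hG.dist_le_mul (a - z) (b - z)

namespace LipschitzNear

theorem exists_ball (hF : LipschitzNear F x₀) :
    ∃ K, ∃ r > 0, LipschitzOnWith K F (Metric.ball x₀ r) := by
  obtain ⟨K, s, hs, h⟩ := hF
  obtain ⟨r, hr, hrs⟩ := Metric.mem_nhds_iff.1 hs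
  exact ⟨K, r, hr, h.mono hrs⟩

theorem eventually_differentiableAt (hF : LipschitzNear F x₀) :
    ∀ᶠ y in 𝓝 x₀ ⊓ ae volume, DifferentiableAt ℝ F y := by
  obtain ⟨K, r, hr, h⟩ := hF.exists_ball
  refine eventually_inf_ae_iff.2 ⟨r, hr, ?_⟩
  filter_upwards [h.ae_differentiableWithinAt_of_mem (μ := volume)] with y hy hyr
  exact (hy hyr).differentiableAt (Metric.isOpen_ball.mem_nhds hyr)

theorem exists_norm_fderiv_le (hF : LipschitzNear F x₀) :
    ∃ C, ∀ᶠ y in 𝓝 x₀, ‖fderiv ℝ F y‖ ≤ C := by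
  obtain ⟨K, r, hr, h⟩ := hF.exists_ball
  refine ⟨K, ?_⟩
  filter_upwards [Metric.ball_mem_nhds x₀ hr] with y hy
  exact norm_fderiv_le_of_lipschitzOn ℝ (Metric.isOpen_ball.mem_nhds hy) h

theorem locEssBounded_fderiv (hF : LipschitzNear F x₀) (v : Euc d) :
    LocEssBounded (fun y => fderiv ℝ F y v) x₀ where
  meas := ⟨univ, univ_mem, (measurable_fderiv_apply_const ℝ F v).aestronglyMeasurable⟩
  bdd := by
    obtain ⟨C, hC⟩ := hF.exists_norm_fderiv_le
    refine ⟨C * ‖v‖, mem_inf_of_left ?_⟩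
    filter_upwards [hC] with y hy
    exact ((fderiv ℝ F y).le_opNorm v).trans (mul_le_mul_of_nonneg_right hy (norm_nonneg v))

theorem eventually_continuousAt (hF : LipschitzNear F x₀) : ∀ᶠ y in 𝓝 x₀, ContinuousAt F y := by
  obtain ⟨K, r, hr, h⟩ := hF.exists_ball
  filter_upwards [Metric.isOpen_ball.mem_nhds (Metric.mem_ball_self hr)] with y hy
  exact h.continuousOn.continuousAt (Metric.isOpen_ball.mem_nhds hy)

theorem of_contDiffAt (hF : ContDiffAt ℝ 1 F x₀) : LipschitzNear F x₀ := by
  obtain ⟨K, s, hs, h⟩ := hF.exists_lipschitzOnWith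
  exact ⟨K, s, hs, h⟩

theorem mul (hF : LipschitzNear F x₀) (hG : LipschitzNear G x₀) :
    LipschitzNear (fun y => F y * G y) x₀ := by
  obtain ⟨K, s, hs, h⟩ := hF
  obtain ⟨K', s', hs', h'⟩ := hG
  have h1 : ∀ᶠ y in 𝓝 x₀, |F y| ≤ |F x₀| + 1 := by
    have := (h.continuousOn.continuousAt hs).abs.eventually (gt_mem_nhds (lt_add_one |F x₀|))
    filter_upwards [this] with y hy using hy.le
  have h2 : ∀ᶠ y in 𝓝 x₀, |G y| ≤ |G x₀| + 1 := by
    have := (h'.continuousOn.continuousAt hs').abs.eventually (gt_mem_nhds (lt_add_one |G x₀|))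
    filter_upwards [this] with y hy using hy.le
  refine ⟨Real.toNNReal ((|F x₀| + 1) * K' + (|G x₀| + 1) * K), s ∩ s' ∩
    ({y | |F y| ≤ |F x₀| + 1} ∩ {y | |G y| ≤ |G x₀| + 1}),
    inter_mem (inter_mem hs hs') (inter_mem h1 h2), LipschitzOnWith.of_dist_le_mul ?_⟩
  rintro a ⟨⟨ha, ha'⟩, ha1, ha2⟩ b ⟨⟨hb, hb'⟩, hb1, hb2⟩
  rw [Real.coe_toNNReal _ (by positivity)]
  have e : F a * G a - F b * G b = F a * (G a - G b) + G b * (F a - F b) := by ring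
  rw [Real.dist_eq, e]
  refine (abs_add_le _ _).trans ?_
  rw [abs_mul, abs_mul, add_mul, mul_assoc, mul_assoc]
  have d1 := h.dist_le_mul a ha b hb
  have d2 := h'.dist_le_mul a ha' b hb'
  rw [Real.dist_eq] at d1 d2
  exact add_le_add (mul_le_mul ha1 d2 (abs_nonneg _) (by positivity))
    (mul_le_mul hb2 d1 (abs_nonneg _) (by positivity))

end LipschitzNear

/-- The average of a Lipschitz function is differentiable, with derivative the average of the
almost everywhere defined derivative. -/
theorem IsMollifierFamily.eventually_hasFDerivAt_mollAverage (hρ : IsMollifierFamily ρ)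
    (hT : IsOpen T) (hx₀ : x₀ ∈ T) (hF : LipschitzNear F x₀) :
    ∀ᶠ q : ℝ × Euc d in 𝓝[>] 0 ×ˢ 𝓝 x₀, ∃ L : Euc d →L[ℝ] ℝ,
      HasFDerivAt (mollAverage ρ T F q.1) L q.2 ∧
      ∀ v, L v = mollAverage ρ T (fun y => fderiv ℝ F y v) q.1 q.2 := by
  obtain ⟨K, r, hr, h⟩ := hF.exists_ball
  obtain ⟨r', hr', hrT⟩ := Metric.mem_nhds_iff.1
    (inter_mem (hT.mem_nhds hx₀) (Metric.ball_mem_nhds x₀ hr))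
  -- A globally Lipschitz extension replaces `F`, so that the integral over the whole space can be
  -- differentiated. At small scales the average does not see the difference.
  obtain ⟨G, hG, hFG⟩ := (h.mono (hrT.trans inter_subset_right)).extend_real
  have hVT : Metric.ball x₀ r' ⊆ T := hrT.trans inter_subset_left
  -- the integrals of functions agreeing near `x₀` agree
  have hcongr : ∀ (A B : Euc d → ℝ), EqOn A B (Metric.ball x₀ r') → ∀ ε > 0, ∀ x,
      Metric.ball x ε ⊆ Metric.ball x₀ r' →
      mollAverage ρ T A ε x = ∫ y, B y * ρ ε (x - y) := by
    intro A B hAB ε hε x hx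
    have h0 : ∀ y ∉ Metric.ball x ε, ρ ε (x - y) = 0 := fun y hy => by
      refine hρ.eq_zero _ hε _ ?_
      rwa [Metric.mem_ball, not_lt, dist_comm, dist_eq_norm] at hy
    unfold mollAverage
    rw [setIntegral_eq_integral_of_forall_compl_eq_zero]
    · congr 1; ext y
      by_cases hy : y ∈ Metric.ball x ε
      · rw [hAB (hx hy)]
      · rw [h0 y hy, mul_zero, mul_zero]
    · intro y hy
      rw [h0 y fun h' => hy (hVT (hx h')), mul_zero]
  have hev : ∀ᶠ ε : ℝ in 𝓝[>] 0, 0 < ε ∧ ε < r' / 2 :=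
    (eventually_mem_nhdsWithin).and
      (mem_nhdsWithin_of_mem_nhds (Iio_mem_nhds (by positivity)))
  filter_upwards [hev.prod_mk (Metric.isOpen_ball.eventually_mem
    (Metric.mem_ball_self (x := x₀) (half_pos hr')))] with q ⟨hq, hq2⟩
  have hsub : ∀ x ∈ Metric.ball x₀ (r' / 2), Metric.ball x q.1 ⊆ Metric.ball x₀ r' :=
    fun x hx => Metric.ball_subset_ball' (by rw [Metric.mem_ball] at hx; linarith [hq.2])
  obtain ⟨L, hL, hLv⟩ := hρ.hasFDerivAt_integral hG hq.1 q.2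
  refine ⟨L, hL.congr_of_eventuallyEq ?_, fun v => ?_⟩
  · have hcont : ∀ᶠ x in 𝓝 q.2, Metric.ball x q.1 ⊆ Metric.ball x₀ r' := by
      filter_upwards [Metric.isOpen_ball.mem_nhds hq2] with x hx using hsub x hx
    filter_upwards [hcont] with x hx
    exact hcongr F G hFG q.1 hq.1 x hx
  · rw [hLv]
    refine (hcongr _ _ (fun y hy => ?_) q.1 hq.1 q.2 (hsub _ hq2)).symm
    have : F =ᶠ[𝓝 y] G := by
      filter_upwards [Metric.isOpen_ball.mem_nhds hy] with z hz using hFG hz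
    simp only [this.fderiv_eq]

end LipschitzAverages

/-! ### Commuting derivatives, coefficients and convolutions across a change of charts. -/

section KeyLemma

variable {d : ℕ} {ρ : ℝ → Euc d → ℝ} {T : Set (Euc d)} {x₀ y₀ : Euc d} {κ : Euc d → Euc d}

theorem tendsto_prodMk_of_continuousAt (hκ : ContinuousAt κ y₀) (hx : κ y₀ = x₀) :
    Tendsto (fun q : ℝ × Euc d => (q.1, κ q.2)) (𝓝[>] 0 ×ˢ 𝓝 y₀) (𝓝[>] 0 ×ˢ 𝓝 x₀) :=
  tendsto_fst.prodMk ((hx ▸ hκ.tendsto).comp tendsto_snd)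

theorem eventually_contDiffAt_one {E F : Type*} [NormedAddCommGroup E] [NormedSpace ℝ E]
    [NormedAddCommGroup F] [NormedSpace ℝ F] {c : E → F} {y : E}
    (hc : ContDiffAt ℝ 1 c y) : ∀ᶠ z in 𝓝 y, ContDiffAt ℝ 1 c z :=
  hc.eventually (by simp)

theorem continuousAt_fderiv_apply {E F : Type*} [NormedAddCommGroup E] [NormedSpace ℝ E]
    [NormedAddCommGroup F] [NormedSpace ℝ F] {c : E → F} {y : E}
    (hc : ContDiffAt ℝ 1 c y) (a : E) : ContinuousAt (fun z => fderiv ℝ c z a) y :=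
  (hc.continuousAt_fderiv one_ne_zero).clm_apply continuousAt_const

/-- This is the freezing principle of the whole proof: a convergent coefficient may be replaced by
its limit in front of a factor that is bounded but has no limit, such as a derivative of a Lipschitz
function or its average. -/
theorem tendsto_sub_mul_of_bounded {ι : Type*} {l : Filter ι} {c u : ι → ℝ} {c₀ C : ℝ}
    (hc : Tendsto c l (𝓝 c₀)) (hu : ∀ᶠ q in l, |u q| ≤ C) :
    Tendsto (fun q => c q * u q - c₀ * u q) l (𝓝 0) := by
  have h1 : Tendsto (fun q => c q - c₀) l (𝓝 0) := by simpa using hc.sub_const c₀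
  have h2 : IsBoundedUnder (· ≤ ·) l (norm ∘ u) := ⟨C, hu⟩
  refine (h1.zero_mul_isBoundedUnder_le h2).congr fun q => ?_
  ring

theorem sum_apply_eq {d : ℕ} (L : Euc d →L[ℝ] ℝ) (v : Euc d) :
    L v = ∑ l, v l * L (EuclideanSpace.single l 1) := by
  conv_lhs => rw [show v = ∑ l, v l • EuclideanSpace.single l (1 : ℝ) from by
    ext j; simp [Finset.sum_apply, Pi.single_apply]]
  simp

/-- Derivative of the product of a smooth function with an average, in a moving chart. -/
theorem IsMollifierFamily.tendsto_fderiv_mul_mollAverage (hρ : IsMollifierFamily ρ)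
    (hT : IsOpen T) (hx₀ : x₀ ∈ T) (hκ : ContDiffAt ℝ 1 κ y₀) (hκx : κ y₀ = x₀)
    {c B : Euc d → ℝ} (hc : ContDiffAt ℝ 1 c y₀) (hB : LipschitzNear B x₀) (a : Euc d) :
    (∀ᶠ q : ℝ × Euc d in 𝓝[>] 0 ×ˢ 𝓝 y₀,
      DifferentiableAt ℝ (fun y => c y * mollAverage ρ T B q.1 (κ y)) q.2) ∧
    Tendsto (fun q : ℝ × Euc d =>
      fderiv ℝ (fun y => c y * mollAverage ρ T B q.1 (κ y)) q.2 a -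
        c y₀ * mollAverage ρ T (fun x => fderiv ℝ B x (fderiv ℝ κ y₀ a)) q.1 (κ q.2))
      (𝓝[>] 0 ×ˢ 𝓝 y₀) (𝓝 (fderiv ℝ c y₀ a * B x₀)) := by
  have hl := tendsto_prodMk_of_continuousAt hκ.continuousAt hκx
  have hder := hl.eventually (hρ.eventually_hasFDerivAt_mollAverage hT hx₀ hB)
  have hcd := ((eventually_contDiffAt_one hc).and (eventually_contDiffAt_one hκ)).prod_inr
    (𝓝[>] (0 : ℝ))
  have hformula : ∀ᶠ q : ℝ × Euc d in 𝓝[>] 0 ×ˢ 𝓝 y₀,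
      DifferentiableAt ℝ (fun y => c y * mollAverage ρ T B q.1 (κ y)) q.2 ∧
      fderiv ℝ (fun y => c y * mollAverage ρ T B q.1 (κ y)) q.2 a =
        fderiv ℝ c q.2 a * mollAverage ρ T B q.1 (κ q.2) +
        ∑ l, (c q.2 * (fderiv ℝ κ q.2 a) l) *
          mollAverage ρ T (fun y => fderiv ℝ B y (EuclideanSpace.single l 1)) q.1 (κ q.2) := by
    filter_upwards [hder, hcd] with q ⟨L, hL, hLv⟩ ⟨hc', hκ'⟩
    have h1 : HasFDerivAt (fun y => mollAverage ρ T B q.1 (κ y)) (L.comp (fderiv ℝ κ q.2)) q.2 :=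
      HasFDerivAt.comp (f := κ) q.2 hL (hκ'.differentiableAt one_ne_zero).hasFDerivAt
    have h2 := (hc'.differentiableAt one_ne_zero).hasFDerivAt.fun_mul h1
    refine ⟨h2.differentiableAt, ?_⟩
    rw [h2.fderiv]
    simp only [FunLike.coe_add, FunLike.coe_smul, Pi.add_apply, Pi.smul_apply, smul_eq_mul,
      ContinuousLinearMap.comp_apply]
    rw [sum_apply_eq L, Finset.mul_sum, add_comm]
    congr 1
    · ring
    · refine Finset.sum_congr rfl fun l _ => ?_
      rw [hLv]; ring
  refine ⟨hformula.mono fun q hq => hq.1, ?_⟩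
  -- the derivative of the coefficient
  have t1 : Tendsto (fun q : ℝ × Euc d => fderiv ℝ c q.2 a * mollAverage ρ T B q.1 (κ q.2))
      (𝓝[>] 0 ×ˢ 𝓝 y₀) (𝓝 (fderiv ℝ c y₀ a * B x₀)) :=
    ((continuousAt_fderiv_apply hc a).tendsto.comp tendsto_snd).mul
      ((hρ.tendsto_mollAverage_of_continuousAt hT hx₀ hB.eventually_continuousAt).comp hl)
  -- the derivative of the average
  have t2 : ∀ l, Tendsto (fun q : ℝ × Euc d => (c q.2 * (fderiv ℝ κ q.2 a) l) *
        mollAverage ρ T (fun y => fderiv ℝ B y (EuclideanSpace.single l 1)) q.1 (κ q.2) -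
        (c y₀ * (fderiv ℝ κ y₀ a) l) *
        mollAverage ρ T (fun y => fderiv ℝ B y (EuclideanSpace.single l 1)) q.1 (κ q.2))
      (𝓝[>] 0 ×ˢ 𝓝 y₀) (𝓝 0) := by
    intro l
    obtain ⟨C, hC⟩ := (hB.locEssBounded_fderiv (EuclideanSpace.single l 1)).bdd
    refine tendsto_sub_mul_of_bounded ?_
      (hl.eventually (hρ.eventually_abs_mollAverage_le hT hx₀ hC))
    have h1 : ContinuousAt (fun y => (fderiv ℝ κ y a) l) y₀ :=
      (EuclideanSpace.proj (𝕜 := ℝ) l).continuous.continuousAt.comp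
        (continuousAt_fderiv_apply hκ a)
    exact ((hc.continuousAt.mul h1).tendsto).comp tendsto_snd
  -- Linearity of this average in the direction is read off from the derivative `L` that represents
  -- it, so no integrability has to be discussed.
  have hsum : ∀ᶠ q : ℝ × Euc d in 𝓝[>] 0 ×ˢ 𝓝 y₀,
      mollAverage ρ T (fun x => fderiv ℝ B x (fderiv ℝ κ y₀ a)) q.1 (κ q.2) =
      ∑ l, (fderiv ℝ κ y₀ a) l *
        mollAverage ρ T (fun y => fderiv ℝ B y (EuclideanSpace.single l 1)) q.1 (κ q.2) := by
    filter_upwards [hder] with q ⟨L, hL, hLv⟩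
    rw [← hLv, sum_apply_eq L]
    simp only [hLv]
  have t3 := t1.add (tendsto_finsetSum Finset.univ fun l _ => t2 l)
  simp only [Finset.sum_const_zero, add_zero] at t3
  refine t3.congr' ?_
  filter_upwards [hformula, hsum] with q hq hs
  rw [hq.2, hs, Finset.mul_sum, Finset.sum_sub_distrib, add_sub_assoc]
  congr 3
  funext l
  ring

variable {ι : Type*} [Fintype ι]

/-- The first derivative of `χ ∑ cᵢ ((ξ bᵢ) ⋆ ρ_ε)` compared with the average of the first
derivative of `∑ cᵢ bᵢ`. -/
theorem IsMollifierFamily.tendsto_fderiv_sum_sub (hρ : IsMollifierFamily ρ)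
    (hT : IsOpen T) (hx₀ : x₀ ∈ T) (hκ : ContDiffAt ℝ 1 κ y₀) (hκx : κ y₀ = x₀)
    {χ ξ : Euc d → ℝ} (hχ : ContDiffAt ℝ 1 χ y₀) (hξ : ContDiffAt ℝ 1 ξ x₀)
    {c b A C : ι → Euc d → ℝ} {V : Euc d → Euc d} {f : Euc d → ℝ}
    (hc : ∀ i, ContDiffAt ℝ 1 (c i) y₀) (hb : ∀ i, LipschitzNear (b i) x₀) (a : Euc d)
    (hA : ∀ i, ∀ᶠ x in 𝓝 x₀, ContinuousAt (A i) x) (hC : ∀ i, ∀ᶠ x in 𝓝 x₀, ContinuousAt (C i) x)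
    (hV : ∀ᶠ x in 𝓝 x₀, ContinuousAt V x) (hA₀ : ∀ i, A i x₀ = fderiv ℝ (c i) y₀ a)
    (hC₀ : ∀ i, C i x₀ = c i y₀) (hV₀ : V x₀ = fderiv ℝ κ y₀ a)
    (hf : ∀ᶠ x in 𝓝 x₀ ⊓ ae volume, f x = ∑ i, (A i x * b i x + C i x * fderiv ℝ (b i) x (V x))) :
    LocEssBounded f x₀ ∧
    (∀ᶠ q : ℝ × Euc d in 𝓝[>] 0 ×ˢ 𝓝 y₀, DifferentiableAt ℝ (fun y =>
      χ y * ∑ i, c i y * mollAverage ρ T (fun x => ξ x * b i x) q.1 (κ y)) q.2) ∧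
    Tendsto (fun q : ℝ × Euc d =>
      fderiv ℝ (fun y => χ y * ∑ i, c i y * mollAverage ρ T (fun x => ξ x * b i x) q.1 (κ y)) q.2 a -
        χ q.2 * mollAverage ρ T (fun x => ξ x * f x) q.1 (κ q.2)) (𝓝[>] 0 ×ˢ 𝓝 y₀)
      (𝓝 ((∑ i, c i y₀ * b i x₀) *
        (fderiv ℝ χ y₀ a * ξ x₀ + χ y₀ * fderiv ℝ ξ x₀ (fderiv ℝ κ y₀ a)))) := by
  have hl := tendsto_prodMk_of_continuousAt hκ.continuousAt hκx
  set v := fderiv ℝ κ y₀ a with hv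
  have hξb : ∀ i, LipschitzNear (fun x => ξ x * b i x) x₀ := fun i =>
    (LipschitzNear.of_contDiffAt hξ).mul (hb i)
  have hbc : ∀ i, LocEssBounded (b i) x₀ := fun i => .of_continuousAt (hb i).eventually_continuousAt
  have hξL : LocEssBounded ξ x₀ := .of_continuousAt
    ((eventually_contDiffAt_one hξ).mono fun _ h => h.continuousAt)
  -- `f` is bounded
  have hDb : ∀ i, LocEssBounded (fun x => fderiv ℝ (b i) x (V x)) x₀ := by
    intro i
    have h1 : ∀ l, LocEssBounded (fun x => V x l) x₀ := fun l => .of_continuousAt <| hV.mono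
      fun x hx => (EuclideanSpace.proj (𝕜 := ℝ) l).continuous.continuousAt.comp hx
    refine (LocEssBounded.sum Finset.univ fun l _ => (h1 l).mul
      ((hb i).locEssBounded_fderiv (EuclideanSpace.single l 1))).congr
      (Eventually.of_forall fun x => ?_)
    exact (sum_apply_eq _ _).symm
  have hfL : LocEssBounded f x₀ :=
    (LocEssBounded.sum Finset.univ fun i _ => ((LocEssBounded.of_continuousAt (hA i)).mul
      (hbc i)).add ((LocEssBounded.of_continuousAt (hC i)).mul (hDb i))).congr
      (hf.mono fun x hx => hx.symm)
  -- derivative of the regularised expression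
  have key := fun i => hρ.tendsto_fderiv_mul_mollAverage hT hx₀ hκ hκx
    (hχ.mul (hc i)) (hξb i) a
  have hrw : ∀ q : ℝ × Euc d, (fun y => χ y * ∑ i, c i y *
      mollAverage ρ T (fun x => ξ x * b i x) q.1 (κ y)) = fun y => ∑ i, (χ y * c i y) *
      mollAverage ρ T (fun x => ξ x * b i x) q.1 (κ y) := fun q => by
    funext y; rw [Finset.mul_sum]; simp only [mul_assoc]
  have hdiff : ∀ᶠ q : ℝ × Euc d in 𝓝[>] 0 ×ˢ 𝓝 y₀, ∀ i, DifferentiableAt ℝ (fun y =>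
      (χ y * c i y) * mollAverage ρ T (fun x => ξ x * b i x) q.1 (κ y)) q.2 :=
    eventually_all.2 fun i => (key i).1
  refine ⟨hfL, hdiff.mono fun q hq => ?_, ?_⟩
  · rw [hrw q]
    exact DifferentiableAt.fun_sum fun i _ => hq i
  have t1 := tendsto_finsetSum Finset.univ fun i _ => (key i).2
  -- the average of `ξ f`
  have hξc : ContinuousAt ξ x₀ := hξ.continuousAt
  -- The limit at `x₀` of ξ f - Σ cᵢ(y₀) ∂_v(ξ bᵢ): the terms containing derivatives of the `b i`
  -- cancel asymptotically and these continuous zeroth order terms remain.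
  set δ : ℝ := ∑ i, (ξ x₀ * (fderiv ℝ (c i) y₀ a * b i x₀) - c i y₀ * (b i x₀ * fderiv ℝ ξ x₀ v))
    with hδ
  have t2 : Tendsto (fun x => ξ x * f x - (∑ i, c i y₀ * fderiv ℝ (fun x => ξ x * b i x) x v + δ))
      (𝓝 x₀ ⊓ ae volume) (𝓝 0) := by
    have hle : 𝓝 x₀ ⊓ ae (volume : Measure (Euc d)) ≤ 𝓝 x₀ := inf_le_left
    have hbdiff : ∀ᶠ x in 𝓝 x₀ ⊓ ae volume, ∀ i, DifferentiableAt ℝ (b i) x :=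
      eventually_all.2 fun i => (hb i).eventually_differentiableAt
    have u1 : ∀ i, Tendsto (fun x => ξ x * (A i x * b i x) - c i y₀ * (b i x * fderiv ℝ ξ x v))
        (𝓝 x₀ ⊓ ae volume)
        (𝓝 (ξ x₀ * (fderiv ℝ (c i) y₀ a * b i x₀) - c i y₀ * (b i x₀ * fderiv ℝ ξ x₀ v))) := by
      intro i
      have hbi := ((hb i).eventually_continuousAt).self_of_nhds
      have := (hξc.mul ((hA i).self_of_nhds.mul hbi)).sub
        ((continuousAt_const (y := c i y₀)).mul (hbi.mul (continuousAt_fderiv_apply hξ v)))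
      rw [← hA₀ i]
      exact this.tendsto.mono_left hle
    -- The direction `V x` varies with the point. It is expanded in the standard basis so that its
    -- components become coefficients which can be frozen.
    have u2 : ∀ i, Tendsto (fun x => ∑ l, ((ξ x * C i x * V x l) *
        fderiv ℝ (b i) x (EuclideanSpace.single l 1) - (ξ x₀ * c i y₀ * v l) *
        fderiv ℝ (b i) x (EuclideanSpace.single l 1))) (𝓝 x₀ ⊓ ae volume) (𝓝 0) := by
      intro i
      rw [show (0 : ℝ) = ∑ l : Fin d, 0 by simp]
      refine tendsto_finsetSum _ fun l _ => ?_
      obtain ⟨K, hK⟩ := ((hb i).locEssBounded_fderiv (EuclideanSpace.single l 1)).bdd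
      refine tendsto_sub_mul_of_bounded ?_ hK
      rw [← hC₀ i, ← hV₀]
      refine Tendsto.mono_left ?_ hle
      exact ((hξc.mul (hC i).self_of_nhds).mul
        ((EuclideanSpace.proj (𝕜 := ℝ) l).continuous.continuousAt.comp hV.self_of_nhds)).tendsto
    -- Corrects for having frozen ξ at `x₀` in `u2`, whereas the product rule for `ξ * b i` produces
    -- `ξ x`.
    have u3 : ∀ i, Tendsto (fun x => (ξ x₀ - ξ x) * (c i y₀ * fderiv ℝ (b i) x v))
        (𝓝 x₀ ⊓ ae volume) (𝓝 0) := by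
      intro i
      obtain ⟨K, hK⟩ := (((hb i).locEssBounded_fderiv v).const_mul (c i y₀)).bdd
      refine Tendsto.zero_mul_isBoundedUnder_le ?_ ⟨K, hK⟩
      have := (hξc.tendsto.mono_left hle).const_sub (ξ x₀)
      rwa [sub_self] at this
    have u4 := tendsto_finsetSum Finset.univ fun i _ => ((u1 i).add (u2 i)).add (u3 i)
    have u5 := u4.sub_const δ
    simp only [add_zero, ← hδ, sub_self] at u5
    refine u5.congr' ?_
    filter_upwards [hf, hbdiff, hle ((eventually_contDiffAt_one hξ))] with x hfx hbx hξx
    have hD : ∀ i, fderiv ℝ (fun x => ξ x * b i x) x v =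
        ξ x * fderiv ℝ (b i) x v + b i x * fderiv ℝ ξ x v := by
      intro i
      rw [fderiv_fun_mul (hξx.differentiableAt one_ne_zero) (hbx i)]
      simp [smul_eq_mul]
    rw [hfx, ← sub_sub]
    congr 1
    rw [Finset.mul_sum, ← Finset.sum_sub_distrib]
    refine Finset.sum_congr rfl fun i _ => ?_
    rw [hD i, Finset.sum_sub_distrib]
    have e1 : ∑ l, (ξ x * C i x * V x l) * fderiv ℝ (b i) x (EuclideanSpace.single l 1) =
        ξ x * C i x * fderiv ℝ (b i) x (V x) := by
      rw [sum_apply_eq _ (V x), Finset.mul_sum]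
      simp only [mul_assoc]
    have e2 : ∑ l, (ξ x₀ * c i y₀ * v l) * fderiv ℝ (b i) x (EuclideanSpace.single l 1) =
        ξ x₀ * c i y₀ * fderiv ℝ (b i) x v := by
      rw [sum_apply_eq _ v, Finset.mul_sum]
      simp only [mul_assoc]
    rw [e1, e2]
    ring
  have hDξb : ∀ i, LocEssBounded (fun x => c i y₀ * fderiv ℝ (fun x => ξ x * b i x) x v) x₀ :=
    fun i => ((hξb i).locEssBounded_fderiv v).const_mul _
  have hS : LocEssBounded (fun x => ∑ i, c i y₀ * fderiv ℝ (fun x => ξ x * b i x) x v) x₀ :=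
    LocEssBounded.sum _ fun i _ => hDξb i
  have t3 := hρ.tendsto_mollAverage_sub hT hx₀ (hξL.mul hfL) (hS.add (.const δ)) t2
  have hsplit : ∀ᶠ q : ℝ × Euc d in 𝓝[>] 0 ×ˢ 𝓝 x₀, mollAverage ρ T (fun x =>
      ∑ i, c i y₀ * fderiv ℝ (fun x => ξ x * b i x) x v + δ) q.1 q.2 =
      ∑ i, c i y₀ * mollAverage ρ T (fun x => fderiv ℝ (fun x => ξ x * b i x) x v) q.1 q.2 + δ := by
    have hint : ∀ᶠ q : ℝ × Euc d in 𝓝[>] 0 ×ˢ 𝓝 x₀, ∀ i, Integrable (fun y =>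
        (c i y₀ * fderiv ℝ (fun x => ξ x * b i x) y v) * ρ q.1 (q.2 - y)) :=
      eventually_all.2 fun i => (hDξb i).eventually_integrable hρ
    filter_upwards [hS.eventually_mollAverage_add (T := T) (.const δ) hρ,
      hρ.eventually_mollAverage_const hT hx₀ δ, hint] with q h1 h2 h3
    rw [h1, h2]
    congr 1
    unfold mollAverage
    simp only [Finset.sum_mul]
    rw [integral_finsetSum _ fun i _ => (h3 i).restrict]
    refine Finset.sum_congr rfl fun i _ => ?_
    rw [← integral_const_mul]
    simp only [mul_assoc]
  obtain ⟨K, hK⟩ := (hξL.mul hfL).bdd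
  have t4 := tendsto_sub_mul_of_bounded ((hχ.continuousAt.tendsto).comp tendsto_snd)
    (hl.eventually (hρ.eventually_abs_mollAverage_le hT hx₀ hK))
  have t5 := (t1.sub t4).sub ((t3.comp hl).const_mul (χ y₀))
  have t6 := t5.sub_const (χ y₀ * δ)
  -- The contributions of the derivatives of the `c i` cancel. What survives is the zeroth order
  -- quantity Σ cᵢ bᵢ times the derivative of the product of χ and ξ.
  have hlim : (∑ i, fderiv ℝ (fun y => χ y * c i y) y₀ a * (ξ x₀ * b i x₀) - 0 - χ y₀ * 0) -
      χ y₀ * δ = (∑ i, c i y₀ * b i x₀) *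
        (fderiv ℝ χ y₀ a * ξ x₀ + χ y₀ * fderiv ℝ ξ x₀ v) := by
    rw [sub_zero, mul_zero, sub_zero, hδ, Finset.mul_sum, Finset.sum_mul, ← Finset.sum_sub_distrib]
    refine Finset.sum_congr rfl fun i _ => ?_
    rw [fderiv_fun_mul (hχ.differentiableAt one_ne_zero) ((hc i).differentiableAt one_ne_zero)]
    simp only [FunLike.coe_add, FunLike.coe_smul, Pi.add_apply, Pi.smul_apply, smul_eq_mul]
    ring
  rw [← hlim]
  refine t6.congr' ?_
  filter_upwards [hdiff, hl.eventually hsplit] with q hq hs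
  rw [hrw q, fderiv_fun_sum fun i _ => hq i]
  simp only [Function.comp_apply, sum_apply] at hs ⊢
  rw [hs, Finset.sum_sub_distrib]
  have : ∑ i, χ y₀ * c i y₀ * mollAverage ρ T (fun x => fderiv ℝ (fun x => ξ x * b i x) x v) q.1
      (κ q.2) = χ y₀ * ∑ i, c i y₀ *
      mollAverage ρ T (fun x => fderiv ℝ (fun x => ξ x * b i x) x v) q.1 (κ q.2) := by
    rw [Finset.mul_sum]; simp only [mul_assoc]
  rw [this]
  ring

end KeyLemma

/-! ### Superposition operators on spaces of curves, and the inverse function theorem. -/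

section Nemytskii

universe u

/-- Pointwise application of a curve of linear maps, parametrised by `L`, to a curve of vectors. -/
noncomputable def pointwiseApply (K : Type*) [TopologicalSpace K] [CompactSpace K]
    {L E F : Type*} [NormedAddCommGroup L] [NormedSpace ℝ L] [NormedAddCommGroup E]
    [NormedSpace ℝ E] [NormedAddCommGroup F] [NormedSpace ℝ F] (b : L →L[ℝ] E →L[ℝ] F) :
    C(K, L) →L[ℝ] C(K, E) →L[ℝ] C(K, F) :=
  LinearMap.mkContinuous₂
    (LinearMap.mk₂ ℝ (fun (A : C(K, L)) (h : C(K, E)) =>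
        (⟨fun t => b (A t) (h t), (b.continuous.comp A.continuous).clm_apply h.continuous⟩ :
          C(K, F)))
      (fun _ _ _ => by ext; simp) (fun _ _ _ => by ext; simp) (fun _ _ _ => by ext; simp)
      (fun _ _ _ => by ext; simp)) ‖b‖ <| by
    intro A h
    rw [ContinuousMap.norm_le _ (by positivity)]
    intro t
    refine (b.le_opNorm₂ (A t) (h t)).trans ?_
    have h1 := A.norm_coe_le_norm t
    have h2 := h.norm_coe_le_norm t
    gcongr

/-- Postcomposition with `g` is continuous for the sup norm, so the derivative of `f` varies little
on all segments from `γ t` to `γ t + h t` at once. The mean value inequality on these segments is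
then uniform in `t`. -/
theorem hasFDerivAt_comp_continuousMap {K : Type*} [TopologicalSpace K] [CompactSpace K]
    {L E F : Type*} [NormedAddCommGroup L] [NormedSpace ℝ L] [NormedAddCommGroup E]
    [NormedSpace ℝ E] [NormedAddCommGroup F] [NormedSpace ℝ F] (b : L →L[ℝ] E →L[ℝ] F)
    (f : C(E, F)) (g : C(E, L)) (hfg : ∀ x, HasFDerivAt f (b (g x)) x) (γ : C(K, E)) :
    HasFDerivAt (fun γ : C(K, E) => f.comp γ) (pointwiseApply K b (g.comp γ)) γ := by
  rw [hasFDerivAt_iff_isLittleO_nhds_zero, Asymptotics.isLittleO_iff]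
  intro c hc
  have hcont := (g.continuous_postcomp (X := K)).continuousAt (x := γ)
  obtain ⟨r, hr, hball⟩ := Metric.continuousAt_iff.1 hcont (c / (‖b‖ + 1)) (by positivity)
  filter_upwards [Metric.ball_mem_nhds (0 : C(K, E)) hr] with h hh
  rw [ContinuousMap.norm_le _ (by positivity)]
  intro t
  have hseg : ∀ z ∈ segment ℝ (γ t) (γ t + h t), ‖b (g z) - b (g (γ t))‖ ≤ c := by
    rintro z hz
    rw [segment_eq_image'] at hz
    obtain ⟨s, hs, rfl⟩ := hz
    have h1 : dist (γ + s • h) γ < r := by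
      rw [dist_eq_norm, add_sub_cancel_left, norm_smul, Real.norm_of_nonneg hs.1]
      rw [mem_ball_zero_iff] at hh
      exact (mul_le_of_le_one_left (norm_nonneg _) hs.2).trans_lt hh
    have h2 := hball h1
    have h3 := (ContinuousMap.norm_coe_le_norm (g.comp (γ + s • h) - g.comp γ) t)
    rw [dist_eq_norm] at h2
    have h4 : ‖g ((fun θ => γ t + θ • (γ t + h t - γ t)) s) - g (γ t)‖ ≤ c / (‖b‖ + 1) := by
      refine le_trans (le_of_eq ?_) (h3.trans h2.le)
      simp
    rw [← map_sub]
    refine (b.le_opNorm _).trans ((mul_le_mul_of_nonneg_left h4 (norm_nonneg _)).trans ?_)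
    rw [mul_div_assoc', div_le_iff₀ (by positivity)]
    nlinarith [norm_nonneg b]
  have := (convex_segment (γ t) (γ t + h t)).norm_image_sub_le_of_norm_hasFDerivWithin_le'
    (fun z _ => (hfg z).hasFDerivWithinAt) hseg (left_mem_segment ℝ _ _)
    (right_mem_segment ℝ _ _)
  rw [add_sub_cancel_left] at this
  exact this.trans (mul_le_mul_of_nonneg_left (h.norm_coe_le_norm t) hc.le)

theorem contDiff_pointwiseApply {K : Type*} [TopologicalSpace K] [CompactSpace K]
    {L E F : Type*} [NormedAddCommGroup L] [NormedSpace ℝ L] [NormedAddCommGroup E]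
    [NormedSpace ℝ E] [NormedAddCommGroup F] [NormedSpace ℝ F] (b : L →L[ℝ] E →L[ℝ] F)
    {n : WithTop ℕ∞} {N : C(K, E) → C(K, L)} (hN : ContDiff ℝ n N) :
    ContDiff ℝ n (fun γ => pointwiseApply K b (N γ)) :=
  (pointwiseApply K b).contDiff.comp hN

/-- The derivative of γ ↦ f ∘ γ is a bounded linear operator applied to γ ↦ f' ∘ γ, again a
superposition operator but with values in `E →L[ℝ] F`. Hence the induction must range over all
targets `F`, and `E` and `F` share a universe so that `E →L[ℝ] F` is one of them. -/
theorem contDiff_comp_continuousMap_nat {K : Type*} [TopologicalSpace K] [CompactSpace K]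
    {E : Type u} [NormedAddCommGroup E] [NormedSpace ℝ E] (n : ℕ) :
    ∀ {F : Type u} [NormedAddCommGroup F] [NormedSpace ℝ F] (f : C(E, F)),
      ContDiff ℝ n f → ContDiff ℝ n (fun γ : C(K, E) => f.comp γ) := by
  induction n with
  | zero =>
    intro F _ _ f _
    exact contDiff_zero.2 f.continuous_postcomp
  | succ n ih =>
    intro F _ _ f hf
    obtain ⟨f', hf', hff'⟩ := contDiff_succ_iff_hasFDerivAt.1 (by exact_mod_cast hf)
    have goal : ContDiff ℝ ((n : WithTop ℕ∞) + 1) (fun γ : C(K, E) => f.comp γ) :=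
      contDiff_succ_iff_hasFDerivAt.2 ⟨_,
        contDiff_pointwiseApply (.id ℝ (E →L[ℝ] F)) (ih ⟨f', hf'.continuous⟩ hf'),
        hasFDerivAt_comp_continuousMap (.id ℝ (E →L[ℝ] F)) f ⟨f', hf'.continuous⟩ hff'⟩
    exact_mod_cast goal

theorem contDiff_comp_continuousMap {K : Type*} [TopologicalSpace K] [CompactSpace K]
    {E F : Type u} [NormedAddCommGroup E] [NormedSpace ℝ E] [NormedAddCommGroup F]
    [NormedSpace ℝ F] (f : C(E, F)) (hf : ContDiff ℝ ∞ f) :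
    ContDiff ℝ ∞ (fun γ : C(K, E) => f.comp γ) :=
  contDiff_infty.2 fun n => contDiff_comp_continuousMap_nat n f (contDiff_infty.1 hf n)

end Nemytskii

/-- The inverse function theorem, with smoothness of the inverse on a neighbourhood. -/
theorem exists_openPartialHomeomorph_of_contDiffOn {X Y : Type*} [NormedAddCommGroup X]
    [NormedSpace ℝ X] [CompleteSpace X] [NormedAddCommGroup Y] [NormedSpace ℝ Y]
    {Ψ : X → Y} {s : Set X} (hs : IsOpen s) (hΨ : ContDiffOn ℝ ∞ Ψ s) {a : X} (ha : a ∈ s)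
    {A : X ≃L[ℝ] Y} (hA : HasFDerivAt Ψ (A : X →L[ℝ] Y) a) :
    ∃ e : OpenPartialHomeomorph X Y, a ∈ e.source ∧ e.source ⊆ s ∧ EqOn e Ψ e.source ∧
      ContDiffOn ℝ ∞ e.symm e.target := by
  have hat : ∀ x ∈ s, ContDiffAt ℝ ∞ Ψ x := fun x hx => (hΨ x hx).contDiffAt (hs.mem_nhds hx)
  let e₀ := (hat a ha).toOpenPartialHomeomorph Ψ hA (by simp)
  have he₀ : (e₀ : X → Y) = Ψ := (hat a ha).toOpenPartialHomeomorph_coe hA (by simp)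
  have hae₀ : a ∈ e₀.source := (hat a ha).mem_toOpenPartialHomeomorph_source hA (by simp)
  have hcont : ContinuousOn (fderiv ℝ Ψ) s := fun x hx =>
    ((hat x hx).continuousAt_fderiv (by simp)).continuousWithinAt
  -- The points with invertible derivative form an open set. After restricting to it, the inverse is
  -- smooth on the whole target and not only at the image of `a`.
  have hopen : IsOpen (s ∩ fderiv ℝ Ψ ⁻¹' range ((↑) : (X ≃L[ℝ] Y) → X →L[ℝ] Y)) :=
    hcont.isOpen_inter_preimage hs (ContinuousLinearEquiv.isOpen)
  set t := s ∩ fderiv ℝ Ψ ⁻¹' range ((↑) : (X ≃L[ℝ] Y) → X →L[ℝ] Y)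
  refine ⟨e₀.restrOpen t hopen, ⟨hae₀, ha, ⟨A, hA.fderiv.symm⟩⟩, fun x hx => hx.2.1, ?_, ?_⟩
  · intro x _
    simp [he₀]
  · intro y hy
    have hx := (e₀.restrOpen t hopen).map_target hy
    set x := (e₀.restrOpen t hopen).symm y
    obtain ⟨B, hB⟩ := hx.2.2
    refine ((e₀.restrOpen t hopen).contDiffAt_symm (f₀' := B) hy ?_ ?_).contDiffWithinAt
    · rw [hB]
      have h := ((hat x hx.2.1).differentiableAt (by simp)).hasFDerivAt
      rw [← he₀] at h ⊢
      exact h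
    · have h := hat x hx.2.1
      rw [← he₀] at h
      exact h

/-! ### Smooth local flows in Banach spaces. -/

section Flow

universe u

/-- Integration of curves on `[-1, 1]` from `0`. -/
noncomputable def curveIntegral (E : Type*) [NormedAddCommGroup E] [NormedSpace ℝ E]
    [CompleteSpace E] : C(Icc (-1 : ℝ) 1, E) →L[ℝ] C(Icc (-1 : ℝ) 1, E) :=
  have hint : ∀ (η : C(Icc (-1 : ℝ) 1, E)) (a b : ℝ), IntervalIntegrable
      (fun σ => η (projIcc (-1 : ℝ) 1 (by norm_num) σ)) volume a b := fun η a b =>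
    (η.continuous.comp continuous_projIcc).intervalIntegrable a b
  LinearMap.mkContinuous
    { toFun := fun η => ⟨fun τ => ∫ σ in (0 : ℝ)..τ, η (projIcc (-1 : ℝ) 1 (by norm_num) σ),
        (intervalIntegral.continuous_primitive (hint η) 0).comp continuous_subtype_val⟩
      map_add' := fun η η' => by
        ext τ
        simpa using intervalIntegral.integral_add (hint η 0 τ) (hint η' 0 τ)
      map_smul' := fun c η => by ext τ; simp } 1 <| by
    intro η
    rw [ContinuousMap.norm_le _ (by positivity), one_mul]
    intro τ
    have h := intervalIntegral.norm_integral_le_of_norm_le_const (a := 0) (b := τ) (C := ‖η‖)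
      (f := fun σ => η (projIcc (-1 : ℝ) 1 (by norm_num) σ)) fun σ _ => η.norm_coe_le_norm _
    refine h.trans ?_
    have := abs_le.2 τ.2
    rw [sub_zero]
    exact mul_le_of_le_one_right (norm_nonneg _) this

theorem curveIntegral_apply {E : Type*} [NormedAddCommGroup E] [NormedSpace ℝ E]
    [CompleteSpace E] (η : C(Icc (-1 : ℝ) 1, E)) (τ : Icc (-1 : ℝ) 1) :
    curveIntegral E η τ = ∫ σ in (0 : ℝ)..τ, η (projIcc (-1 : ℝ) 1 (by norm_num) σ) := rfl

/-- The constant curves. -/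
noncomputable def constCurve (E : Type*) [NormedAddCommGroup E] [NormedSpace ℝ E] :
    E →L[ℝ] C(Icc (-1 : ℝ) 1, E) :=
  LinearMap.mkContinuous
    { toFun := fun x => ContinuousMap.const _ x
      map_add' := fun _ _ => rfl
      map_smul' := fun _ _ => rfl } 1 <| by
    intro x
    rw [ContinuousMap.norm_le _ (by positivity), one_mul]
    intro τ
    exact le_rfl

theorem constCurve_apply {E : Type*} [NormedAddCommGroup E] [NormedSpace ℝ E] (x : E)
    (τ : Icc (-1 : ℝ) 1) : constCurve E x τ = x := rfl

/-- Smooth local flow of a smooth vector field on a Banach space. -/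
theorem exists_contDiffOn_flow {E : Type u} [NormedAddCommGroup E] [NormedSpace ℝ E]
    [CompleteSpace E] {f : E → E} (hf : ContDiff ℝ ∞ f) (x₀ : E) :
    ∃ δ > 0, ∃ u : E × ℝ → E, ContDiffOn ℝ ∞ u (Metric.ball x₀ δ ×ˢ Ioo (-δ) δ) ∧
      ∀ x ∈ Metric.ball x₀ δ, u (x, 0) = x ∧
        ∀ t ∈ Ioo (-δ) δ, HasDerivAt (fun s => u (x, s)) (f (u (x, t))) t := by
  set P : C(Icc (-1 : ℝ) 1, E) → C(Icc (-1 : ℝ) 1, E) := fun γ =>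
    curveIntegral E ((⟨f, hf.continuous⟩ : C(E, E)).comp γ) with hP
  have hPc : ContDiff ℝ ∞ P :=
    (curveIntegral E).contDiff.comp (contDiff_comp_continuousMap _ hf)
  -- The third component vanishes exactly when γ(τ) = x + s ∫₀^τ f(γ), that is, when γ is the
  -- solution starting at x with time rescaled by s. The parameter s keeps all solutions on the
  -- fixed interval [-1, 1] and makes the equation trivial at s = 0.
  set Ψ : E × ℝ × C(Icc (-1 : ℝ) 1, E) → E × ℝ × C(Icc (-1 : ℝ) 1, E) := fun q =>
    (q.1, q.2.1, q.2.2 - constCurve E q.1 - q.2.1 • P q.2.2) with hΨ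
  have hΨc : ContDiff ℝ ∞ Ψ := by
    refine contDiff_fst.prodMk ((contDiff_fst.comp contDiff_snd).prodMk ?_)
    exact ((contDiff_snd.comp contDiff_snd).sub ((constCurve E).contDiff.comp contDiff_fst)).sub
      ((contDiff_fst.comp contDiff_snd).smul (hPc.comp (contDiff_snd.comp contDiff_snd)))
  set c := constCurve E x₀ with hc
  let pE := ContinuousLinearMap.fst ℝ E (ℝ × C(Icc (-1 : ℝ) 1, E))
  let p2 := ContinuousLinearMap.snd ℝ E (ℝ × C(Icc (-1 : ℝ) 1, E))
  let ps := (ContinuousLinearMap.fst ℝ ℝ C(Icc (-1 : ℝ) 1, E)).comp p2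
  let pc := (ContinuousLinearMap.snd ℝ ℝ C(Icc (-1 : ℝ) 1, E)).comp p2
  -- The differential of Ψ at s = 0: the derivative of `P` carries the factor s and drops out,
  -- leaving a triangular operator with explicit inverse.
  let A : (E × ℝ × C(Icc (-1 : ℝ) 1, E)) ≃L[ℝ] (E × ℝ × C(Icc (-1 : ℝ) 1, E)) :=
    ContinuousLinearEquiv.equivOfInverse
      (pE.prod (ps.prod (pc - (constCurve E).comp pE - ps.smulRight (P c))))
      (pE.prod (ps.prod (pc + (constCurve E).comp pE + ps.smulRight (P c))))
      (fun q => by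
        refine Prod.ext rfl (Prod.ext rfl ?_)
        simp only [pE, ps, pc, p2]
        simp
        abel)
      (fun q => by
        refine Prod.ext rfl (Prod.ext rfl ?_)
        simp only [pE, ps, pc, p2]
        simp
        abel)
  have hA : HasFDerivAt Ψ (A : _ →L[ℝ] _) (x₀, (0 : ℝ), c) := by
    have h1 : HasFDerivAt (fun q : E × ℝ × C(Icc (-1 : ℝ) 1, E) => q.2.1 • P q.2.2)
        (ps.smulRight (P c)) (x₀, (0 : ℝ), c) := by
      have hs : HasFDerivAt (fun q : E × ℝ × C(Icc (-1 : ℝ) 1, E) => q.2.1) ps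
          (x₀, (0 : ℝ), c) := ps.hasFDerivAt
      have hPd : HasFDerivAt (fun q : E × ℝ × C(Icc (-1 : ℝ) 1, E) => P q.2.2)
          ((fderiv ℝ P c).comp pc) (x₀, (0 : ℝ), c) :=
        HasFDerivAt.comp (f := fun q : E × ℝ × C(Icc (-1 : ℝ) 1, E) => q.2.2) (x₀, (0 : ℝ), c)
          ((hPc.differentiable (by simp)) c).hasFDerivAt pc.hasFDerivAt
      have := hs.smul hPd
      simpa using! this
    have h2 : HasFDerivAt (fun q : E × ℝ × C(Icc (-1 : ℝ) 1, E) => q.2.2 - constCurve E q.1)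
        (pc - (constCurve E).comp pE) (x₀, (0 : ℝ), c) :=
      (pc - (constCurve E).comp pE).hasFDerivAt
    exact pE.hasFDerivAt.prodMk (ps.hasFDerivAt.prodMk (h2.sub h1))
  obtain ⟨e, hae, -, heΨ, hes⟩ := exists_openPartialHomeomorph_of_contDiffOn isOpen_univ
    hΨc.contDiffOn (mem_univ _) hA
  -- `G (x, s)` is the solution curve for the parameters x and s. It depends smoothly on them
  -- because the inverse of Ψ is smooth.
  set G : E × ℝ → C(Icc (-1 : ℝ) 1, E) := fun p => (e.symm (p.1, p.2, 0)).2.2 with hG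
  have hP0 : e (x₀, (0 : ℝ), c) = (x₀, (0 : ℝ), 0) := by
    rw [heΨ hae]; simp [hΨ, hc]
  have htgt : (x₀, (0 : ℝ), (0 : C(Icc (-1 : ℝ) 1, E))) ∈ e.target := hP0 ▸ e.map_source hae
  have hG0 : G (x₀, 0) = c := by
    simp only [hG]; rw [← hP0, e.left_inv hae]
  let j : E × ℝ → E × ℝ × C(Icc (-1 : ℝ) 1, E) := fun p => (p.1, p.2, 0)
  have hj : ContDiff ℝ ∞ j := contDiff_fst.prodMk (contDiff_snd.prodMk contDiff_const)
  have hGc : ContDiffOn ℝ ∞ G (j ⁻¹' e.target) :=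
    (contDiff_snd.comp contDiff_snd).comp_contDiffOn (hes.comp hj.contDiffOn fun p hp => hp)
  have hjo : IsOpen (j ⁻¹' e.target) := e.open_target.preimage hj.continuous
  -- the box on which solutions are unique
  obtain ⟨r, hr, hbox⟩ := Metric.mem_nhds_iff.1 (e.open_source.mem_nhds hae)
  have hm : j ⁻¹' e.target ∈ 𝓝 (x₀, (0 : ℝ)) := hjo.mem_nhds htgt
  have hcontG : ContinuousAt G (x₀, 0) := hGc.continuousOn.continuousAt hm
  obtain ⟨δ, hδ, hδG⟩ : ∃ δ > 0, ∀ x ∈ Metric.ball x₀ δ, ∀ s ∈ Ioo (-δ) δ,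
      (x, s) ∈ j ⁻¹' e.target ∧ ‖G (x, s) - c‖ < r ∧ δ < r := by
    have h1 : ∀ᶠ p in 𝓝 (x₀, (0 : ℝ)), p ∈ j ⁻¹' e.target ∧ ‖G p - c‖ < r := by
      refine Filter.Eventually.and hm ?_
      have := Metric.continuousAt_iff'.1 hcontG r hr
      simpa [hG0, dist_eq_norm] using this
    obtain ⟨η, hη, h⟩ := Metric.eventually_nhds_iff.1 h1
    refine ⟨min η (r / 2), by positivity, fun x hx s hs => ?_⟩
    have hxs : dist (x, s) (x₀, (0 : ℝ)) < η := by
      rw [Prod.dist_eq]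
      refine max_lt (lt_of_lt_of_le hx (min_le_left _ _)) ?_
      rw [Real.dist_0_eq_abs]
      exact lt_of_lt_of_le (abs_lt.2 hs) (min_le_left _ _)
    exact ⟨(h hxs).1, (h hxs).2, lt_of_le_of_lt (min_le_right _ _) (by linarith)⟩
  have hsol : ∀ x ∈ Metric.ball x₀ δ, ∀ s ∈ Ioo (-δ) δ,
      G (x, s) = constCurve E x + s • P (G (x, s)) := by
    intro x hx s hs
    have hmem := (hδG x hx s hs).1
    have h1 := e.right_inv hmem
    rw [heΨ (e.map_target hmem)] at h1
    simp only [hΨ, j, Prod.mk.injEq] at h1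
    obtain ⟨h1, h2, h3⟩ := h1
    rw [h1, h2] at h3
    change G (x, s) - constCurve E x - s • P (G (x, s)) = 0 at h3
    rw [sub_sub] at h3
    exact sub_eq_zero.1 h3
  have huniq : ∀ x ∈ Metric.ball x₀ δ, ∀ s ∈ Ioo (-δ) δ, ∀ γ : C(Icc (-1 : ℝ) 1, E),
      ‖γ - c‖ < r → γ = constCurve E x + s • P γ → γ = G (x, s) := by
    intro x hx s hs γ hγ hγs
    have hδr := (hδG x hx s hs).2.2
    have hmem : (x, s, γ) ∈ e.source := by
      apply hbox
      rw [Metric.mem_ball, Prod.dist_eq, Prod.dist_eq]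
      refine max_lt (lt_trans hx hδr) (max_lt ?_ ?_)
      · change dist s 0 < r
        rw [Real.dist_0_eq_abs]; exact (abs_lt.2 hs).trans hδr
      · change dist γ c < r
        rwa [dist_eq_norm]
    have h1 : e (x, s, γ) = (x, s, 0) := by
      rw [heΨ hmem]
      simp only [hΨ, Prod.mk.injEq, true_and]
      rw [sub_sub, ← hγs, sub_self]
    simp only [hG]
    rw [← h1, e.left_inv hmem]
  let one : Icc (-1 : ℝ) 1 := ⟨1, by norm_num⟩
  -- rescaling
  have hscale : ∀ x ∈ Metric.ball x₀ δ, ∀ s ∈ Ioo (-δ) δ, ∀ l (hl : l ∈ Icc (-1 : ℝ) 1),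
      G (x, l * s) one = G (x, s) ⟨l, hl⟩ := by
    intro x hx s hs l hl
    have hl' := abs_le.2 hl
    -- τ ↦ G(x, s)(l τ) solves the equation with parameter l s and stays in the uniqueness box. It
    -- therefore equals G(x, l s), and evaluation at τ = 1 gives the claim.
    let m : C(Icc (-1 : ℝ) 1, Icc (-1 : ℝ) 1) := ⟨fun τ => ⟨l * τ, abs_le.1 (by
      rw [abs_mul]; exact mul_le_one₀ hl' (abs_nonneg _) (abs_le.2 τ.2))⟩, by fun_prop⟩
    have hls : l * s ∈ Ioo (-δ) δ := abs_lt.1 (by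
      rw [abs_mul]
      exact lt_of_le_of_lt (mul_le_of_le_one_left (abs_nonneg _) hl') (abs_lt.2 hs))
    have hγ := huniq x hx (l * s) hls ((G (x, s)).comp m) ?_ ?_
    · rw [← hγ]
      simp [m, one]
    · refine lt_of_le_of_lt ?_ (hδG x hx s hs).2.1
      rw [ContinuousMap.norm_le _ (norm_nonneg _)]
      intro τ
      exact (G (x, s) - c).norm_coe_le_norm (m τ)
    · ext τ
      have h1 := congrArg (fun γ => γ (m τ)) (hsol x hx s hs)
      simp only [ContinuousMap.add_apply, ContinuousMap.smul_apply, constCurve_apply, hP,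
        curveIntegral_apply] at h1
      simp only [ContinuousMap.comp_apply, ContinuousMap.add_apply, ContinuousMap.smul_apply,
        constCurve_apply, hP, curveIntegral_apply]
      rw [h1]
      congr 1
      have h2 := intervalIntegral.smul_integral_comp_mul_left (a := (0 : ℝ)) (b := τ)
        (fun σ => f (G (x, s) (projIcc (-1 : ℝ) 1 (by norm_num) σ))) l
      rw [mul_zero] at h2
      change s • (∫ σ in (0 : ℝ)..(l * τ), f (G (x, s) (projIcc (-1 : ℝ) 1 (by norm_num) σ))) = _
      rw [← h2, smul_smul, mul_comm s l]
      congr 1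
      refine intervalIntegral.integral_congr fun σ hσ => ?_
      have hσ' : σ ∈ Icc (-1 : ℝ) 1 := by
        have h0 : (0 : ℝ) ∈ Icc (-1 : ℝ) 1 := by norm_num
        exact (Set.ordConnected_Icc.uIcc_subset h0 τ.2) hσ
      have hlσ : l * σ ∈ Icc (-1 : ℝ) 1 := (m ⟨σ, hσ'⟩).2
      simp only [ContinuousMap.coe_mk]
      rw [projIcc_of_mem _ hlσ, projIcc_of_mem _ hσ']
      rfl
  -- The flow is the endpoint of the rescaled curve. Halving δ makes δ / 2 itself an allowed
  -- parameter, so that for fixed x all values with |t| < δ / 2 lie on the single curve `G (x, δ /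
  -- 2)`. The differential equation then follows from the fundamental theorem of calculus.
  refine ⟨δ / 2, by positivity, fun p => G p one, ?_, ?_⟩
  · refine ((ContinuousMap.evalCLM ℝ one).contDiff.comp_contDiffOn
      (hGc.mono fun p hp => (hδG p.1 ?_ p.2 ?_).1))
    · exact Metric.ball_subset_ball (by linarith) hp.1
    · exact ⟨by linarith [hp.2.1], by linarith [hp.2.2]⟩
  · intro x hx
    have hx' : x ∈ Metric.ball x₀ δ := Metric.ball_subset_ball (by linarith) hx
    have hs1 : δ / 2 ∈ Ioo (-δ) δ := ⟨by linarith, by linarith⟩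
    have hval : ∀ t ∈ Ioo (-(δ / 2)) (δ / 2), G (x, t) one = x + (δ / 2) •
        ∫ σ in (0 : ℝ)..(t / (δ / 2)), f (G (x, δ / 2) (projIcc (-1 : ℝ) 1 (by norm_num) σ)) ∧
        G (x, t) one = G (x, δ / 2) (projIcc (-1 : ℝ) 1 (by norm_num) (t / (δ / 2))) := by
      intro t ht
      have hl : t / (δ / 2) ∈ Icc (-1 : ℝ) 1 := by
        rw [mem_Icc, le_div_iff₀ (by positivity), div_le_iff₀ (by positivity)]
        exact ⟨by linarith [ht.1], by linarith [ht.2]⟩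
      have h1 := hscale x hx' (δ / 2) hs1 _ hl
      rw [div_mul_cancel₀ _ (by positivity)] at h1
      rw [h1, projIcc_of_mem _ hl]
      refine ⟨?_, rfl⟩
      have h2 := congrArg (fun γ => γ ⟨_, hl⟩) (hsol x hx' (δ / 2) hs1)
      simpa only [ContinuousMap.add_apply, ContinuousMap.smul_apply, constCurve_apply, hP,
        curveIntegral_apply] using! h2
    refine ⟨?_, fun t ht => ?_⟩
    · have := (hval 0 ⟨by linarith, by linarith⟩).1
      simpa using this
    · have hcont : Continuous fun σ => f (G (x, δ / 2) (projIcc (-1 : ℝ) 1 (by norm_num) σ)) :=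
        hf.continuous.comp ((G (x, δ / 2)).continuous.comp continuous_projIcc)
      have h1 : HasDerivAt (fun b => ∫ σ in (0 : ℝ)..b,
          f (G (x, δ / 2) (projIcc (-1 : ℝ) 1 (by norm_num) σ))) _ (t / (δ / 2)) :=
        intervalIntegral.integral_hasDerivAt_right (hcont.intervalIntegrable _ _)
          (hcont.stronglyMeasurableAtFilter _ _) hcont.continuousAt
      have h2 : HasDerivAt (fun s : ℝ => s / (δ / 2)) (1 / (δ / 2)) t :=
        (hasDerivAt_id t).div_const _
      have h3 := ((h1.scomp t h2).const_smul (δ / 2)).const_add x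
      rw [smul_smul, mul_one_div_cancel (by positivity), one_smul, ← (hval t ht).2] at h3
      refine h3.congr_of_eventuallyEq ?_
      filter_upwards [Ioo_mem_nhds ht.1 ht.2] with s hs
      exact (hval s hs).1

end Flow

/-! ### Charts, transition maps and components of bilinear fields. -/

section Charts

variable {n : ℕ} {M : Type*} [TopologicalSpace M] [ChartedSpace (Euc n) M] {φ φ' : OpenPartialHomeomorph M (Euc n)}

theorem mdifferentiableAt_chart (hφ : φ ∈ IsManifold.maximalAtlas (𝓡 n) ∞ M) {p : M}
    (hp : p ∈ φ.source) : MDifferentiableAt (𝓡 n) (𝓡 n) φ p :=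
  (contMDiffAt_of_mem_maximalAtlas hφ hp).mdifferentiableAt (by simp)

theorem mdifferentiableAt_chart_symm (hφ : φ ∈ IsManifold.maximalAtlas (𝓡 n) ∞ M) {y : Euc n}
    (hy : y ∈ φ.target) : MDifferentiableAt (𝓡 n) (𝓡 n) φ.symm y :=
  (contMDiffAt_symm_of_mem_maximalAtlas hφ hy).mdifferentiableAt (by simp)

theorem contDiffAt_transition (hφ : φ ∈ IsManifold.maximalAtlas (𝓡 n) ∞ M)
    (hφ' : φ' ∈ IsManifold.maximalAtlas (𝓡 n) ∞ M) {y : Euc n} (hy : y ∈ φ.target)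
    (hy' : φ.symm y ∈ φ'.source) : ContDiffAt ℝ ∞ (φ' ∘ φ.symm) y := by
  rw [← contMDiffAt_iff_contDiffAt]
  exact (contMDiffAt_of_mem_maximalAtlas hφ' hy').comp y
    (contMDiffAt_symm_of_mem_maximalAtlas hφ hy)

theorem fderiv_transition_apply (hφ : φ ∈ IsManifold.maximalAtlas (𝓡 n) ∞ M)
    (hφ' : φ' ∈ IsManifold.maximalAtlas (𝓡 n) ∞ M) {y : Euc n} (hy : y ∈ φ.target)
    (hy' : φ.symm y ∈ φ'.source) (v : Euc n) :
    fderiv ℝ (φ' ∘ φ.symm) y v =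
      mfderiv (𝓡 n) (𝓡 n) φ' (φ.symm y) (mfderiv (𝓡 n) (𝓡 n) φ.symm y v) := by
  rw [← mfderiv_eq_fderiv, mfderiv_comp y (mdifferentiableAt_chart hφ' hy')
    (mdifferentiableAt_chart_symm hφ hy)]
  rfl

theorem eventually_mem_target_transition {y : Euc n} (hy : y ∈ φ.target)
    (hy' : φ.symm y ∈ φ'.source) : ∀ᶠ z in 𝓝 y, z ∈ φ.target ∧ φ.symm z ∈ φ'.source :=
  Filter.Eventually.and (φ.open_target.mem_nhds hy)
    ((φ.continuousAt_symm hy).preimage_mem_nhds (φ'.open_source.mem_nhds hy'))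

theorem mfderiv_chart_symm_comp (hφ : φ ∈ IsManifold.maximalAtlas (𝓡 n) ∞ M) {p : M}
    (hp : p ∈ φ.source) (v : TangentSpace (𝓡 n) p) :
    mfderiv (𝓡 n) (𝓡 n) φ.symm (φ p) (mfderiv (𝓡 n) (𝓡 n) φ p v) = v := by
  have h1 := mfderiv_comp p (mdifferentiableAt_chart_symm hφ (φ.map_source hp))
    (mdifferentiableAt_chart hφ hp)
  have h2 : (φ.symm ∘ φ) =ᶠ[𝓝 p] id := by
    filter_upwards [φ.open_source.mem_nhds hp] with q hq using φ.left_inv hq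
  rw [h2.mfderiv_eq, mfderiv_id] at h1
  exact (DFunLike.congr_fun h1 v).symm

theorem mfderiv_chart_comp_symm (hφ : φ ∈ IsManifold.maximalAtlas (𝓡 n) ∞ M) {y : Euc n}
    (hy : y ∈ φ.target) (v : Euc n) :
    mfderiv (𝓡 n) (𝓡 n) φ (φ.symm y) (mfderiv (𝓡 n) (𝓡 n) φ.symm y v) = v := by
  rw [← fderiv_transition_apply hφ hφ hy (φ.map_target hy)]
  have h2 : (φ ∘ φ.symm) =ᶠ[𝓝 y] id := by
    filter_upwards [φ.open_target.mem_nhds hy] with z hz using φ.right_inv hz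
  rw [h2.fderiv_eq, fderiv_id]
  rfl

theorem apply_eq_components (hφ : φ ∈ IsManifold.maximalAtlas (𝓡 n) ∞ M) {p : M}
    (hp : p ∈ φ.source) (t : (p : M) → TangentSpace (𝓡 n) p → TangentSpace (𝓡 n) p → ℝ)
    (v w : TangentSpace (𝓡 n) p) :
    t p v w = components φ t (φ p) (mfderiv (𝓡 n) (𝓡 n) φ p v) (mfderiv (𝓡 n) (𝓡 n) φ p w) := by
  -- The tangent spaces at `p` and at `φ.symm (φ p)` are formally indexed by different points.
  -- Generalising the second point allows the equality of base points to be substituted.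
  have key : ∀ q (hq : q = p) (a b : TangentSpace (𝓡 n) q)
      (ha : (a : Euc n) = (v : Euc n)) (hb : (b : Euc n) = (w : Euc n)), t p v w = t q a b := by
    rintro q rfl a b ha hb
    rw [show a = v from ha, show b = w from hb]
  exact key _ (φ.left_inv hp) _ _ (mfderiv_chart_symm_comp hφ hp v)
    (mfderiv_chart_symm_comp hφ hp w)

theorem components_transition (hφ : φ ∈ IsManifold.maximalAtlas (𝓡 n) ∞ M)
    (hφ' : φ' ∈ IsManifold.maximalAtlas (𝓡 n) ∞ M)
    (t : (p : M) → TangentSpace (𝓡 n) p → TangentSpace (𝓡 n) p → ℝ) {y : Euc n}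
    (hy : y ∈ φ.target) (hy' : φ.symm y ∈ φ'.source) (v w : Euc n) :
    components φ t y v w = components φ' t ((φ' ∘ φ.symm) y)
      (fderiv ℝ (φ' ∘ φ.symm) y v) (fderiv ℝ (φ' ∘ φ.symm) y w) := by
  rw [fderiv_transition_apply hφ hφ' hy hy', fderiv_transition_apply hφ hφ' hy hy']
  exact apply_eq_components hφ' hy' t _ _

/-- The components of a field of bilinear forms are bilinear. -/
noncomputable def componentsBilin (φ : OpenPartialHomeomorph M (Euc n)) (g : BilinField n M)
    (y : Euc n) : Euc n →ₗ[ℝ] Euc n →ₗ[ℝ] ℝ :=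
  (g (φ.symm y)).compl₁₂ (mfderiv (𝓡 n) (𝓡 n) φ.symm y).toLinearMap
    (mfderiv (𝓡 n) (𝓡 n) φ.symm y).toLinearMap

theorem bilin_eq_sum {d : ℕ} (B : Euc d →ₗ[ℝ] Euc d →ₗ[ℝ] ℝ) (v w : Euc d) :
    B v w = ∑ p : Fin d × Fin d, (v p.1 * w p.2) *
      B (EuclideanSpace.single p.1 1) (EuclideanSpace.single p.2 1) := by
  have h : ∀ v : Euc d, v = ∑ l, v l • EuclideanSpace.single l (1 : ℝ) := fun v => by
    ext j; simp [Finset.sum_apply, Pi.single_apply]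
  conv_lhs => rw [h v, h w]
  simp only [map_sum, LinearMap.sum_apply, map_smul, LinearMap.smul_apply, smul_eq_mul,
    Fintype.sum_prod_type, Finset.mul_sum]
  rw [Finset.sum_comm]
  refine Finset.sum_congr rfl fun i _ => Finset.sum_congr rfl fun j _ => by ring

end Charts

/-! ### Derivatives of metric components and Christoffel symbols under a change of chart. -/

section ComponentDerivatives

variable {n : ℕ} {M : Type*} [TopologicalSpace M] [ChartedSpace (Euc n) M]
  {φ φ' : OpenPartialHomeomorph M (Euc n)} {g : BilinField n M}

/-- The components of `g` in the chart `φ` with respect to two fixed vectors. -/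
noncomputable def comp₂ (φ : OpenPartialHomeomorph M (Euc n)) (g : BilinField n M)
    (v w : Euc n) (y : Euc n) : ℝ :=
  components φ (fun p a b => g p a b) y v w

/-- The components of `g` in the chart `φ` with respect to the standard basis. -/
noncomputable def compBasis (φ : OpenPartialHomeomorph M (Euc n)) (g : BilinField n M)
    (p : Fin n × Fin n) : Euc n → ℝ :=
  comp₂ φ g (EuclideanSpace.single p.1 1) (EuclideanSpace.single p.2 1)

/-- The components of `g` in the chart `φ` are differentiable at `y`. -/
def CompDiffAt (φ : OpenPartialHomeomorph M (Euc n)) (g : BilinField n M) (y : Euc n) : Prop :=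
  ∀ v w, DifferentiableAt ℝ (comp₂ φ g v w) y

/-- Coefficients of the change of components under the change of coordinates `κ`. -/
noncomputable def transCoeff {n : ℕ} (κ : Euc n → Euc n) (v w : Euc n) (p : Fin n × Fin n)
    (y : Euc n) : ℝ :=
  (fderiv ℝ κ y v) p.1 * (fderiv ℝ κ y w) p.2

theorem comp₂_eq_sum (v w y : Euc n) :
    comp₂ φ g v w y = ∑ p : Fin n × Fin n, (v p.1 * w p.2) * compBasis φ g p y :=
  bilin_eq_sum (componentsBilin φ g y) v w

theorem comp₂_transition (hφ : φ ∈ IsManifold.maximalAtlas (𝓡 n) ∞ M)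
    (hφ' : φ' ∈ IsManifold.maximalAtlas (𝓡 n) ∞ M) {y : Euc n} (hy : y ∈ φ.target)
    (hy' : φ.symm y ∈ φ'.source) (v w : Euc n) :
    comp₂ φ g v w y = comp₂ φ' g (fderiv ℝ (φ' ∘ φ.symm) y v) (fderiv ℝ (φ' ∘ φ.symm) y w)
      ((φ' ∘ φ.symm) y) :=
  components_transition hφ hφ' _ hy hy' v w

theorem comp₂_transition_sum (hφ : φ ∈ IsManifold.maximalAtlas (𝓡 n) ∞ M)
    (hφ' : φ' ∈ IsManifold.maximalAtlas (𝓡 n) ∞ M) {y : Euc n} (hy : y ∈ φ.target)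
    (hy' : φ.symm y ∈ φ'.source) (v w : Euc n) :
    comp₂ φ g v w y = ∑ p : Fin n × Fin n, transCoeff (φ' ∘ φ.symm) v w p y *
      compBasis φ' g p ((φ' ∘ φ.symm) y) := by
  rw [comp₂_transition hφ hφ' hy hy', comp₂_eq_sum]
  rfl

theorem contDiffAt_fderiv_apply {κ : Euc n → Euc n} {y : Euc n} (hκ : ContDiffAt ℝ ∞ κ y)
    (v : Euc n) : ContDiffAt ℝ ∞ (fun z => fderiv ℝ κ z v) y :=
  (hκ.fderiv_right (m := ∞) (by simp)).clm_apply contDiffAt_const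

theorem contDiffAt_coord {f : Euc n → Euc n} {y : Euc n} (hf : ContDiffAt ℝ ∞ f y) (i : Fin n) :
    ContDiffAt ℝ ∞ (fun z => f z i) y :=
  (EuclideanSpace.proj (𝕜 := ℝ) i).contDiff.contDiffAt.comp y hf

theorem contDiffAt_transCoeff {κ : Euc n → Euc n} {y : Euc n} (hκ : ContDiffAt ℝ ∞ κ y)
    (v w : Euc n) (p : Fin n × Fin n) : ContDiffAt ℝ ∞ (transCoeff κ v w p) y :=
  (contDiffAt_coord (contDiffAt_fderiv_apply hκ v) p.1).mul
    (contDiffAt_coord (contDiffAt_fderiv_apply hκ w) p.2)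

theorem fderiv_coord {f : Euc n → Euc n} {y : Euc n} (hf : DifferentiableAt ℝ f y) (i : Fin n)
    (a : Euc n) : fderiv ℝ (fun z => f z i) y a = (fderiv ℝ f y a) i := by
  have := ((EuclideanSpace.proj (𝕜 := ℝ) i).hasFDerivAt.comp y hf.hasFDerivAt).fderiv
  exact DFunLike.congr_fun this a

theorem fderiv_transCoeff {κ : Euc n → Euc n} {y : Euc n} (hκ : ContDiffAt ℝ ∞ κ y)
    (v w a : Euc n) (p : Fin n × Fin n) : fderiv ℝ (transCoeff κ v w p) y a =
      (fderiv ℝ (fun z => fderiv ℝ κ z v) y a) p.1 * (fderiv ℝ κ y w) p.2 +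
      (fderiv ℝ κ y v) p.1 * (fderiv ℝ (fun z => fderiv ℝ κ z w) y a) p.2 := by
  have h1 := (contDiffAt_fderiv_apply hκ v).differentiableAt (by simp)
  have h2 := (contDiffAt_fderiv_apply hκ w).differentiableAt (by simp)
  have h1' := (contDiffAt_coord (contDiffAt_fderiv_apply hκ v) p.1).differentiableAt (by simp)
  have h2' := (contDiffAt_coord (contDiffAt_fderiv_apply hκ w) p.2).differentiableAt (by simp)
  change fderiv ℝ (fun z => (fderiv ℝ κ z v) p.1 * (fderiv ℝ κ z w) p.2) y a = _
  rw [fderiv_fun_mul h1' h2', ← fderiv_coord h1, ← fderiv_coord h2]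
  simp only [FunLike.coe_add, FunLike.coe_smul, Pi.add_apply, Pi.smul_apply, smul_eq_mul]
  ring

/-- Product and chain rule, with differentiability of the components in the chart `φ'` required at
the single image point only. This is what Rademacher's theorem provides almost everywhere. -/
theorem hasFDerivAt_comp₂_of_transition (hφ : φ ∈ IsManifold.maximalAtlas (𝓡 n) ∞ M)
    (hφ' : φ' ∈ IsManifold.maximalAtlas (𝓡 n) ∞ M) {y : Euc n} (hy : y ∈ φ.target)
    (hy' : φ.symm y ∈ φ'.source)
    (hd : ∀ p, DifferentiableAt ℝ (compBasis φ' g p) ((φ' ∘ φ.symm) y)) (v w : Euc n) :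
    DifferentiableAt ℝ (comp₂ φ g v w) y ∧ ∀ a, fderiv ℝ (comp₂ φ g v w) y a =
      ∑ p : Fin n × Fin n, (fderiv ℝ (transCoeff (φ' ∘ φ.symm) v w p) y a *
        compBasis φ' g p ((φ' ∘ φ.symm) y) + transCoeff (φ' ∘ φ.symm) v w p y *
        fderiv ℝ (compBasis φ' g p) ((φ' ∘ φ.symm) y) (fderiv ℝ (φ' ∘ φ.symm) y a)) := by
  have hκ := contDiffAt_transition hφ hφ' hy hy'
  have heq : comp₂ φ g v w =ᶠ[𝓝 y] fun z => ∑ p : Fin n × Fin n,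
      transCoeff (φ' ∘ φ.symm) v w p z * compBasis φ' g p ((φ' ∘ φ.symm) z) := by
    filter_upwards [eventually_mem_target_transition hy hy'] with z hz
    exact comp₂_transition_sum hφ hφ' hz.1 hz.2 v w
  have hp : ∀ p, HasFDerivAt (fun z => transCoeff (φ' ∘ φ.symm) v w p z *
      compBasis φ' g p ((φ' ∘ φ.symm) z)) _ y := fun p =>
    ((contDiffAt_transCoeff hκ v w p).differentiableAt (by simp)).hasFDerivAt.fun_mul
      (HasFDerivAt.comp (f := φ' ∘ φ.symm) y (hd p).hasFDerivAt
        (hκ.differentiableAt (by simp)).hasFDerivAt)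
  have hsum := (HasFDerivAt.fun_sum (u := Finset.univ) fun p _ => hp p).congr_of_eventuallyEq heq
  refine ⟨hsum.differentiableAt, fun a => ?_⟩
  rw [hsum.fderiv, sum_apply]
  refine Finset.sum_congr rfl fun p _ => ?_
  simp only [FunLike.coe_add, FunLike.coe_smul, Pi.add_apply, Pi.smul_apply, smul_eq_mul,
    ContinuousLinearMap.comp_apply, Function.comp_apply]
  ring

theorem fderiv_comp₂_eq_sum {y : Euc n} (hd : ∀ p, DifferentiableAt ℝ (compBasis φ g p) y)
    (v w : Euc n) : DifferentiableAt ℝ (comp₂ φ g v w) y ∧ ∀ a, fderiv ℝ (comp₂ φ g v w) y a =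
      ∑ p : Fin n × Fin n, (v p.1 * w p.2) * fderiv ℝ (compBasis φ g p) y a := by
  have h : comp₂ φ g v w = fun y => ∑ p : Fin n × Fin n, (v p.1 * w p.2) * compBasis φ g p y := by
    funext y; exact comp₂_eq_sum v w y
  have hp : ∀ p : Fin n × Fin n, HasFDerivAt (fun y => (v p.1 * w p.2) * compBasis φ g p y) _ y :=
    fun p => (hd p).hasFDerivAt.const_mul (v p.1 * w p.2)
  have hsum := HasFDerivAt.fun_sum (u := Finset.univ) fun p _ => hp p
  rw [← h] at hsum
  refine ⟨hsum.differentiableAt, fun a => ?_⟩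
  rw [hsum.fderiv, sum_apply]
  rfl

theorem compDiffAt_iff {y : Euc n} :
    CompDiffAt φ g y ↔ ∀ p, DifferentiableAt ℝ (compBasis φ g p) y :=
  ⟨fun h _ => h _ _, fun h v w => (fderiv_comp₂_eq_sum h v w).1⟩

theorem CompDiffAt.transition (hφ : φ ∈ IsManifold.maximalAtlas (𝓡 n) ∞ M)
    (hφ' : φ' ∈ IsManifold.maximalAtlas (𝓡 n) ∞ M) {y : Euc n} (hy : y ∈ φ.target)
    (hy' : φ.symm y ∈ φ'.source) (hd : CompDiffAt φ' g ((φ' ∘ φ.symm) y)) : CompDiffAt φ g y :=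
  fun v w => (hasFDerivAt_comp₂_of_transition hφ hφ' hy hy' (compDiffAt_iff.1 hd) v w).1

/-- The derivative of the components under a change of charts. -/
theorem fderiv_comp₂_transition (hφ : φ ∈ IsManifold.maximalAtlas (𝓡 n) ∞ M)
    (hφ' : φ' ∈ IsManifold.maximalAtlas (𝓡 n) ∞ M) {y : Euc n} (hy : y ∈ φ.target)
    (hy' : φ.symm y ∈ φ'.source) (hd : CompDiffAt φ' g ((φ' ∘ φ.symm) y)) (v w a : Euc n) :
    fderiv ℝ (comp₂ φ g v w) y a =
      fderiv ℝ (comp₂ φ' g (fderiv ℝ (φ' ∘ φ.symm) y v) (fderiv ℝ (φ' ∘ φ.symm) y w))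
        ((φ' ∘ φ.symm) y) (fderiv ℝ (φ' ∘ φ.symm) y a) +
      comp₂ φ' g (fderiv ℝ (fun z => fderiv ℝ (φ' ∘ φ.symm) z v) y a)
        (fderiv ℝ (φ' ∘ φ.symm) y w) ((φ' ∘ φ.symm) y) +
      comp₂ φ' g (fderiv ℝ (φ' ∘ φ.symm) y v)
        (fderiv ℝ (fun z => fderiv ℝ (φ' ∘ φ.symm) z w) y a) ((φ' ∘ φ.symm) y) := by
  have hκ := contDiffAt_transition hφ hφ' hy hy'
  have hd' := compDiffAt_iff.1 hd
  rw [(hasFDerivAt_comp₂_of_transition hφ hφ' hy hy' hd' v w).2 a, (fderiv_comp₂_eq_sum hd' _ _).2,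
    comp₂_eq_sum (g := g) (φ := φ') (fderiv ℝ (fun z => fderiv ℝ (φ' ∘ φ.symm) z v) y a),
    comp₂_eq_sum (g := g) (φ := φ') (fderiv ℝ (φ' ∘ φ.symm) y v), ← Finset.sum_add_distrib,
    ← Finset.sum_add_distrib]
  refine Finset.sum_congr rfl fun p _ => ?_
  rw [fderiv_transCoeff hκ, transCoeff]
  ring

/-- The transformation law of the Christoffel symbols of the first kind. -/
theorem christoffel_transition (hφ : φ ∈ IsManifold.maximalAtlas (𝓡 n) ∞ M)
    (hφ' : φ' ∈ IsManifold.maximalAtlas (𝓡 n) ∞ M) (hg : ∀ p v w, g p v w = g p w v)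
    {y : Euc n} (hy : y ∈ φ.target)
    (hy' : φ.symm y ∈ φ'.source) (hd : CompDiffAt φ' g ((φ' ∘ φ.symm) y)) (a b c : Euc n) :
    christoffel φ g y a b c =
      christoffel φ' g ((φ' ∘ φ.symm) y) (fderiv ℝ (φ' ∘ φ.symm) y a)
        (fderiv ℝ (φ' ∘ φ.symm) y b) (fderiv ℝ (φ' ∘ φ.symm) y c) +
      comp₂ φ' g (fderiv ℝ (fun z => fderiv ℝ (φ' ∘ φ.symm) z b) y a)
        (fderiv ℝ (φ' ∘ φ.symm) y c) ((φ' ∘ φ.symm) y) := by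
  have hκ := contDiffAt_transition hφ hφ' hy hy'
  -- Of the six terms with second derivatives of the transition map, symmetry cancels four in pairs
  -- and makes the other two equal; the factor 1/2 then leaves one of them.
  have hsymm : ∀ u v : Euc n, fderiv ℝ (fun z => fderiv ℝ (φ' ∘ φ.symm) z v) y u =
      fderiv ℝ (fun z => fderiv ℝ (φ' ∘ φ.symm) z u) y v := by
    have hdd : DifferentiableAt ℝ (fderiv ℝ (φ' ∘ φ.symm)) y :=
      (hκ.fderiv_right (m := ∞) (by simp)).differentiableAt (by simp)
    have hap : ∀ u v : Euc n, fderiv ℝ (fun z => fderiv ℝ (φ' ∘ φ.symm) z v) y u =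
        fderiv ℝ (fderiv ℝ (φ' ∘ φ.symm)) y u v := fun u v => by
      rw [fderiv_clm_apply hdd (differentiableAt_const v)]
      simp
    intro u v
    rw [hap, hap]
    exact hκ.isSymmSndFDerivAt
      (by rw [minSmoothness_of_isRCLikeNormedField]; 
          exact (show ((2 : ℕ∞) : WithTop ℕ∞) ≤ ((⊤ : ℕ∞) : WithTop ℕ∞) from
            WithTop.coe_le_coe.2 le_top)) u v
  have hcs : ∀ v w, comp₂ φ' g v w ((φ' ∘ φ.symm) y) = comp₂ φ' g w v ((φ' ∘ φ.symm) y) :=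
    fun v w => hg _ _ _
  change (fderiv ℝ (comp₂ φ g b c) y a + fderiv ℝ (comp₂ φ g a c) y b -
    fderiv ℝ (comp₂ φ g a b) y c) / 2 = (fderiv ℝ (comp₂ φ' g _ _) _ _ +
    fderiv ℝ (comp₂ φ' g _ _) _ _ - fderiv ℝ (comp₂ φ' g _ _) _ _) / 2 + _
  rw [fderiv_comp₂_transition hφ hφ' hy hy' hd, fderiv_comp₂_transition hφ hφ' hy hy' hd,
    fderiv_comp₂_transition hφ hφ' hy hy' hd, hsymm b a, hsymm c a, hsymm c b,
    hcs (fderiv ℝ (fun z => fderiv ℝ (φ' ∘ φ.symm) z c) y a)]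
  ring

end ComponentDerivatives

/-- Identities valid along the joint filter can be differentiated in the second variable with the
first one held fixed, because they then hold on a whole neighbourhood of the second variable. -/
theorem eventually_eventually_prod {X Y : Type*} [TopologicalSpace Y] {l : Filter X} {y₀ : Y}
    {P : X × Y → Prop} (h : ∀ᶠ q in l ×ˢ 𝓝 y₀, P q) :
    ∀ᶠ q in l ×ˢ 𝓝 y₀, ∀ᶠ y in 𝓝 q.2, P (q.1, y) := by
  obtain ⟨pa, ha, pb, hb, hab⟩ := eventually_prod_iff.1 h
  filter_upwards [ha.prod_mk (eventually_eventually_nhds.2 hb)] with q hq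
  filter_upwards [hq.2] with y hy using hab hq.1 hy

/-! ### The manifold convolution of functions. -/

section Convolution

variable {n : ℕ} {M : Type*} [TopologicalSpace M] [ChartedSpace (Euc n) M]
  (D : RegularisationData n M)

namespace RegularisationData

/-- The finitely many indices relevant near `p₀`. -/
theorem exists_finset (p₀ : M) : ∃ I : Finset ℕ, (∀ α ∈ I, p₀ ∈ (D.chart α).source) ∧
    ∀ᶠ p in 𝓝 p₀, ∀ α ∉ I, D.χ α p = 0 := by
  classical
  obtain ⟨t, ht, hfin⟩ := D.locallyFinite p₀
  refine ⟨hfin.toFinset.filter fun α => p₀ ∈ tsupport (D.χ α), fun α hα =>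
    D.χ_support α (Finset.mem_filter.1 hα).2, ?_⟩
  have h1 : ∀ᶠ p in 𝓝 p₀, ∀ α ∈ hfin.toFinset, p₀ ∉ tsupport (D.χ α) → D.χ α p = 0 := by
    refine (Filter.eventually_all_finset _).2 fun α _ => ?_
    by_cases hα : p₀ ∈ tsupport (D.χ α)
    · exact Eventually.of_forall fun p h => absurd hα h
    · filter_upwards [(isClosed_tsupport (D.χ α)).isOpen_compl.mem_nhds hα] with p hp _
      exact image_eq_zero_of_notMem_tsupport hp
  filter_upwards [h1, ht] with p hp hpt α hα
  by_cases hJ : α ∈ hfin.toFinset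
  · exact hp α hJ fun h => hα (Finset.mem_filter.2 ⟨hJ, h⟩)
  · refine image_eq_zero_of_notMem_tsupport fun h => hJ ?_
    rw [Set.Finite.mem_toFinset]
    exact ⟨p, D.χ_support α h, hpt⟩

theorem χ_mul_ξ (α : ℕ) (p : M) : D.χ α p * D.ξ α p = D.ξ α p := by
  by_cases h : D.ξ α p = 0
  · rw [h, mul_zero]
  · have h1 : p ∈ tsupport (D.ξ α) := subset_tsupport _ h
    rw [(eventually_nhdsSet_iff_forall.1 (D.χ_eq_one α) p h1).self_of_nhds, one_mul]

/-- Each χ equals one on the support of its ξ, so the products still form a partition of unity. That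
the sum is constant is what later removes the errors from differentiating the cut-off functions. -/
theorem sum_χ_mul_ξ {I : Finset ℕ} {p : M} (h : ∀ α ∉ I, D.χ α p = 0) :
    ∑ α ∈ I, D.χ α p * D.ξ α p = 1 := by
  rw [← D.ξ.sum_eq_one (mem_univ p)]
  simp only [D.χ_mul_ξ]
  refine (finsum_eq_sum_of_support_subset _ fun α hα => ?_).symm
  by_contra hI
  refine hα ?_
  change D.ξ α p = 0
  rw [← D.χ_mul_ξ, h α hI, zero_mul]

theorem conv_eq_sum {I : Finset ℕ} {p : M} (h : ∀ α ∉ I, D.χ α p = 0) (f : M → ℝ) (ε : ℝ) :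
    D.conv f ε p = ∑ α ∈ I, D.χ α p * mollAverage D.mollifier (D.chart α).target
      (fun y => D.ξ α ((D.chart α).symm y) * f ((D.chart α).symm y)) ε (D.chart α p) := by
  unfold conv
  refine finsum_eq_sum_of_support_subset _ fun α hα => ?_
  by_contra hI
  refine hα ?_
  change D.χ α p * _ = 0
  rw [h α hI, zero_mul]

theorem tendsto_chart {α : ℕ} {p₀ : M} (hp₀ : p₀ ∈ (D.chart α).source) :
    Tendsto (fun q : ℝ × M => (q.1, D.chart α q.2)) (𝓝[>] 0 ×ˢ 𝓝 p₀)
      (𝓝[>] 0 ×ˢ 𝓝 (D.chart α p₀)) :=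
  tendsto_fst.prodMk (((D.chart α).continuousAt hp₀).tendsto.comp tendsto_snd)

theorem contDiffAt_ξ {α : ℕ} {p₀ : M} (hp₀ : p₀ ∈ (D.chart α).source) :
    ContDiffAt ℝ ∞ (fun y => D.ξ α ((D.chart α).symm y)) (D.chart α p₀) := by
  rw [← contMDiffAt_iff_contDiffAt]
  exact ((D.ξ α).contMDiff.contMDiffAt).comp _
    (contMDiffAt_symm_of_mem_maximalAtlas (D.chart_mem α) ((D.chart α).map_source hp₀))

theorem continuousAt_ξ {α : ℕ} {p₀ : M} (hp₀ : p₀ ∈ (D.chart α).source) :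
    ∀ᶠ y in 𝓝 (D.chart α p₀), ContinuousAt (fun y => D.ξ α ((D.chart α).symm y)) y :=
  (eventually_contDiffAt_one ((D.contDiffAt_ξ hp₀).of_le (by simp))).mono
    fun _ h => h.continuousAt

/-- The function `f` is essentially bounded near `p₀` in all charts of the family. -/
def LocBdd (f : M → ℝ) (p₀ : M) : Prop :=
  ∀ α, p₀ ∈ (D.chart α).source →
    LocEssBounded (fun y => f ((D.chart α).symm y)) (D.chart α p₀)

/-- A property holds near `p₀` almost everywhere in all charts of the family. -/
def EventuallyAE (P : M → Prop) (p₀ : M) : Prop :=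
  ∀ α, p₀ ∈ (D.chart α).source →
    ∀ᶠ y in 𝓝 (D.chart α p₀) ⊓ ae volume, P ((D.chart α).symm y)

variable {D}

theorem locBdd_ξ_mul {f : M → ℝ} {p₀ : M} (hf : D.LocBdd f p₀) {α : ℕ}
    (hα : p₀ ∈ (D.chart α).source) : LocEssBounded
      (fun y => D.ξ α ((D.chart α).symm y) * f ((D.chart α).symm y)) (D.chart α p₀) :=
  (LocEssBounded.of_continuousAt (D.continuousAt_ξ hα)).mul (hf α hα)

/-- The convolutions of functions which agree asymptotically at `p₀` agree asymptotically. -/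
theorem tendsto_conv_sub {f h : M → ℝ} {p₀ : M} (hf : D.LocBdd f p₀) (hh : D.LocBdd h p₀)
    (hfh : ∀ η > 0, D.EventuallyAE (fun p => |f p - h p| ≤ η) p₀) :
    Tendsto (fun q : ℝ × M => D.conv f q.1 q.2 - D.conv h q.1 q.2) (𝓝[>] 0 ×ˢ 𝓝 p₀) (𝓝 0) := by
  obtain ⟨I, hI, hev⟩ := D.exists_finset p₀
  have key : ∀ α ∈ I, Tendsto (fun q : ℝ × M => D.χ α q.2 *
      (mollAverage D.mollifier (D.chart α).target
        (fun y => D.ξ α ((D.chart α).symm y) * f ((D.chart α).symm y)) q.1 (D.chart α q.2) -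
      mollAverage D.mollifier (D.chart α).target
        (fun y => D.ξ α ((D.chart α).symm y) * h ((D.chart α).symm y)) q.1 (D.chart α q.2)))
      (𝓝[>] 0 ×ˢ 𝓝 p₀) (𝓝 0) := by
    intro α hα
    have hp₀ := hI α hα
    have h1 : Tendsto (fun y => f ((D.chart α).symm y) - h ((D.chart α).symm y))
        (𝓝 (D.chart α p₀) ⊓ ae volume) (𝓝 0) := by
      rw [Metric.tendsto_nhds]
      intro η hη
      filter_upwards [hfh (η / 2) (by positivity) α hp₀] with y hy
      rw [Real.dist_0_eq_abs]; linarith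
    have hξ : Tendsto (fun y => D.ξ α ((D.chart α).symm y)) (𝓝 (D.chart α p₀) ⊓ ae volume)
        (𝓝 (D.ξ α ((D.chart α).symm (D.chart α p₀)))) :=
      (D.continuousAt_ξ hp₀).self_of_nhds.tendsto.mono_left inf_le_left
    have h2 := hξ.mul h1
    rw [mul_zero] at h2
    have h3 := (D.isMollifierFamily.tendsto_mollAverage_sub (D.chart α).open_target
      ((D.chart α).map_source hp₀) (locBdd_ξ_mul hf hp₀) (locBdd_ξ_mul hh hp₀)
      (h2.congr fun y => mul_sub _ _ _)).comp (D.tendsto_chart hp₀)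
    have h4 : Tendsto (fun q : ℝ × M => D.χ α q.2) (𝓝[>] 0 ×ˢ 𝓝 p₀) (𝓝 (D.χ α p₀)) :=
      ((D.χ_smooth α).continuous.tendsto p₀).comp tendsto_snd
    simpa using! h4.mul h3
  have hsum := tendsto_finsetSum I key
  rw [Finset.sum_const_zero] at hsum
  refine hsum.congr' ?_
  filter_upwards [hev.prod_inr _] with q hq
  rw [D.conv_eq_sum hq, D.conv_eq_sum hq, ← Finset.sum_sub_distrib]
  exact Finset.sum_congr rfl fun α _ => mul_sub _ _ _

theorem LocBdd.const (c : ℝ) (p₀ : M) : D.LocBdd (fun _ => c) p₀ := fun _ _ => .const c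

theorem LocBdd.const_mul {f : M → ℝ} {p₀ : M} (hf : D.LocBdd f p₀) (c : ℝ) :
    D.LocBdd (fun p => c * f p) p₀ := fun α hα => (hf α hα).const_mul c

theorem LocBdd.sum {κ : Type*} (s : Finset κ) {f : κ → M → ℝ} {p₀ : M}
    (hf : ∀ i ∈ s, D.LocBdd (f i) p₀) : D.LocBdd (fun p => ∑ i ∈ s, f i p) p₀ :=
  fun α hα => LocEssBounded.sum s fun i hi => hf i hi α hα

/-- A constant is not reproduced exactly, since it is each `ξ α` times the constant that is
convolved. The summands tend to χ ξ c, and these limits add up to c. -/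
theorem tendsto_conv_const (c : ℝ) (p₀ : M) :
    Tendsto (fun q : ℝ × M => D.conv (fun _ => c) q.1 q.2) (𝓝[>] 0 ×ˢ 𝓝 p₀) (𝓝 c) := by
  obtain ⟨I, hI, hev⟩ := D.exists_finset p₀
  have key : ∀ α ∈ I, Tendsto (fun q : ℝ × M => D.χ α q.2 *
      (mollAverage D.mollifier (D.chart α).target
        (fun y => D.ξ α ((D.chart α).symm y) * c) q.1 (D.chart α q.2)))
      (𝓝[>] 0 ×ˢ 𝓝 p₀) (𝓝 (D.χ α p₀ * (D.ξ α p₀ * c))) := by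
    intro α hα
    have hp₀ := hI α hα
    have h0 : ∀ᶠ y in 𝓝 (D.chart α p₀),
        ContinuousAt (fun y => D.ξ α ((D.chart α).symm y) * c) y :=
      (D.continuousAt_ξ hp₀).mono fun y hy => ContinuousAt.fun_mul hy continuousAt_const
    have h1 := (D.isMollifierFamily.tendsto_mollAverage_of_continuousAt (D.chart α).open_target
      ((D.chart α).map_source hp₀) h0).comp (D.tendsto_chart hp₀)
    have h4 : Tendsto (fun q : ℝ × M => D.χ α q.2) (𝓝[>] 0 ×ˢ 𝓝 p₀) (𝓝 (D.χ α p₀)) :=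
      ((D.χ_smooth α).continuous.tendsto p₀).comp tendsto_snd
    rw [(D.chart α).left_inv hp₀] at h1
    exact h4.mul h1
  have hsum := tendsto_finsetSum I key
  have hlim : ∑ α ∈ I, D.χ α p₀ * (D.ξ α p₀ * c) = c := by
    have := D.sum_χ_mul_ξ hev.self_of_nhds
    calc _ = (∑ α ∈ I, D.χ α p₀ * D.ξ α p₀) * c := by
          rw [Finset.sum_mul]; simp only [mul_assoc]
      _ = c := by rw [this, one_mul]
  rw [hlim] at hsum
  refine hsum.congr' ?_
  filter_upwards [hev.prod_inr _] with q hq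
  rw [D.conv_eq_sum hq]

/-- Linearity holds only eventually: the integrands are known to be integrable only when the
mollifier is supported near `p₀`. -/
theorem eventually_conv_sum {κ : Type*} [Fintype κ] {f : κ → M → ℝ} {p₀ : M} (c : κ → ℝ)
    (hf : ∀ i, D.LocBdd (f i) p₀) :
    ∀ᶠ q : ℝ × M in 𝓝[>] 0 ×ˢ 𝓝 p₀,
      D.conv (fun p => ∑ i, c i * f i p) q.1 q.2 = ∑ i, c i * D.conv (f i) q.1 q.2 := by
  obtain ⟨I, hI, hev⟩ := D.exists_finset p₀
  have hint : ∀ᶠ q : ℝ × M in 𝓝[>] 0 ×ˢ 𝓝 p₀, ∀ α ∈ I, ∀ i, Integrable (fun y =>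
      (D.ξ α ((D.chart α).symm y) * f i ((D.chart α).symm y)) *
        D.mollifier q.1 (D.chart α q.2 - y)) :=
    (Filter.eventually_all_finset I).2 fun α hα => eventually_all.2 fun i =>
      (D.tendsto_chart (hI α hα)).eventually
        ((locBdd_ξ_mul (hf i) (hI α hα)).eventually_integrable D.isMollifierFamily)
  filter_upwards [hev.prod_inr _, hint] with q hq hqi
  simp only [D.conv_eq_sum hq]
  simp only [Finset.mul_sum]
  rw [Finset.sum_comm]
  refine Finset.sum_congr rfl fun α hα => ?_
  simp only [← mul_assoc, mul_comm _ (D.χ α q.2)]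
  simp only [mul_assoc, ← Finset.mul_sum]
  congr 1
  unfold mollAverage
  simp only [← integral_const_mul]
  rw [← integral_finsetSum _ fun i _ => ((hqi α hα i).const_mul (c i)).restrict]
  refine integral_congr_ae (Eventually.of_forall fun y => ?_)
  simp only [Finset.mul_sum, Finset.sum_mul]
  exact Finset.sum_congr rfl fun i _ => by ring

/-- Upper bounds survive convolution, asymptotically. -/
theorem eventually_conv_le {f : M → ℝ} {p₀ : M} (hf : D.LocBdd f p₀) {c c' : ℝ} (hc : c < c')
    (hfc : D.EventuallyAE (fun p => f p ≤ c) p₀) :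
    ∀ᶠ q : ℝ × M in 𝓝[>] 0 ×ˢ 𝓝 p₀, D.conv f q.1 q.2 ≤ c' := by
  obtain ⟨I, hI, hev⟩ := D.exists_finset p₀
  have key : ∀ᶠ q : ℝ × M in 𝓝[>] 0 ×ˢ 𝓝 p₀, ∀ α ∈ I,
      D.χ α q.2 * mollAverage D.mollifier (D.chart α).target
        (fun y => D.ξ α ((D.chart α).symm y) * f ((D.chart α).symm y)) q.1 (D.chart α q.2) ≤
      D.χ α q.2 * mollAverage D.mollifier (D.chart α).target
        (fun y => D.ξ α ((D.chart α).symm y) * c) q.1 (D.chart α q.2) := by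
    refine (Filter.eventually_all_finset I).2 fun α hα => ?_
    have hp₀ := hI α hα
    -- The cut-off χ has no prescribed sign. If `p₀` lies in the support of ξ, then χ = 1 nearby and
    -- monotonicity of averages applies; otherwise ξ vanishes near `p₀` and both averages are
    -- eventually zero.
    by_cases hξ : p₀ ∈ tsupport (D.ξ α)
    · have hle := (D.tendsto_chart hp₀).eventually <|
        D.isMollifierFamily.eventually_mollAverage_mono (locBdd_ξ_mul hf hp₀)
          (locBdd_ξ_mul (LocBdd.const c p₀) hp₀) (D.chart α).open_target
          ((D.chart α).map_source hp₀) <| by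
          filter_upwards [hfc α hp₀] with y hy
          exact mul_le_mul_of_nonneg_left hy (D.ξ.nonneg _ _)
      filter_upwards [hle, (eventually_nhdsSet_iff_forall.1 (D.χ_eq_one α) p₀ hξ).prod_inr _]
        with q hq hχ
      rw [hχ, one_mul, one_mul]
      exact hq
    · have h0 : ∀ᶠ y in 𝓝 (D.chart α p₀), D.ξ α ((D.chart α).symm y) = 0 := by
        have h1 : ∀ᶠ p in 𝓝 p₀, D.ξ α p = 0 := by
          filter_upwards [(isClosed_tsupport (D.ξ α)).isOpen_compl.mem_nhds hξ] with p hp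
          exact image_eq_zero_of_notMem_tsupport hp
        have h2 := (D.chart α).continuousAt_symm ((D.chart α).map_source hp₀)
        rw [ContinuousAt, (D.chart α).left_inv hp₀] at h2
        exact h2.eventually h1
      have hz : ∀ h : M → ℝ, ∀ᶠ q : ℝ × M in 𝓝[>] 0 ×ˢ 𝓝 p₀,
          mollAverage D.mollifier (D.chart α).target
            (fun y => D.ξ α ((D.chart α).symm y) * h ((D.chart α).symm y)) q.1
            (D.chart α q.2) = 0 := fun h => by
        have := (D.tendsto_chart hp₀).eventually <|
          D.isMollifierFamily.eventually_abs_mollAverage_le (C := 0) (D.chart α).open_target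
            ((D.chart α).map_source hp₀) (F := fun y => D.ξ α ((D.chart α).symm y) *
              h ((D.chart α).symm y)) <| mem_inf_of_left <| by
            filter_upwards [h0] with y hy
            simp [hy]
        filter_upwards [this] with q hq
        exact abs_nonpos_iff.1 hq
      filter_upwards [hz f, hz (fun _ => c)] with q h1 h2
      rw [h1, h2]
  filter_upwards [key, hev.prod_inr _, (tendsto_conv_const (D := D) c p₀).eventually (gt_mem_nhds hc)]
    with q h1 h2 h3
  refine le_trans ?_ h3.le
  rw [D.conv_eq_sum h2, D.conv_eq_sum h2]
  exact Finset.sum_le_sum h1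

end RegularisationData

end Convolution

/-! ### First derivatives of the convolved metric. -/

section ConvolutionOfMetric

variable {n : ℕ} {M : Type*} [TopologicalSpace M] [ChartedSpace (Euc n) M]
  {D : RegularisationData n M} {φ : OpenPartialHomeomorph M (Euc n)} {g : BilinField n M}

theorem IsLocallyLipschitz.lipschitzNear (hg : IsLocallyLipschitz g)
    (hφ : φ ∈ IsManifold.maximalAtlas (𝓡 n) ∞ M) {y : Euc n} (hy : y ∈ φ.target) (v w : Euc n) :
    LipschitzNear (comp₂ φ g v w) y := by
  obtain ⟨K, t, ht, h⟩ := hg φ hφ v w hy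
  rw [φ.open_target.nhdsWithin_eq hy] at ht
  exact ⟨K, t, ht, h⟩

theorem IsLocallyLipschitz.eventually_compDiffAt (hg : IsLocallyLipschitz g)
    (hφ : φ ∈ IsManifold.maximalAtlas (𝓡 n) ∞ M) {y : Euc n} (hy : y ∈ φ.target) :
    ∀ᶠ x in 𝓝 y ⊓ ae volume, CompDiffAt φ g x := by
  have : ∀ᶠ x in 𝓝 y ⊓ ae volume, ∀ p, DifferentiableAt ℝ (compBasis φ g p) x :=
    eventually_all.2 fun p => (hg.lipschitzNear hφ hy _ _).eventually_differentiableAt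
  filter_upwards [this] with x hx using compDiffAt_iff.2 hx

/-- The function `∂_a g(v, w)` of the components of `g` in the chart `φ`. -/
noncomputable def derivComp (φ : OpenPartialHomeomorph M (Euc n)) (g : BilinField n M)
    (v w a : Euc n) (p : M) : ℝ :=
  fderiv ℝ (comp₂ φ g v w) (φ p) a

theorem eventually_continuousAt_comp_transition {φ' : OpenPartialHomeomorph M (Euc n)}
    (hφ : φ ∈ IsManifold.maximalAtlas (𝓡 n) ∞ M) (hφ' : φ' ∈ IsManifold.maximalAtlas (𝓡 n) ∞ M)
    {y₀ : Euc n} (hy₀ : y₀ ∈ φ.target) (hy' : φ.symm y₀ ∈ φ'.source) {F : Type*}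
    [NormedAddCommGroup F] [NormedSpace ℝ F] {c : Euc n → F} (hc : ContDiffAt ℝ ∞ c y₀) :
    ∀ᶠ x in 𝓝 (φ' (φ.symm y₀)), ContinuousAt (fun x => c ((φ ∘ φ'.symm) x)) x := by
  have hφs : φ'.symm (φ' (φ.symm y₀)) ∈ φ.source := by
    rw [φ'.left_inv hy']; exact φ.map_target hy₀
  have hl : ContDiffAt ℝ ∞ (φ ∘ φ'.symm) (φ' (φ.symm y₀)) :=
    contDiffAt_transition hφ' hφ (φ'.map_source hy') hφs
  have hl₀ : (φ ∘ φ'.symm) (φ' (φ.symm y₀)) = y₀ := by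
    rw [Function.comp_apply, φ'.left_inv hy', φ.right_inv hy₀]
  rw [← hl₀] at hc
  exact (eventually_contDiffAt_one ((hc.comp _ hl).of_le (by simp))).mono
    fun _ h => h.continuousAt

/-- The derivatives of the components in the chart `φ`, in terms of the chart `φ'`. -/
theorem eventually_derivComp_eq {φ' : OpenPartialHomeomorph M (Euc n)}
    (hφ : φ ∈ IsManifold.maximalAtlas (𝓡 n) ∞ M) (hφ' : φ' ∈ IsManifold.maximalAtlas (𝓡 n) ∞ M)
    (hg : IsLocallyLipschitz g) {x₀ : Euc n} (hx₀ : x₀ ∈ φ'.target) (hφs : φ'.symm x₀ ∈ φ.source)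
    (v w a : Euc n) :
    ∀ᶠ x in 𝓝 x₀ ⊓ ae volume, derivComp φ g v w a (φ'.symm x) = ∑ p : Fin n × Fin n,
        (fderiv ℝ (transCoeff (φ' ∘ φ.symm) v w p) ((φ ∘ φ'.symm) x) a *
          compBasis φ' g p x + transCoeff (φ' ∘ φ.symm) v w p ((φ ∘ φ'.symm) x) *
          fderiv ℝ (compBasis φ' g p) x (fderiv ℝ (φ' ∘ φ.symm) ((φ ∘ φ'.symm) x) a)) := by
  filter_upwards [hg.eventually_compDiffAt hφ' hx₀,
    mem_inf_of_left (eventually_mem_target_transition hx₀ hφs)] with x hd hx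
  have h1 : (φ ∘ φ'.symm) x ∈ φ.target := φ.map_source hx.2
  have h2 : φ.symm ((φ ∘ φ'.symm) x) ∈ φ'.source := by
    rw [Function.comp_apply, φ.left_inv hx.2]; exact φ'.map_target hx.1
  have h3 : (φ' ∘ φ.symm) ((φ ∘ φ'.symm) x) = x := by
    rw [Function.comp_apply, Function.comp_apply, φ.left_inv hx.2, φ'.right_inv hx.1]
  have h4 := (hasFDerivAt_comp₂_of_transition hφ hφ' h1 h2
    (by rw [h3]; exact compDiffAt_iff.1 hd) v w).2 a
  rw [h3] at h4
  exact h4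

theorem contDiffAt_fderiv_transCoeff {κ : Euc n → Euc n} {y : Euc n} (hκ : ContDiffAt ℝ ∞ κ y)
    (v w a : Euc n) (p : Fin n × Fin n) :
    ContDiffAt ℝ ∞ (fun y => fderiv ℝ (transCoeff κ v w p) y a) y :=
  ((contDiffAt_transCoeff hκ v w p).fderiv_right (m := ∞) (by simp)).clm_apply contDiffAt_const

/-- Seen from another chart, the derivative is a combination, with smooth coefficients, of Lipschitz
components and their bounded derivatives. The bound is needed in the charts of the regularisation,
while `φ` is chosen independently of them. -/
theorem locEssBounded_derivComp {φ' : OpenPartialHomeomorph M (Euc n)}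
    (hφ : φ ∈ IsManifold.maximalAtlas (𝓡 n) ∞ M) (hφ' : φ' ∈ IsManifold.maximalAtlas (𝓡 n) ∞ M)
    (hg : IsLocallyLipschitz g) {y₀ : Euc n} (hy₀ : y₀ ∈ φ.target) (hy' : φ.symm y₀ ∈ φ'.source)
    (v w a : Euc n) :
    LocEssBounded (fun x => derivComp φ g v w a (φ'.symm x)) (φ' (φ.symm y₀)) := by
  have hκ := contDiffAt_transition hφ hφ' hy₀ hy'
  have hx₀ := φ'.map_source hy'
  have hφs : φ'.symm (φ' (φ.symm y₀)) ∈ φ.source := by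
    rw [φ'.left_inv hy']; exact φ.map_target hy₀
  have hev := eventually_derivComp_eq hφ hφ' hg hx₀ hφs v w a
  refine LocEssBounded.congr (LocEssBounded.sum Finset.univ fun p _ => ?_)
    (hev.mono fun x hx => hx.symm)
  have hb := hg.lipschitzNear hφ' hx₀ (EuclideanSpace.single p.1 1) (EuclideanSpace.single p.2 1)
  refine LocEssBounded.add ((LocEssBounded.of_continuousAt
    (eventually_continuousAt_comp_transition hφ hφ' hy₀ hy'
      (contDiffAt_fderiv_transCoeff hκ v w a p))).mul (.of_continuousAt hb.eventually_continuousAt))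
    ((LocEssBounded.of_continuousAt (eventually_continuousAt_comp_transition hφ hφ' hy₀ hy'
      (contDiffAt_transCoeff hκ v w p))).mul ?_)
  have h1 : (fun x => fderiv ℝ (compBasis φ' g p) x
      (fderiv ℝ (φ' ∘ φ.symm) ((φ ∘ φ'.symm) x) a)) = fun x => ∑ l,
      (fderiv ℝ (φ' ∘ φ.symm) ((φ ∘ φ'.symm) x) a) l *
        fderiv ℝ (compBasis φ' g p) x (EuclideanSpace.single l 1) := by
    funext x
    exact sum_apply_eq _ _
  rw [h1]
  exact LocEssBounded.sum Finset.univ fun l _ => (LocEssBounded.of_continuousAt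
    (eventually_continuousAt_comp_transition hφ hφ' hy₀ hy'
      (contDiffAt_coord (contDiffAt_fderiv_apply hκ a) l))).mul (hb.locEssBounded_fderiv _)

namespace RegularisationData

/-- One summand of the components of `g ⋆_M ρ_ε` in the chart `φ`. -/
noncomputable def convSummand (D : RegularisationData n M) (φ : OpenPartialHomeomorph M (Euc n))
    (g : BilinField n M) (v w : Euc n) (α : ℕ) (ε : ℝ) (y : Euc n) : ℝ :=
  D.χ α (φ.symm y) * ∑ p, transCoeff (D.chart α ∘ φ.symm) v w p y *
    mollAverage D.mollifier (D.chart α).target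
      (fun x => D.ξ α ((D.chart α).symm x) * compBasis (D.chart α) g p x) ε
      ((D.chart α ∘ φ.symm) y)

variable {y₀ : Euc n}

theorem locEssBounded_ξ_mul_compBasis (hg : IsLocallyLipschitz g) {α : ℕ} {p₀ : M}
    (hα : p₀ ∈ (D.chart α).source) (p : Fin n × Fin n) :
    LocEssBounded (fun x => D.ξ α ((D.chart α).symm x) * compBasis (D.chart α) g p x)
      (D.chart α p₀) :=
  (LocEssBounded.of_continuousAt (D.continuousAt_ξ hα)).mul <| .of_continuousAt
    (hg.lipschitzNear (D.chart_mem α) ((D.chart α).map_source hα) _ _).eventually_continuousAt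

theorem tendsto_transition (hφ : φ ∈ IsManifold.maximalAtlas (𝓡 n) ∞ M) (hy₀ : y₀ ∈ φ.target)
    {α : ℕ} (hα : φ.symm y₀ ∈ (D.chart α).source) :
    Tendsto (fun q : ℝ × Euc n => (q.1, (D.chart α ∘ φ.symm) q.2)) (𝓝[>] 0 ×ˢ 𝓝 y₀)
      (𝓝[>] 0 ×ˢ 𝓝 (D.chart α (φ.symm y₀))) :=
  tendsto_prodMk_of_continuousAt
    (contDiffAt_transition hφ (D.chart_mem α) hy₀ hα).continuousAt rfl

/-- The tangent vectors are pushed to the chart α at the evaluation point, not at the integration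
variable. The coefficients of the change of chart therefore come out of the integral. -/
theorem components_convBilin_eq (hφ : φ ∈ IsManifold.maximalAtlas (𝓡 n) ∞ M)
    (hg : IsLocallyLipschitz g) (hy₀ : y₀ ∈ φ.target) {I : Finset ℕ}
    (hI : ∀ α ∈ I, φ.symm y₀ ∈ (D.chart α).source)
    (hev : ∀ᶠ p in 𝓝 (φ.symm y₀), ∀ α ∉ I, D.χ α p = 0) (v w : Euc n) :
    ∀ᶠ q : ℝ × Euc n in 𝓝[>] 0 ×ˢ 𝓝 y₀,
      components φ (D.convBilin g q.1) q.2 v w = ∑ α ∈ I, D.convSummand φ g v w α q.1 q.2 := by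
  have hint : ∀ᶠ q : ℝ × Euc n in 𝓝[>] 0 ×ˢ 𝓝 y₀, ∀ α ∈ I, ∀ p, Integrable (fun x =>
      (D.ξ α ((D.chart α).symm x) * compBasis (D.chart α) g p x) *
        D.mollifier q.1 ((D.chart α ∘ φ.symm) q.2 - x)) :=
    (Filter.eventually_all_finset I).2 fun α hα => eventually_all.2 fun p =>
      (tendsto_transition hφ hy₀ (hI α hα)).eventually
        ((locEssBounded_ξ_mul_compBasis hg (hI α hα) p).eventually_integrable D.isMollifierFamily)
  have hsrc : ∀ᶠ y in 𝓝 y₀, ∀ α ∈ I, y ∈ φ.target ∧ φ.symm y ∈ (D.chart α).source :=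
    (Filter.eventually_all_finset I).2 fun α hα => eventually_mem_target_transition hy₀ (hI α hα)
  filter_upwards [hint, hsrc.prod_inr _, ((φ.continuousAt_symm hy₀).eventually hev).prod_inr _]
    with q h1 h2 h3
  unfold components convBilin
  rw [finsum_eq_sum_of_support_subset (s := I) _ fun α hα => ?_]
  · refine Finset.sum_congr rfl fun α hα => ?_
    unfold convSummand mollAverage
    congr 1
    simp only [← integral_const_mul]
    rw [← integral_finsetSum _ fun p _ => ((h1 α hα p).const_mul _).restrict]
    refine integral_congr_ae (Eventually.of_forall fun x => ?_)
    have hc := comp₂_eq_sum (φ := D.chart α) (g := g)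
      (fderiv ℝ (D.chart α ∘ φ.symm) q.2 v) (fderiv ℝ (D.chart α ∘ φ.symm) q.2 w) x
    rw [fderiv_transition_apply hφ (D.chart_mem α) (h2 α hα).1 (h2 α hα).2,
      fderiv_transition_apply hφ (D.chart_mem α) (h2 α hα).1 (h2 α hα).2] at hc
    change _ * comp₂ (D.chart α) g _ _ x * _ = _
    rw [hc]
    simp only [Finset.mul_sum, Finset.sum_mul]
    refine Finset.sum_congr rfl fun p _ => ?_
    rw [transCoeff, fderiv_transition_apply hφ (D.chart_mem α) (h2 α hα).1 (h2 α hα).2,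
      fderiv_transition_apply hφ (D.chart_mem α) (h2 α hα).1 (h2 α hα).2]
    simp only [Function.comp_apply]
    ring
  · by_contra hI'
    refine hα ?_
    change D.χ α _ * _ = 0
    rw [h3 α hI', zero_mul]

theorem contDiffAt_χ (hφ : φ ∈ IsManifold.maximalAtlas (𝓡 n) ∞ M) (hy₀ : y₀ ∈ φ.target) (α : ℕ) :
    ContDiffAt ℝ ∞ (fun y => D.χ α (φ.symm y)) y₀ := by
  rw [← contMDiffAt_iff_contDiffAt]
  exact (D.χ_smooth α).contMDiffAt.comp _ (contMDiffAt_symm_of_mem_maximalAtlas hφ hy₀)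

theorem symm_comp_transition {α : ℕ} {y : Euc n} (h : φ.symm y ∈ (D.chart α).source) :
    (D.chart α).symm ((D.chart α ∘ φ.symm) y) = φ.symm y :=
  (D.chart α).left_inv h

/-- Each summand tends to χ ξ times the component of g, since the components are continuous and
transform like a tensor; the weights add up to one. -/
theorem tendsto_components_convBilin (hφ : φ ∈ IsManifold.maximalAtlas (𝓡 n) ∞ M)
    (hg : IsLocallyLipschitz g) (hy₀ : y₀ ∈ φ.target) (v w : Euc n) :
    Tendsto (fun q : ℝ × Euc n => components φ (D.convBilin g q.1) q.2 v w) (𝓝[>] 0 ×ˢ 𝓝 y₀)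
      (𝓝 (comp₂ φ g v w y₀)) := by
  obtain ⟨I, hI, hev⟩ := D.exists_finset (φ.symm y₀)
  have key : ∀ α ∈ I, Tendsto (fun q : ℝ × Euc n => D.convSummand φ g v w α q.1 q.2)
      (𝓝[>] 0 ×ˢ 𝓝 y₀)
      (𝓝 (D.χ α (φ.symm y₀) * ∑ p, transCoeff (D.chart α ∘ φ.symm) v w p y₀ *
        (D.ξ α (φ.symm y₀) * compBasis (D.chart α) g p ((D.chart α ∘ φ.symm) y₀)))) := by
    intro α hα
    have hκ := contDiffAt_transition hφ (D.chart_mem α) hy₀ (hI α hα)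
    refine (((contDiffAt_χ hφ hy₀ α).continuousAt.tendsto.comp tendsto_snd)).mul
      (tendsto_finsetSum _ fun p _ => ?_)
    refine (((contDiffAt_transCoeff hκ v w p).continuousAt.tendsto.comp tendsto_snd)).mul ?_
    have h0 : ∀ᶠ x in 𝓝 (D.chart α (φ.symm y₀)), ContinuousAt
        (fun x => D.ξ α ((D.chart α).symm x) * compBasis (D.chart α) g p x) x := by
      filter_upwards [D.continuousAt_ξ (hI α hα), (hg.lipschitzNear (D.chart_mem α)
        ((D.chart α).map_source (hI α hα)) _ _).eventually_continuousAt] with x h1 h2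
      exact ContinuousAt.fun_mul h1 h2
    have h1 := (D.isMollifierFamily.tendsto_mollAverage_of_continuousAt (D.chart α).open_target
      ((D.chart α).map_source (hI α hα)) h0).comp (tendsto_transition hφ hy₀ (hI α hα))
    rw [(D.chart α).left_inv (hI α hα)] at h1
    exact h1
  have hsum := tendsto_finsetSum I key
  have hlim : (∑ α ∈ I, (D.χ α (φ.symm y₀) * ∑ p, transCoeff (D.chart α ∘ φ.symm) v w p y₀ *
        (D.ξ α (φ.symm y₀) * compBasis (D.chart α) g p ((D.chart α ∘ φ.symm) y₀)))) =
      comp₂ φ g v w y₀ := by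
    have h1 := D.sum_χ_mul_ξ hev.self_of_nhds
    calc _ = ∑ α ∈ I, (D.χ α (φ.symm y₀) * D.ξ α (φ.symm y₀)) * comp₂ φ g v w y₀ := by
          refine Finset.sum_congr rfl fun α hα => ?_
          rw [comp₂_transition_sum hφ (D.chart_mem α) hy₀ (hI α hα), mul_assoc]
          congr 1
          rw [Finset.mul_sum]
          exact Finset.sum_congr rfl fun p _ => by ring
      _ = _ := by rw [← Finset.sum_mul, h1, one_mul]
  rw [hlim] at hsum
  refine hsum.congr' ?_
  filter_upwards [components_convBilin_eq hφ hg hy₀ hI hev v w] with q hq using hq.symm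

/-- An instance of `tendsto_fderiv_sum_sub` with the change of chart as coefficients. The limit of
one summand need not vanish; it is kept in the form of a component of g times the derivative of χ ξ,
so that the sum over α can be evaluated. -/
theorem convSummand_deriv (hφ : φ ∈ IsManifold.maximalAtlas (𝓡 n) ∞ M)
    (hg : IsLocallyLipschitz g) (hy₀ : y₀ ∈ φ.target) {α : ℕ}
    (hα : φ.symm y₀ ∈ (D.chart α).source) (v w a : Euc n) :
    LocEssBounded (fun x => derivComp φ g v w a ((D.chart α).symm x))
      (D.chart α (φ.symm y₀)) ∧
    (∀ᶠ q : ℝ × Euc n in 𝓝[>] 0 ×ˢ 𝓝 y₀,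
      DifferentiableAt ℝ (D.convSummand φ g v w α q.1) q.2) ∧
    Tendsto (fun q : ℝ × Euc n => fderiv ℝ (D.convSummand φ g v w α q.1) q.2 a -
        D.χ α (φ.symm q.2) * mollAverage D.mollifier (D.chart α).target (fun x =>
          D.ξ α ((D.chart α).symm x) * derivComp φ g v w a ((D.chart α).symm x)) q.1
          (D.chart α (φ.symm q.2))) (𝓝[>] 0 ×ˢ 𝓝 y₀)
      (𝓝 (comp₂ φ g v w y₀ *
        fderiv ℝ (fun y => D.χ α (φ.symm y) * D.ξ α (φ.symm y)) y₀ a)) := by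
  set κ := D.chart α ∘ φ.symm with hκdef
  have hκ : ContDiffAt ℝ ∞ κ y₀ := contDiffAt_transition hφ (D.chart_mem α) hy₀ hα
  have hx₀ := (D.chart α).map_source hα
  have hφs : (D.chart α).symm (D.chart α (φ.symm y₀)) ∈ φ.source := by
    rw [(D.chart α).left_inv hα]; exact φ.map_target hy₀
  have hl₀ : (φ ∘ (D.chart α).symm) (D.chart α (φ.symm y₀)) = y₀ := by
    rw [Function.comp_apply, (D.chart α).left_inv hα, φ.right_inv hy₀]
  have htc : ∀ p, ContDiffAt ℝ ∞ (transCoeff κ v w p) y₀ := contDiffAt_transCoeff hκ v w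
  have hcomp : ∀ {F : Type} [NormedAddCommGroup F] [NormedSpace ℝ F] {c : Euc n → F},
      ContDiffAt ℝ ∞ c y₀ → ∀ᶠ x in 𝓝 (D.chart α (φ.symm y₀)),
        ContinuousAt (fun x => c ((φ ∘ (D.chart α).symm) x)) x := fun hc =>
    eventually_continuousAt_comp_transition hφ (D.chart_mem α) hy₀ hα hc
  have hev := eventually_derivComp_eq hφ (D.chart_mem α) hg hx₀ hφs v w a
  have key := D.isMollifierFamily.tendsto_fderiv_sum_sub (κ := κ) (y₀ := y₀)
    (x₀ := D.chart α (φ.symm y₀)) (c := fun p => transCoeff κ v w p)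
    (b := fun p => compBasis (D.chart α) g p)
    (χ := fun y => D.χ α (φ.symm y)) (ξ := fun x => D.ξ α ((D.chart α).symm x))
    (A := fun p x => fderiv ℝ (transCoeff κ v w p) ((φ ∘ (D.chart α).symm) x) a)
    (C := fun p x => transCoeff κ v w p ((φ ∘ (D.chart α).symm) x))
    (V := fun x => fderiv ℝ κ ((φ ∘ (D.chart α).symm) x) a)
    (f := fun x => derivComp φ g v w a ((D.chart α).symm x))
    (D.chart α).open_target hx₀ (hκ.of_le (by simp)) rfl
    ((contDiffAt_χ hφ hy₀ α).of_le (by simp)) ((D.contDiffAt_ξ hα).of_le (by simp))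
    (fun p => (htc p).of_le (by simp))
    (fun p => hg.lipschitzNear (D.chart_mem α) hx₀ _ _) a
    (fun p => hcomp (contDiffAt_fderiv_transCoeff hκ v w a p)) (fun p => hcomp (htc p)) (hcomp (contDiffAt_fderiv_apply hκ a))
    (fun p => by rw [hl₀]) (fun p => by rw [hl₀]) (by rw [hl₀]) hev
  refine ⟨key.1, key.2.1, ?_⟩
  refine (congrArg (fun c => Tendsto _ _ (𝓝 c)) ?_).mp key.2.2
  rw [comp₂_transition_sum hφ (D.chart_mem α) hy₀ hα]
  congr 1
  have hξ : HasFDerivAt (fun y => D.ξ α (φ.symm y)) _ y₀ :=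
    (HasFDerivAt.comp (f := κ) y₀
      ((D.contDiffAt_ξ hα).differentiableAt (by simp)).hasFDerivAt
      (hκ.differentiableAt (by simp)).hasFDerivAt).congr_of_eventuallyEq <| by
      filter_upwards [eventually_mem_target_transition hy₀ hα] with y hy
      exact congrArg _ (symm_comp_transition hy.2).symm
  have hχ := ((contDiffAt_χ (D := D) hφ hy₀ α).differentiableAt (by simp)).hasFDerivAt
  rw [(hχ.fun_mul hξ).fderiv]
  simp only [FunLike.coe_add, FunLike.coe_smul, Pi.add_apply, Pi.smul_apply, smul_eq_mul,
    ContinuousLinearMap.comp_apply]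
  rw [(D.chart α).left_inv hα]
  ring

/-- Up to an error tending to zero, the derivatives of the components of `g ⋆_M ρ_ε` are the
convolutions of the derivatives of the components of `g`. -/
theorem tendsto_fderiv_components_convBilin (hφ : φ ∈ IsManifold.maximalAtlas (𝓡 n) ∞ M)
    (hg : IsLocallyLipschitz g) (hy₀ : y₀ ∈ φ.target) (v w a : Euc n) :
    (∀ᶠ q : ℝ × Euc n in 𝓝[>] 0 ×ˢ 𝓝 y₀,
      DifferentiableAt ℝ (fun y => components φ (D.convBilin g q.1) y v w) q.2) ∧
    Tendsto (fun q : ℝ × Euc n =>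
      fderiv ℝ (fun y => components φ (D.convBilin g q.1) y v w) q.2 a -
        D.conv (derivComp φ g v w a) q.1 (φ.symm q.2)) (𝓝[>] 0 ×ˢ 𝓝 y₀) (𝓝 0) := by
  obtain ⟨I, hI, hev⟩ := D.exists_finset (φ.symm y₀)
  have hconv := eventually_eventually_prod (components_convBilin_eq hφ hg hy₀ hI hev v w)
  have hdiff : ∀ᶠ q : ℝ × Euc n in 𝓝[>] 0 ×ˢ 𝓝 y₀, ∀ α ∈ I,
      DifferentiableAt ℝ (D.convSummand φ g v w α q.1) q.2 :=
    (Filter.eventually_all_finset I).2 fun α hα =>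
      (convSummand_deriv hφ hg hy₀ (hI α hα) v w a).2.1
  have hF : ∀ᶠ q : ℝ × Euc n in 𝓝[>] 0 ×ˢ 𝓝 y₀, HasFDerivAt
      (fun y => components φ (D.convBilin g q.1) y v w)
      (∑ α ∈ I, fderiv ℝ (D.convSummand φ g v w α q.1) q.2) q.2 := by
    filter_upwards [hconv, hdiff] with q h1 h2
    exact (HasFDerivAt.fun_sum fun α hα => (h2 α hα).hasFDerivAt).congr_of_eventuallyEq h1
  refine ⟨hF.mono fun q h => h.differentiableAt, ?_⟩
  have hsum := tendsto_finsetSum I fun α hα =>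
    (convSummand_deriv hφ hg hy₀ (hI α hα) v w a).2.2
  -- The errors have the common factor g(v, w), and the remaining factors add up to the derivative
  -- of the constant function Σ χ_α ξ_α = 1.
  have hlim : ∑ α ∈ I, comp₂ φ g v w y₀ *
      fderiv ℝ (fun y => D.χ α (φ.symm y) * D.ξ α (φ.symm y)) y₀ a = 0 := by
    have h1 : (fun y => ∑ α ∈ I, D.χ α (φ.symm y) * D.ξ α (φ.symm y)) =ᶠ[𝓝 y₀] fun _ => 1 := by
      filter_upwards [(φ.continuousAt_symm hy₀).eventually hev] with y hy
      exact D.sum_χ_mul_ξ hy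
    have h2 : ∀ α ∈ I, DifferentiableAt ℝ (fun y => D.χ α (φ.symm y) * D.ξ α (φ.symm y)) y₀ := by
      intro α hα
      refine ((contDiffAt_χ (D := D) hφ hy₀ α).differentiableAt (by simp)).fun_mul ?_
      have : ContDiffAt ℝ ∞ (fun y => D.ξ α (φ.symm y)) y₀ := by
        rw [← contMDiffAt_iff_contDiffAt]
        exact (D.ξ α).contMDiff.contMDiffAt.comp _ (contMDiffAt_symm_of_mem_maximalAtlas hφ hy₀)
      exact this.differentiableAt (by simp)
    have h3 := (HasFDerivAt.fun_sum fun α hα => (h2 α hα).hasFDerivAt).fderiv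
    rw [h1.fderiv_eq, fderiv_fun_const] at h3
    rw [← Finset.mul_sum, ← sum_apply, ← h3]
    simp
  rw [hlim] at hsum
  refine hsum.congr' ?_
  filter_upwards [hF, ((φ.continuousAt_symm hy₀).eventually hev).prod_inr _] with q h1 h2
  rw [h1.fderiv, sum_apply, D.conv_eq_sum h2, Finset.sum_sub_distrib]

end RegularisationData

end ConvolutionOfMetric

/-! ### Charts in which the leaves are parallel hyperplanes. -/

section AdaptedCharts

variable {m n : ℕ} {M : Type*} [TopologicalSpace M] [ChartedSpace (Euc n) M]
  {S : Type*} [TopologicalSpace S] [ChartedSpace (Euc m) S]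

/-- Charts `φ` of `M` and `ψ` of `S` in which the map `F : S × ℝ → M` is the linear isomorphism
`L`, on the open set `N`. -/
structure IsAdaptedChart (F : S × ℝ → M) (N : Set (S × ℝ)) (φ : OpenPartialHomeomorph M (Euc n))
    (ψ : OpenPartialHomeomorph S (Euc m)) (L : (Euc m × ℝ) ≃L[ℝ] Euc n) : Prop where
  isOpen : IsOpen N
  φ_mem : φ ∈ IsManifold.maximalAtlas (𝓡 n) ∞ M
  ψ_mem : ψ ∈ IsManifold.maximalAtlas (𝓡 m) ∞ S
  mem_source : ∀ w ∈ N, w.1 ∈ ψ.source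
  map_mem_source : ∀ w ∈ N, F w ∈ φ.source
  eq : ∀ w ∈ N, φ (F w) = L (ψ w.1, w.2)

/-- Compose the local inverse of `F` with a chart of `S` times the identity, and then with `L`. The
result is smooth in both directions, hence belongs to the maximal atlas of `M`. -/
theorem exists_isAdaptedChart [IsManifold (𝓡 n) ∞ M] [IsManifold (𝓡 m) ∞ S]
    (L : (Euc m × ℝ) ≃L[ℝ] Euc n) {F : S × ℝ → M} {w₀ : S × ℝ}
    (hF : IsLocalDiffeomorphAt ((𝓡 m).prod 𝓘(ℝ, ℝ)) (𝓡 n) ∞ F w₀) :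
    ∃ N φ ψ, w₀ ∈ N ∧ IsAdaptedChart F N φ ψ L := by
  obtain ⟨e, he, heF⟩ := hF
  set ψ := chartAt (Euc m) w₀.1
  have hψ : ψ ∈ IsManifold.maximalAtlas (𝓡 m) ∞ S := IsManifold.chart_mem_maximalAtlas _
  let c : OpenPartialHomeomorph (S × ℝ) (Euc n) :=
    (ψ.prod (OpenPartialHomeomorph.refl ℝ)).trans L.toHomeomorph.toOpenPartialHomeomorph
  have hc : ContMDiffOn ((𝓡 m).prod 𝓘(ℝ, ℝ)) (𝓡 n) ∞ c c.source := by
    have h1 : ContMDiffOn ((𝓡 m).prod 𝓘(ℝ, ℝ)) 𝓘(ℝ, Euc m × ℝ) ∞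
        (fun w : S × ℝ => (ψ w.1, w.2)) c.source := by
      refine ContMDiffOn.prodMk_space ?_ contMDiffOn_snd
      refine (contMDiffOn_of_mem_maximalAtlas hψ).comp contMDiffOn_fst fun w hw => ?_
      simp only [c, mfld_simps] at hw
      exact hw
    exact (L.contDiff.contMDiff (n := ∞)).comp_contMDiffOn h1
  have hc' : ContMDiffOn (𝓡 n) ((𝓡 m).prod 𝓘(ℝ, ℝ)) ∞ c.symm c.target := by
    have h1 : ContMDiffOn (𝓡 n) (𝓡 m) ∞ (fun y => ψ.symm (L.symm y).1) c.target := by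
      refine (contMDiffOn_symm_of_mem_maximalAtlas hψ).comp
        (contDiff_fst.comp L.symm.contDiff).contMDiff.contMDiffOn fun y hy => ?_
      simp only [c, mfld_simps] at hy
      exact hy
    exact h1.prodMk (contDiff_snd.comp L.symm.contDiff).contMDiff.contMDiffOn
  let φ : OpenPartialHomeomorph M (Euc n) := e.symm.toOpenPartialHomeomorph.trans c
  have hφ : φ ∈ IsManifold.maximalAtlas (𝓡 n) ∞ M := by
    refine φ.mem_maximalAtlas_of_contMDiffOn ?_ ?_
    · exact hc.comp (e.symm.contMDiffOn.mono inter_subset_left) inter_subset_right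
    · exact e.contMDiffOn.comp (hc'.mono inter_subset_left) inter_subset_right
  have hleft : ∀ w ∈ e.source, e.symm (F w) = w := fun w hw => by
    rw [heF hw]; exact e.left_inv' hw
  refine ⟨e.source ∩ c.source, φ, ψ, ⟨he, ?_⟩, ⟨e.open_source.inter c.open_source, hφ, hψ, ?_, ?_,
    ?_⟩⟩
  · simp only [c, mfld_simps, ψ]
  · intro w hw
    have := hw.2
    simp only [c, mfld_simps] at this
    exact this
  · intro w hw
    refine ⟨?_, ?_⟩
    · change F w ∈ e.target
      rw [heF hw.1]
      exact e.map_source' hw.1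
    · change e.symm (F w) ∈ c.source
      rw [hleft w hw.1]
      exact hw.2
  · intro w hw
    change c (e.symm (F w)) = _
    rw [hleft w hw.1]
    rfl

namespace IsAdaptedChart

variable {F : S × ℝ → M} {N : Set (S × ℝ)} {φ : OpenPartialHomeomorph M (Euc n)}
    {ψ : OpenPartialHomeomorph S (Euc m)} {L : (Euc m × ℝ) ≃L[ℝ] Euc n} {w : S × ℝ}

theorem mem_target (h : IsAdaptedChart F N φ ψ L) (hw : w ∈ N) : L (ψ w.1, w.2) ∈ φ.target := by
  rw [← h.eq w hw]
  exact φ.map_source (h.map_mem_source w hw)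

theorem apply_eq (h : IsAdaptedChart F N φ ψ L) (hw : w ∈ N) :
    F w = φ.symm (L (ψ w.1, w.2)) := by
  rw [← h.eq w hw, φ.left_inv (h.map_mem_source w hw)]

theorem continuousAt (h : IsAdaptedChart F N φ ψ L) (hw : w ∈ N) : ContinuousAt F w := by
  have h1 : ContinuousAt (fun w : S × ℝ => L (ψ w.1, w.2)) w :=
    L.continuous.continuousAt.comp
      (((ψ.continuousAt (h.mem_source w hw)).comp continuousAt_fst).prodMk continuousAt_snd)
  have h2 : ContinuousAt (fun w : S × ℝ => φ.symm (L (ψ w.1, w.2))) w :=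
    ContinuousAt.comp (f := fun w : S × ℝ => L (ψ w.1, w.2))
      (φ.continuousAt_symm (h.mem_target hw)) h1
  refine h2.congr ?_
  filter_upwards [h.isOpen.mem_nhds hw] with w' hw' using (h.apply_eq hw').symm

theorem leaf_eventuallyEq (h : IsAdaptedChart F N φ ψ L) (hw : w ∈ N) :
    (fun z => F (z, w.2)) =ᶠ[𝓝 w.1] fun z => φ.symm (L (ψ z, w.2)) := by
  have : ∀ᶠ z in 𝓝 w.1, (z, w.2) ∈ N :=
    (Continuous.prodMk_left w.2).continuousAt.preimage_mem_nhds (h.isOpen.mem_nhds hw)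
  filter_upwards [this] with z hz using h.apply_eq hz

theorem contMDiffAt_leaf (h : IsAdaptedChart F N φ ψ L) (hw : w ∈ N) :
    ContMDiffAt (𝓡 m) (𝓡 n) ∞ (fun z => F (z, w.2)) w.1 := by
  have h1 : ContMDiffAt (𝓡 m) 𝓘(ℝ, Euc m × ℝ) ∞ (fun z => (ψ z, w.2)) w.1 :=
    (contMDiffAt_of_mem_maximalAtlas h.ψ_mem (h.mem_source w hw)).prodMk_space contMDiffAt_const
  have h2 : ContMDiffAt (𝓡 m) (𝓡 n) ∞ (fun z => L (ψ z, w.2)) w.1 :=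
    (L.contDiff.contMDiff (n := ∞)).contMDiffAt.comp w.1 h1
  exact ((contMDiffAt_symm_of_mem_maximalAtlas h.φ_mem (h.mem_target hw)).comp w.1 h2).congr_of_eventuallyEq
    (h.leaf_eventuallyEq hw)

/-- The differential of a leaf in an adapted chart. -/
theorem mfderiv_leaf (h : IsAdaptedChart F N φ ψ L) (hw : w ∈ N) (v : TangentSpace (𝓡 m) w.1) :
    mfderiv (𝓡 n) (𝓡 n) φ (F w) (mfderiv (𝓡 m) (𝓡 n) (fun z => F (z, w.2)) w.1 v) =
      L (mfderiv (𝓡 m) (𝓡 m) ψ w.1 v, 0) := by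
  have h1 := mfderiv_comp w.1 (mdifferentiableAt_chart h.φ_mem (h.map_mem_source w hw))
    ((h.contMDiffAt_leaf hw).mdifferentiableAt (by simp))
  have h2 : (φ ∘ fun z => F (z, w.2)) =ᶠ[𝓝 w.1]
      (fun x : Euc m => L (x, w.2)) ∘ ψ := by
    have : ∀ᶠ z in 𝓝 w.1, (z, w.2) ∈ N :=
      (Continuous.prodMk_left w.2).continuousAt.preimage_mem_nhds (h.isOpen.mem_nhds hw)
    filter_upwards [this] with z hz using h.eq _ hz
  have h3 : HasFDerivAt (fun x : Euc m => L (x, w.2))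
      ((L : (Euc m × ℝ) →L[ℝ] Euc n) ∘L ContinuousLinearMap.inl ℝ (Euc m) ℝ) (ψ w.1) :=
    L.hasFDerivAt.comp (ψ w.1) (hasFDerivAt_prodMk_left (ψ w.1) w.2)
  rw [h2.mfderiv_eq, mfderiv_comp w.1 h3.hasMFDerivAt.mdifferentiableAt
    (mdifferentiableAt_chart h.ψ_mem (h.mem_source w hw)), h3.hasMFDerivAt.mfderiv] at h1
  exact (DFunLike.congr_fun h1 v).symm

end IsAdaptedChart

end AdaptedCharts

/-! ### The normal direction by linear algebra. -/

section NormalVector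

variable {m n : ℕ}

/-- The Gram matrix of the vectors `b i`. -/
noncomputable def gram (B : Euc n →ₗ[ℝ] Euc n →ₗ[ℝ] ℝ) (b : Fin m → Euc n) :
    Matrix (Fin m) (Fin m) ℝ :=
  Matrix.of fun i j => B (b i) (b j)

/-- The projection of `τ` to the orthogonal complement of the vectors `b i`. -/
noncomputable def normalVec (B : Euc n →ₗ[ℝ] Euc n →ₗ[ℝ] ℝ) (b : Fin m → Euc n) (τ : Euc n) :
    Euc n :=
  τ - ∑ l, (∑ k, B τ (b k) * (gram B b)⁻¹ k l) • b l

theorem normalVec_orthogonal {B : Euc n →ₗ[ℝ] Euc n →ₗ[ℝ] ℝ} {b : Fin m → Euc n}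
    (hdet : (gram B b).det ≠ 0) (τ : Euc n) (j : Fin m) : B (normalVec B b τ) (b j) = 0 := by
  have h1 : (gram B b)⁻¹ * gram B b = 1 := Matrix.nonsing_inv_mul _ (isUnit_iff_ne_zero.2 hdet)
  have h2 : ∀ k, ∑ l, (gram B b)⁻¹ k l * B (b l) (b j) = (1 : Matrix (Fin m) (Fin m) ℝ) k j :=
    fun k => by rw [← h1]; rfl
  simp only [normalVec, map_sub, map_sum, map_smul, LinearMap.sub_apply, LinearMap.sum_apply,
    LinearMap.smul_apply, smul_eq_mul, Finset.sum_mul]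
  rw [Finset.sum_comm]
  simp only [mul_assoc, ← Finset.mul_sum, h2]
  simp [Matrix.one_apply]

/-- The first basis vectors in an adapted chart. -/
noncomputable def leafBasis (L : (Euc m × ℝ) ≃L[ℝ] Euc n) (i : Fin m) : Euc n :=
  L (EuclideanSpace.single i 1, 0)

theorem apply_zero_eq_sum (L : (Euc m × ℝ) ≃L[ℝ] Euc n) (x : Euc m) :
    L (x, 0) = ∑ i, x i • leafBasis L i := by
  have h : x = ∑ l, x l • EuclideanSpace.single l (1 : ℝ) := by
    ext j; simp [Finset.sum_apply, Pi.single_apply]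
  have h2 : ((x, 0) : Euc m × ℝ) = ∑ i, x i • ((EuclideanSpace.single i (1 : ℝ), 0) : Euc m × ℝ) := by
    refine Prod.ext ?_ ?_
    · rw [Prod.fst_sum]; exact h
    · rw [Prod.snd_sum]; simp
  rw [h2, map_sum]
  exact Finset.sum_congr rfl fun i _ => map_smul _ _ _

/-- `W` has a nonzero last coordinate, as otherwise it would be tangential and null. Subtracting the
right multiple of `W` from `ν` leaves a tangential vector orthogonal to all tangential vectors,
which is zero because the Gram matrix is invertible. -/
theorem eq_smul_of_orthogonal {B : Euc n →ₗ[ℝ] Euc n →ₗ[ℝ] ℝ}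
    {L : (Euc m × ℝ) ≃L[ℝ] Euc n}
    (hdet : (gram B (leafBasis L)).det ≠ 0) {W ν : Euc n} (hW : ∀ j, B W (leafBasis L j) = 0)
    (hWW : B W W ≠ 0) (hν : ∀ j, B ν (leafBasis L j) = 0) : ∃ s : ℝ, ν = s • W := by
  have h0 : ∀ (u : Euc n) x, (∀ j, B u (leafBasis L j) = 0) → B u (L (x, 0)) = 0 :=
    fun u x hu => by
      rw [apply_zero_eq_sum, map_sum]
      exact Finset.sum_eq_zero fun i _ => by rw [map_smul, hu, smul_zero]
  have hs : (L.symm W).2 ≠ 0 := by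
    intro hs
    refine hWW ?_
    have : W = L ((L.symm W).1, 0) := by
      rw [← hs]; exact (L.apply_symm_apply W).symm
    conv_lhs => rw [this]
    rw [← this]
    conv_lhs => arg 2; rw [this]
    exact h0 W _ hW
  set s := (L.symm ν).2 / (L.symm W).2
  refine ⟨s, ?_⟩
  set u := ν - s • W
  have hu : u = L ((L.symm u).1, 0) := by
    have : (L.symm u).2 = 0 := by
      simp only [u, map_sub, map_smul, Prod.snd_sub, Prod.smul_snd, smul_eq_mul, s]
      field_simp
      ring
    rw [← this]; exact (L.apply_symm_apply u).symm
  have huj : ∀ j, B u (leafBasis L j) = 0 := fun j => by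
    simp [u, hν, hW]
  have hx : (L.symm u).1.ofLp = 0 := by
    refine Matrix.eq_zero_of_vecMul_eq_zero hdet ?_
    funext j
    have := huj j
    rw [hu, apply_zero_eq_sum] at this
    simpa [Matrix.vecMul, dotProduct, gram] using this
  have hx' : (L.symm u).1 = 0 := by ext i; exact congrFun hx i
  rw [hx'] at hu
  have : u = 0 := by rw [hu]; exact map_zero L
  exact sub_eq_zero.1 this

/-- Two forms occur because `B` fixes the length of the normal, whereas its time orientation is
decided by the reference form `B₀`. -/
theorem eq_unit_smul_of_orthogonal {B B₀ : Euc n →ₗ[ℝ] Euc n →ₗ[ℝ] ℝ}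
    {L : (Euc m × ℝ) ≃L[ℝ] Euc n}
    (hdet : (gram B (leafBasis L)).det ≠ 0) {W ν τ : Euc n} (hW : ∀ j, B W (leafBasis L j) = 0)
    (hWW : B W W < 0) (hWτ : B₀ W τ < 0) (hν : ∀ j, B ν (leafBasis L j) = 0) (hν1 : B ν ν = -1)
    (hντ : B₀ ν τ < 0) : ν = (√(-B W W))⁻¹ • W := by
  obtain ⟨s, rfl⟩ := eq_smul_of_orthogonal hdet hW hWW.ne hν
  simp only [map_smul, LinearMap.smul_apply, smul_eq_mul] at hν1 hντ
  have hs : 0 < s := by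
    by_contra h
    nlinarith
  congr 1
  rw [eq_comm, inv_eq_iff_eq_inv, ← Real.sqrt_sq (inv_nonneg.2 hs.le)]
  congr 1
  field_simp
  linarith

end NormalVector

/-! ### Linearity of the Christoffel symbols and independence of the frame. -/

section ChristoffelLinear

variable {n : ℕ} {M : Type*} [TopologicalSpace M] [ChartedSpace (Euc n) M]
  {φ φ' : OpenPartialHomeomorph M (Euc n)} {g : BilinField n M} {y : Euc n}

/-- Differentiability cannot be dropped: at other points `fderiv` takes its default value 0, and
additivity in the vectors may fail. -/
theorem christoffel_eq_sum (hd : CompDiffAt φ g y) (a b c : Euc n) :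
    christoffel φ g y a b c = (∑ p : Fin n × Fin n,
      ((b p.1 * c p.2) * fderiv ℝ (compBasis φ g p) y a +
        (a p.1 * c p.2) * fderiv ℝ (compBasis φ g p) y b -
        (a p.1 * b p.2) * fderiv ℝ (compBasis φ g p) y c)) / 2 := by
  have hd' := compDiffAt_iff.1 hd
  rw [Finset.sum_sub_distrib, Finset.sum_add_distrib, ← (fderiv_comp₂_eq_sum hd' _ _).2,
    ← (fderiv_comp₂_eq_sum hd' _ _).2, ← (fderiv_comp₂_eq_sum hd' _ _).2]
  rfl

theorem isLinearMap_christoffel_left (hd : CompDiffAt φ g y) (b c : Euc n) :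
    IsLinearMap ℝ fun a => christoffel φ g y a b c where
  map_add u v := by
    simp only [christoffel_eq_sum hd]
    rw [← add_div, ← Finset.sum_add_distrib]
    congr 1
    refine Finset.sum_congr rfl fun p _ => ?_
    simp only [map_add, PiLp.add_apply]
    ring
  map_smul r v := by
    simp only [christoffel_eq_sum hd]
    rw [smul_eq_mul, ← mul_div_assoc, Finset.mul_sum]
    congr 1
    refine Finset.sum_congr rfl fun p _ => ?_
    simp only [map_smul, PiLp.smul_apply, smul_eq_mul]
    ring

theorem isLinearMap_christoffel_mid (hd : CompDiffAt φ g y) (a c : Euc n) :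
    IsLinearMap ℝ fun b => christoffel φ g y a b c where
  map_add u v := by
    simp only [christoffel_eq_sum hd]
    rw [← add_div, ← Finset.sum_add_distrib]
    congr 1
    refine Finset.sum_congr rfl fun p _ => ?_
    simp only [map_add, PiLp.add_apply]
    ring
  map_smul r v := by
    simp only [christoffel_eq_sum hd]
    rw [smul_eq_mul, ← mul_div_assoc, Finset.mul_sum]
    congr 1
    refine Finset.sum_congr rfl fun p _ => ?_
    simp only [map_smul, PiLp.smul_apply, smul_eq_mul]
    ring

theorem isLinearMap_christoffel_right (hd : CompDiffAt φ g y) (a b : Euc n) :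
    IsLinearMap ℝ fun c => christoffel φ g y a b c where
  map_add u v := by
    simp only [christoffel_eq_sum hd]
    rw [← add_div, ← Finset.sum_add_distrib]
    congr 1
    refine Finset.sum_congr rfl fun p _ => ?_
    simp only [map_add, PiLp.add_apply]
    ring
  map_smul r v := by
    simp only [christoffel_eq_sum hd]
    rw [smul_eq_mul, ← mul_div_assoc, Finset.mul_sum]
    congr 1
    refine Finset.sum_congr rfl fun p _ => ?_
    simp only [map_smul, PiLp.smul_apply, smul_eq_mul]
    ring

theorem _root_.IsLinearMap.apply_sum_smul {E ι : Type*} [AddCommGroup E] [Module ℝ E] {f : E → ℝ}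
    (hf : IsLinearMap ℝ f) (s : Finset ι) (c : ι → ℝ) (v : ι → E) :
    f (∑ i ∈ s, c i • v i) = ∑ i ∈ s, c i * f (v i) := by
  have := map_sum (IsLinearMap.mk' f hf) (fun i => c i • v i) s
  simpa only [map_smul, smul_eq_mul, IsLinearMap.mk'_apply] using this

/-- The differentials of two charts are related by the derivative of the transition map. -/
theorem mfderiv_chart_eq_fderiv_transition (hφ : φ ∈ IsManifold.maximalAtlas (𝓡 n) ∞ M)
    (hφ' : φ' ∈ IsManifold.maximalAtlas (𝓡 n) ∞ M) {p : M} (hp : p ∈ φ.source)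
    (hp' : p ∈ φ'.source) (v : TangentSpace (𝓡 n) p) :
    mfderiv (𝓡 n) (𝓡 n) φ' p v =
      fderiv ℝ (φ' ∘ φ.symm) (φ p) (mfderiv (𝓡 n) (𝓡 n) φ p v) := by
  have hp2 : φ.symm (φ p) ∈ φ'.source := by rwa [φ.left_inv hp]
  have h1 := mfderiv_comp p ((contDiffAt_transition hφ hφ' (φ.map_source hp) hp2).differentiableAt
    (by simp)).mdifferentiableAt (mdifferentiableAt_chart hφ hp)
  have h2 : (φ' ∘ φ.symm) ∘ φ =ᶠ[𝓝 p] φ' := by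
    filter_upwards [φ.open_source.mem_nhds hp] with q hq
    simp [φ.left_inv hq]
  rw [h2.mfderiv_eq, mfderiv_eq_fderiv] at h1
  exact DFunLike.congr_fun h1 v

theorem apply_inverse_of_eq_equiv {E F : Type*} [TopologicalSpace E] [AddCommGroup E] [Module ℝ E]
    [TopologicalSpace F] [AddCommGroup F] [Module ℝ F] {A : E →L[ℝ] F} (e : E ≃L[ℝ] F)
    (h : A = e) (v : F) : A (A.inverse v) = v := by
  rw [h, ContinuousLinearMap.inverse_equiv]
  exact e.apply_symm_apply v

theorem mfderiv_coordField {S : Type*} [TopologicalSpace S] [ChartedSpace (Euc n) S]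
    {ψ : OpenPartialHomeomorph S (Euc n)} (hψ : ψ ∈ IsManifold.maximalAtlas (𝓡 n) ∞ S) {z : S}
    (hz : z ∈ ψ.source) (i : Fin n) :
    mfderiv (𝓡 n) (𝓡 n) ψ z (coordField ψ i z) = (EuclideanSpace.single i (1 : ℝ) : Euc n) := by
  have hsurj : ∀ v : Euc n, mfderiv (𝓡 n) (𝓡 n) ψ z
      ((mfderiv (𝓡 n) (𝓡 n) ψ.symm (ψ z) v : Euc n)) = v := fun v => by
    have h1 := mfderiv_chart_comp_symm hψ (ψ.map_source hz) v
    rw [ψ.left_inv hz] at h1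
    exact h1
  let e : TangentSpace (𝓡 n) z ≃L[ℝ] Euc n := ContinuousLinearEquiv.equivOfInverse
    (mfderiv (𝓡 n) (𝓡 n) ψ z) (mfderiv (𝓡 n) (𝓡 n) ψ.symm (ψ z))
    (mfderiv_chart_symm_comp hψ hz) hsurj
  exact apply_inverse_of_eq_equiv (A := mfderiv (𝓡 n) (𝓡 n) ψ z) e rfl _

end ChristoffelLinear

/-- The sum is the trace of G⁻¹ Kᵀ, and the change of frame drops out of it by cyclicity of the
trace. Mean curvature is thereby independent of the tangential frame. -/
theorem sum_inv_mul_congruence {m : ℕ} {P Q G K : Matrix (Fin m) (Fin m) ℝ} (h : Q * P = 1) :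
    ∑ i, ∑ j, (P.transpose * G * P)⁻¹ i j * (P.transpose * K * P) i j =
      ∑ i, ∑ j, G⁻¹ i j * K i j := by
  have htr : ∀ A B : Matrix (Fin m) (Fin m) ℝ,
      ∑ i, ∑ j, A i j * B i j = (A * B.transpose).trace := fun A B => by
    simp [Matrix.trace, Matrix.mul_apply]
  have hP : P⁻¹ = Q := Matrix.inv_eq_left_inv h
  have h' : P * Q = 1 := mul_eq_one_comm.1 h
  have hPt : P.transpose⁻¹ * P.transpose = 1 := by
    rw [← Matrix.transpose_nonsing_inv, hP, ← Matrix.transpose_mul, h', Matrix.transpose_one]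
  rw [htr, htr, Matrix.mul_inv_rev, Matrix.mul_inv_rev, hP, Matrix.transpose_mul,
    Matrix.transpose_mul, Matrix.transpose_transpose]
  calc (Q * (G⁻¹ * P.transpose⁻¹) * (P.transpose * (K.transpose * P))).trace
      = (Q * (G⁻¹ * (P.transpose⁻¹ * P.transpose) * K.transpose * P)).trace := by
        simp only [Matrix.mul_assoc]
    _ = (G⁻¹ * K.transpose).trace := by
        rw [hPt, Matrix.mul_one, Matrix.trace_mul_comm, Matrix.mul_assoc, h', Matrix.mul_one]

/-! ### The covariant derivative of the coordinate frame in an adapted chart. -/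

section LeafCurvature

variable {m n : ℕ} {M : Type*} [TopologicalSpace M] [ChartedSpace (Euc n) M]
  [IsManifold (𝓡 n) ∞ M]
  {S : Type*} [TopologicalSpace S] [ChartedSpace (Euc m) S] [IsManifold (𝓡 m) ∞ S]
  {F : S × ℝ → M} {N : Set (S × ℝ)} {φ : OpenPartialHomeomorph M (Euc n)}
  {ψ : OpenPartialHomeomorph S (Euc m)} {L : (Euc m × ℝ) ≃L[ℝ] Euc n} {w : S × ℝ}

namespace IsAdaptedChart

/-- The coordinate field of the chart `chartAt z`, expressed in the chart `ψ`. -/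
noncomputable def frameVec (ψ : OpenPartialHomeomorph S (Euc m)) (L : (Euc m × ℝ) ≃L[ℝ] Euc n)
    (z : S) (i : Fin m) (x : Euc m) : Euc n :=
  L (fderiv ℝ (ψ ∘ (chartAt (Euc m) z).symm) x (EuclideanSpace.single i 1), 0)

theorem mfderiv_leaf_coordField (h : IsAdaptedChart F N φ ψ L) (hw : w ∈ N) {z : S}
    (hz : w.1 ∈ (chartAt (Euc m) z).source) (i : Fin m) :
    mfderiv (𝓡 n) (𝓡 n) φ (F w) (mfderiv (𝓡 m) (𝓡 n) (fun z => F (z, w.2)) w.1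
      (coordField (chartAt (Euc m) z) i w.1)) =
      frameVec ψ L z i (chartAt (Euc m) z w.1) := by
  have hc := IsManifold.chart_mem_maximalAtlas (I := 𝓡 m) (n := ∞) z
  rw [h.mfderiv_leaf hw, frameVec,
    mfderiv_chart_eq_fderiv_transition hc h.ψ_mem hz (h.mem_source w hw),
    mfderiv_coordField hc hz]

theorem mfderiv_chartAt_leaf (h : IsAdaptedChart F N φ ψ L) (hw : w ∈ N) {z : S}
    (hz : w.1 ∈ (chartAt (Euc m) z).source) {p : M} (hp : F w ∈ (chartAt (Euc n) p).source)
    (i : Fin m) :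
    mfderiv (𝓡 n) (𝓡 n) (chartAt (Euc n) p) (F w) (mfderiv (𝓡 m) (𝓡 n) (fun z => F (z, w.2)) w.1
      (coordField (chartAt (Euc m) z) i w.1)) =
      fderiv ℝ (chartAt (Euc n) p ∘ φ.symm) (φ (F w))
        (frameVec ψ L z i (chartAt (Euc m) z w.1)) := by
  rw [mfderiv_chart_eq_fderiv_transition h.φ_mem (IsManifold.chart_mem_maximalAtlas p)
    (h.map_mem_source w hw) hp, h.mfderiv_leaf_coordField hw hz]

theorem contDiffAt_frameVec (h : IsAdaptedChart F N φ ψ L) (hw : w ∈ N) (i : Fin m) :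
    ContDiffAt ℝ ∞ (fun x => fderiv ℝ (ψ ∘ (chartAt (Euc m) w.1).symm) x
      (EuclideanSpace.single i 1)) (chartAt (Euc m) w.1 w.1) := by
  refine contDiffAt_fderiv_apply (contDiffAt_transition
    (IsManifold.chart_mem_maximalAtlas (I := 𝓡 m) (n := ∞) w.1) h.ψ_mem (mem_chart_target _ _) ?_) _
  rw [(chartAt (Euc m) w.1).left_inv (mem_chart_source _ _)]
  exact h.mem_source w hw

/-- The definition uses the preferred chart at `F w`. On passing to the adapted chart, the second
derivative of the transition map in the derivative of the frame is the inhomogeneous term of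
`christoffel_transition`. The rest of that derivative is tangential and is killed by the normal. -/
theorem innerCovDeriv_eq (h : IsAdaptedChart F N φ ψ L) (hw : w ∈ N) {g : BilinField n M}
    (hg : ∀ p v w, g p v w = g p w v) (hd : CompDiffAt φ g (φ (F w)))
    {ν : TangentSpace (𝓡 n) (F w)}
    (hν : ∀ x, componentsBilin φ g (φ (F w)) (mfderiv (𝓡 n) (𝓡 n) φ (F w) ν) (L (x, 0)) = 0)
    (i j : Fin m) :
    innerCovDeriv g (fun z => F (z, w.2)) (fun z' => mfderiv (𝓡 m) (𝓡 n) (fun z => F (z, w.2)) z'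
      (coordField (chartAt (Euc m) w.1) j z')) w.1 (coordField (chartAt (Euc m) w.1) i w.1) ν =
    christoffel φ g (φ (F w)) (frameVec ψ L w.1 i (chartAt (Euc m) w.1 w.1))
      (frameVec ψ L w.1 j (chartAt (Euc m) w.1 w.1)) (mfderiv (𝓡 n) (𝓡 n) φ (F w) ν) := by
  set φ' := chartAt (Euc n) (F w) with hφ'def
  set c := chartAt (Euc m) w.1
  set κ := φ' ∘ φ.symm with hκdef
  set θ := ψ ∘ c.symm
  have hφ' : φ' ∈ IsManifold.maximalAtlas (𝓡 n) ∞ M := IsManifold.chart_mem_maximalAtlas _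
  have hc : c ∈ IsManifold.maximalAtlas (𝓡 m) ∞ S := IsManifold.chart_mem_maximalAtlas _
  have hz : w.1 ∈ c.source := mem_chart_source _ _
  have hp : F w ∈ φ'.source := mem_chart_source _ _
  have hpφ := h.map_mem_source w hw
  have hy := φ.map_source hpφ
  have hy' : φ.symm (φ (F w)) ∈ φ'.source := by rwa [φ.left_inv hpφ]
  have hκ : ContDiffAt ℝ ∞ κ (φ (F w)) := contDiffAt_transition h.φ_mem hφ' hy hy'
  have hκy : κ (φ (F w)) = φ' (F w) := by
    rw [hκdef, Function.comp_apply, φ.left_inv hpφ]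
  -- the frame field in the chart `φ'`
  have hZ : (fun z' => (mfderiv (𝓡 n) (𝓡 n) φ' (F (z', w.2))
      (mfderiv (𝓡 m) (𝓡 n) (fun z => F (z, w.2)) z' (coordField c j z')) : Euc n)) =ᶠ[𝓝 w.1]
      (fun x => fderiv ℝ κ (L (θ x, w.2)) (frameVec ψ L w.1 j x)) ∘ c := by
    have hN : ∀ᶠ z in 𝓝 w.1, (z, w.2) ∈ N :=
      (Continuous.prodMk_left w.2).continuousAt.preimage_mem_nhds (h.isOpen.mem_nhds hw)
    have hFc : ∀ᶠ z in 𝓝 w.1, F (z, w.2) ∈ φ'.source :=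
      (h.contMDiffAt_leaf hw).continuousAt.preimage_mem_nhds (φ'.open_source.mem_nhds hp)
    filter_upwards [hN, hFc, c.open_source.mem_nhds hz] with z h1 h2 h3
    have h4 := h.mfderiv_chartAt_leaf (w := (z, w.2)) h1 h3 h2 j
    rw [h.eq _ h1] at h4
    simp only [Function.comp_apply, θ, c.left_inv h3]
    exact h4
  have hθ : ContDiffAt ℝ ∞ θ (c w.1) := contDiffAt_transition hc h.ψ_mem (c.map_source hz)
    (by rw [c.left_inv hz]; exact h.mem_source w hw)
  have hθz : L (θ (c w.1), w.2) = φ (F w) := by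
    rw [h.eq w hw]; simp only [θ, Function.comp_apply, c.left_inv hz]
  have hh : HasFDerivAt (fun x : Euc m => L (θ x, w.2))
      ((L : (Euc m × ℝ) →L[ℝ] Euc n) ∘L ((fderiv ℝ θ (c w.1)).prod 0)) (c w.1) :=
    L.hasFDerivAt.comp (c w.1)
      ((hθ.differentiableAt (by simp)).hasFDerivAt.prodMk (hasFDerivAt_const _ _))
  have hfv : HasFDerivAt (frameVec ψ L w.1 j)
      ((L : (Euc m × ℝ) →L[ℝ] Euc n) ∘L
        ((fderiv ℝ (fun x => fderiv ℝ θ x (EuclideanSpace.single j 1)) (c w.1)).prod 0)) (c w.1) :=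
    L.hasFDerivAt.comp (c w.1)
      (((h.contDiffAt_frameVec hw j).differentiableAt (by simp)).hasFDerivAt.prodMk
        (hasFDerivAt_const _ _))
  have hκd : DifferentiableAt ℝ (fderiv ℝ κ) (φ (F w)) :=
    (hκ.fderiv_right (m := ∞) (by simp)).differentiableAt (by simp)
  have hY : HasFDerivAt (fun x => fderiv ℝ κ (L (θ x, w.2)) (frameVec ψ L w.1 j x)) _ (c w.1) :=
    HasFDerivAt.clm_apply (HasFDerivAt.comp (g := fderiv ℝ κ) (c w.1)
      (by rw [hθz]; exact hκd.hasFDerivAt) hh) hfv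
  have hdZ : mfderiv (𝓡 m) (𝓡 n) (fun z' => (mfderiv (𝓡 n) (𝓡 n) φ' (F (z', w.2))
      (mfderiv (𝓡 m) (𝓡 n) (fun z => F (z, w.2)) z' (coordField c j z')) : Euc n)) w.1
      (coordField c i w.1) = fderiv ℝ (fun z => fderiv ℝ κ z (frameVec ψ L w.1 j (c w.1)))
        (φ (F w)) (frameVec ψ L w.1 i (c w.1)) + fderiv ℝ κ (φ (F w)) (L (fderiv ℝ
        (fun x => fderiv ℝ θ x (EuclideanSpace.single j 1)) (c w.1) (EuclideanSpace.single i 1),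
          0)) := by
    have h2 := mfderiv_coordField hc hz i
    -- The chain rule is stated for an arbitrary derivative `A`, so that the lengthy expression
    -- found by unification in `hY` need not be written out.
    have h0 : ∀ A : Euc m →L[ℝ] Euc n, HasFDerivAt
        (fun x => fderiv ℝ κ (L (θ x, w.2)) (frameVec ψ L w.1 j x)) A (c w.1) →
        mfderiv (𝓡 m) (𝓡 n) (fun z' => (mfderiv (𝓡 n) (𝓡 n) φ' (F (z', w.2))
          (mfderiv (𝓡 m) (𝓡 n) (fun z => F (z, w.2)) z' (coordField c j z')) : Euc n)) w.1
          (coordField c i w.1) = A (EuclideanSpace.single i 1) := fun A hA => by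
      rw [hZ.mfderiv_eq, mfderiv_comp w.1 hA.hasMFDerivAt.mdifferentiableAt
        (mdifferentiableAt_chart hc hz), hA.hasMFDerivAt.mfderiv]
      exact congrArg (fun v : Euc m => A v) h2
    rw [h0 _ hY]
    have h3 : fderiv ℝ (fun z => fderiv ℝ κ z (frameVec ψ L w.1 j (c w.1))) (φ (F w))
        (frameVec ψ L w.1 i (c w.1)) = fderiv ℝ (fderiv ℝ κ) (φ (F w))
          (frameVec ψ L w.1 i (c w.1)) (frameVec ψ L w.1 j (c w.1)) := by
      rw [fderiv_clm_apply hκd (differentiableAt_const _)]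
      simp
    rw [h3, hθz, add_comm]
    rfl
  have hν' : mfderiv (𝓡 n) (𝓡 n) φ' (F w) ν =
      fderiv ℝ κ (φ (F w)) (mfderiv (𝓡 n) (𝓡 n) φ (F w) ν) :=
    mfderiv_chart_eq_fderiv_transition h.φ_mem hφ' hpφ hp ν
  have hd' : CompDiffAt φ' g (κ (φ (F w))) := by
    rw [hκy]
    refine CompDiffAt.transition hφ' h.φ_mem (φ'.map_source hp) ?_ ?_
    · rwa [φ'.left_inv hp]
    · rwa [Function.comp_apply, φ'.left_inv hp]
  have hchr := christoffel_transition h.φ_mem hφ' hg hy hy' hd'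
    (frameVec ψ L w.1 i (c w.1)) (frameVec ψ L w.1 j (c w.1)) (mfderiv (𝓡 n) (𝓡 n) φ (F w) ν)
  have hcomp := comp₂_transition (g := g) h.φ_mem hφ' hy hy' (L (fderiv ℝ
        (fun x => fderiv ℝ θ x (EuclideanSpace.single j 1)) (c w.1) (EuclideanSpace.single i 1),
          0)) (mfderiv (𝓡 n) (𝓡 n) φ (F w) ν)
  -- In the adapted chart the tangent spaces of the leaves are constant, so the derivative of the
  -- frame is again tangential.
  have hzero : comp₂ φ g (L (fderiv ℝ (fun x => fderiv ℝ θ x (EuclideanSpace.single j 1)) (c w.1)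
      (EuclideanSpace.single i 1), 0)) (mfderiv (𝓡 n) (𝓡 n) φ (F w) ν) (φ (F w)) = 0 :=
    (hg _ _ _).trans (hν _)
  rw [hzero] at hcomp
  rw [hchr, ← hκdef]
  have hleaf := fun k => h.mfderiv_chartAt_leaf hw hz hp k
  change comp₂ φ' g (mfderiv (𝓡 m) (𝓡 n) (fun z' => (mfderiv (𝓡 n) (𝓡 n) φ' (F (z', w.2))
      (mfderiv (𝓡 m) (𝓡 n) (fun z => F (z, w.2)) z' (coordField c j z')) : Euc n)) w.1
      (coordField c i w.1)) (mfderiv (𝓡 n) (𝓡 n) φ' (F w) ν) (φ' (F w)) +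
    christoffel φ' g (φ' (F w)) (mfderiv (𝓡 n) (𝓡 n) φ' (F w)
      (mfderiv (𝓡 m) (𝓡 n) (fun z => F (z, w.2)) w.1 (coordField c i w.1)))
      (mfderiv (𝓡 n) (𝓡 n) φ' (F w)
        (mfderiv (𝓡 m) (𝓡 n) (fun z => F (z, w.2)) w.1 (coordField c j w.1)))
      (mfderiv (𝓡 n) (𝓡 n) φ' (F w) ν) = _
  have hadd : ∀ u v x : Euc n, comp₂ φ' g (u + v) x (φ' (F w)) =
      comp₂ φ' g u x (φ' (F w)) + comp₂ φ' g v x (φ' (F w)) := fun u v x => by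
    have := LinearMap.congr_fun (map_add (componentsBilin φ' g (φ' (F w))) u v) x
    exact this
  rw [hdZ, hleaf, hleaf, hν', ← hκdef, hadd, ← hκy, ← hcomp, add_zero, add_comm]

end IsAdaptedChart

end LeafCurvature

/-! ### The coefficients of the mean curvature and their continuity. -/

section CurvatureCoefficients

variable {m n : ℕ}

/-- The conditions under which `normalVec` is a future directed timelike normal. -/
structure NormalCondition (B B₀ : Euc n →ₗ[ℝ] Euc n →ₗ[ℝ] ℝ) (L : (Euc m × ℝ) ≃L[ℝ] Euc n)
    (τ : Euc n) : Prop where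
  det_ne_zero : (gram B (leafBasis L)).det ≠ 0
  timelike : B (normalVec B (leafBasis L) τ) (normalVec B (leafBasis L) τ) < 0
  future : B₀ (normalVec B (leafBasis L) τ) τ < 0

/-- The coefficients of the mean curvature of the leaves as a linear combination of the
Christoffel symbols. -/
noncomputable def curvCoeff (B : Euc n →ₗ[ℝ] Euc n →ₗ[ℝ] ℝ) (L : (Euc m × ℝ) ≃L[ℝ] Euc n)
    (τ : Euc n) (q : Fin m × Fin m × Fin n) : ℝ :=
  -((gram B (leafBasis L))⁻¹ q.1 q.2.1 *
    ((√(-B (normalVec B (leafBasis L) τ) (normalVec B (leafBasis L) τ)))⁻¹ *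
      normalVec B (leafBasis L) τ q.2.2))

/-- Decompose τ = W + tangential part orthogonally. The tangential part has nonnegative square, so
B(W, W) ≤ B(τ, τ) < 0; moreover B(W, τ) = B(W, W), so `W` has the time orientation of τ. -/
theorem NormalCondition.of_pos {B : Euc n →ₗ[ℝ] Euc n →ₗ[ℝ] ℝ} {L : (Euc m × ℝ) ≃L[ℝ] Euc n}
    {τ : Euc n} (hpos : ∀ x : Euc m, x ≠ 0 → 0 < B (L (x, 0)) (L (x, 0)))
    (hsymm : ∀ u v, B u v = B v u) (hτ : B τ τ < 0) : NormalCondition B B L τ := by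
  have hdet : (gram B (leafBasis L)).det ≠ 0 := by
    intro h
    obtain ⟨x, hx, hx0⟩ := Matrix.exists_vecMul_eq_zero_iff.2 h
    have hx' : (WithLp.toLp 2 x : Euc m) ≠ 0 := fun h => hx <| by
      funext i
      exact congrFun (congrArg WithLp.ofLp h) i
    refine (hpos _ hx').ne' ?_
    conv_lhs => arg 2; rw [apply_zero_eq_sum]
    rw [map_sum]
    refine Finset.sum_eq_zero fun j _ => ?_
    rw [map_smul, apply_zero_eq_sum]
    have := congrFun hx0 j
    simp only [Matrix.vecMul, dotProduct, gram, Matrix.of_apply, Pi.zero_apply] at this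
    simp [this]
  set W := normalVec B (leafBasis L) τ with hW
  have horth : ∀ j, B W (leafBasis L j) = 0 := normalVec_orthogonal hdet τ
  obtain ⟨x, hx⟩ : ∃ x : Euc m, τ = W + L (x, 0) := by
    refine ⟨WithLp.toLp 2 fun l => ∑ k, B τ (leafBasis L k) * (gram B (leafBasis L))⁻¹ k l, ?_⟩
    rw [apply_zero_eq_sum, hW, normalVec]
    simp
  have h0 : B W (L (x, 0)) = 0 := by
    rw [apply_zero_eq_sum, map_sum]
    exact Finset.sum_eq_zero fun i _ => by rw [map_smul, horth, smul_zero]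
  have hnn : 0 ≤ B (L (x, 0)) (L (x, 0)) := by
    by_cases hx0 : x = 0
    · rw [hx0, show ((0, 0) : Euc m × ℝ) = 0 from rfl, map_zero, map_zero]
    · exact (hpos x hx0).le
  have hWW : B W W < 0 := by
    have : B τ τ = B W W + B (L (x, 0)) (L (x, 0)) := by
      rw [hx]
      simp only [map_add, LinearMap.add_apply]
      linarith [hsymm (L (x, 0)) W]
    linarith
  refine ⟨hdet, hWW, ?_⟩
  change B W τ < 0
  rw [hx, map_add, h0, add_zero]
  exact hWW

section Limits

variable {ι : Type*} {l : Filter ι} {Bq : ι → Euc n →ₗ[ℝ] Euc n →ₗ[ℝ] ℝ}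
  {B : Euc n →ₗ[ℝ] Euc n →ₗ[ℝ] ℝ} {L : (Euc m × ℝ) ≃L[ℝ] Euc n} {τq : ι → Euc n} {τ : Euc n}

theorem tendsto_bilin_apply (hB : ∀ v w, Tendsto (fun q => Bq q v w) l (𝓝 (B v w)))
    {u v : ι → Euc n} {u₀ v₀ : Euc n} (hu : Tendsto u l (𝓝 u₀)) (hv : Tendsto v l (𝓝 v₀)) :
    Tendsto (fun q => Bq q (u q) (v q)) l (𝓝 (B u₀ v₀)) := by
  simp only [bilin_eq_sum (B := Bq _) (u _), bilin_eq_sum (B := B) u₀]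
  have hc : ∀ (i : Fin n) {u : ι → Euc n} {u₀ : Euc n}, Tendsto u l (𝓝 u₀) →
      Tendsto (fun q => u q i) l (𝓝 (u₀ i)) := fun i u u₀ hu =>
    ((EuclideanSpace.proj (𝕜 := ℝ) i).continuous.tendsto u₀).comp hu
  exact tendsto_finsetSum _ fun p _ => ((hc _ hu).mul (hc _ hv)).mul (hB _ _)

theorem tendsto_gram (hB : ∀ v w, Tendsto (fun q => Bq q v w) l (𝓝 (B v w)))
    (b : Fin m → Euc n) : Tendsto (fun q => gram (Bq q) b) l (𝓝 (gram B b)) :=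
  tendsto_pi_nhds.2 fun _ => tendsto_pi_nhds.2 fun _ => hB _ _

theorem tendsto_gram_inv (hB : ∀ v w, Tendsto (fun q => Bq q v w) l (𝓝 (B v w)))
    (b : Fin m → Euc n) (hdet : (gram B b).det ≠ 0) :
    Tendsto (fun q => (gram (Bq q) b)⁻¹) l (𝓝 (gram B b)⁻¹) := by
  have h1 := tendsto_gram hB b
  have hd : Tendsto (fun q => (gram (Bq q) b).det) l (𝓝 (gram B b).det) :=
    ((continuous_id.matrix_det).tendsto _).comp h1
  have ha : Tendsto (fun q => (gram (Bq q) b).adjugate) l (𝓝 (gram B b).adjugate) :=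
    ((continuous_id.matrix_adjugate).tendsto _).comp h1
  simp only [Matrix.inv_def, Ring.inverse_eq_inv']
  exact (hd.inv₀ hdet).smul ha

theorem tendsto_normalVec (hB : ∀ v w, Tendsto (fun q => Bq q v w) l (𝓝 (B v w)))
    (hτ : Tendsto τq l (𝓝 τ)) (b : Fin m → Euc n) (hdet : (gram B b).det ≠ 0) :
    Tendsto (fun q => normalVec (Bq q) b (τq q)) l (𝓝 (normalVec B b τ)) := by
  have hi : ∀ k i, Tendsto (fun q => (gram (Bq q) b)⁻¹ k i) l (𝓝 ((gram B b)⁻¹ k i)) := fun k i =>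
    tendsto_pi_nhds.1 (tendsto_pi_nhds.1 (tendsto_gram_inv hB b hdet) k) i
  exact hτ.sub (tendsto_finsetSum _ fun i _ => (tendsto_finsetSum _ fun k _ =>
    (tendsto_bilin_apply hB hτ tendsto_const_nhds).mul (hi k i)).smul_const _)

/-- The coefficients involve the values of the form but none of its derivatives, so pointwise
convergence of the components suffices. -/
theorem tendsto_curvCoeff (hB : ∀ v w, Tendsto (fun q => Bq q v w) l (𝓝 (B v w)))
    (hτ : Tendsto τq l (𝓝 τ)) {B₀ : Euc n →ₗ[ℝ] Euc n →ₗ[ℝ] ℝ} (h : NormalCondition B B₀ L τ)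
    (r : Fin m × Fin m × Fin n) :
    Tendsto (fun q => curvCoeff (Bq q) L (τq q) r) l (𝓝 (curvCoeff B L τ r)) := by
  have hW := tendsto_normalVec hB hτ (leafBasis L) h.det_ne_zero
  have hi := tendsto_pi_nhds.1 (tendsto_pi_nhds.1
    (tendsto_gram_inv hB (leafBasis L) h.det_ne_zero) r.1) r.2.1
  have hs := ((tendsto_bilin_apply hB hW hW).neg.sqrt).inv₀
    (Real.sqrt_pos.2 (neg_pos.2 h.timelike)).ne'
  have hc := ((EuclideanSpace.proj (𝕜 := ℝ) r.2.2).continuous.tendsto _).comp hW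
  exact (hi.mul (hs.mul hc)).neg

theorem eventually_normalCondition (hB : ∀ v w, Tendsto (fun q => Bq q v w) l (𝓝 (B v w)))
    (hτ : Tendsto τq l (𝓝 τ)) {B₀q : ι → Euc n →ₗ[ℝ] Euc n →ₗ[ℝ] ℝ}
    {B₀ : Euc n →ₗ[ℝ] Euc n →ₗ[ℝ] ℝ}
    (hB₀ : ∀ v w, Tendsto (fun q => B₀q q v w) l (𝓝 (B₀ v w))) (h : NormalCondition B B₀ L τ) :
    ∀ᶠ q in l, NormalCondition (Bq q) (B₀q q) L (τq q) := by
  have hW := tendsto_normalVec hB hτ (leafBasis L) h.det_ne_zero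
  have hd : Tendsto (fun q => (gram (Bq q) (leafBasis L)).det) l
      (𝓝 (gram B (leafBasis L)).det) :=
    ((continuous_id.matrix_det).tendsto _).comp (tendsto_gram hB _)
  filter_upwards [hd.eventually_ne h.det_ne_zero,
    (tendsto_bilin_apply hB hW hW).eventually (gt_mem_nhds h.timelike),
    (tendsto_bilin_apply hB₀ hW hτ).eventually (gt_mem_nhds h.future)] with q h1 h2 h3
  exact ⟨h1, h2, h3⟩

end Limits

end CurvatureCoefficients

/-! ### The mean curvature as a linear combination of Christoffel symbols. -/

section LeafCurvature

variable {m n : ℕ} {M : Type*} [TopologicalSpace M] [ChartedSpace (Euc n) M]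
  [IsManifold (𝓡 n) ∞ M]
  {S : Type*} [TopologicalSpace S] [ChartedSpace (Euc m) S] [IsManifold (𝓡 m) ∞ S]
  {F : S × ℝ → M} {N : Set (S × ℝ)} {φ : OpenPartialHomeomorph M (Euc n)}
  {ψ : OpenPartialHomeomorph S (Euc m)} {L : (Euc m × ℝ) ≃L[ℝ] Euc n} {w : S × ℝ}

/-- The Christoffel symbols of `g` in the chart `φ` with respect to the basis vectors. -/
noncomputable def chrBasis (φ : OpenPartialHomeomorph M (Euc n)) (g : BilinField n M)
    (L : (Euc m × ℝ) ≃L[ℝ] Euc n) (q : Fin m × Fin m × Fin n) (p : M) : ℝ :=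
  christoffel φ g (φ p) (leafBasis L q.1) (leafBasis L q.2.1) (EuclideanSpace.single q.2.2 1)

theorem componentsBilin_mfderiv (hφ : φ ∈ IsManifold.maximalAtlas (𝓡 n) ∞ M) (g : BilinField n M)
    {p : M} (hp : p ∈ φ.source) (v w : TangentSpace (𝓡 n) p) :
    componentsBilin φ g (φ p) (mfderiv (𝓡 n) (𝓡 n) φ p v) (mfderiv (𝓡 n) (𝓡 n) φ p w) = g p v w :=
  (apply_eq_components hφ hp (fun p a b => g p a b) v w).symm

theorem exists_mfderiv_chart_eq (hφ : φ ∈ IsManifold.maximalAtlas (𝓡 n) ∞ M)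
    {p : M} (hp : p ∈ φ.source) (v : Euc n) :
    ∃ u : TangentSpace (𝓡 n) p, mfderiv (𝓡 n) (𝓡 n) φ p u = v := by
  refine ⟨(mfderiv (𝓡 n) (𝓡 n) φ.symm (φ p) v : Euc n), ?_⟩
  have h1 := mfderiv_chart_comp_symm hφ (φ.map_source hp) v
  rw [φ.left_inv hp] at h1
  exact h1

namespace IsAdaptedChart

theorem componentsBilin_leaf_pos (h : IsAdaptedChart F N φ ψ L) (hw : w ∈ N) {g : BilinField n M}
    (hpos : ∀ v : TangentSpace (𝓡 m) w.1, v ≠ 0 → 0 < g (F w)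
      (mfderiv (𝓡 m) (𝓡 n) (fun z => F (z, w.2)) w.1 v)
      (mfderiv (𝓡 m) (𝓡 n) (fun z => F (z, w.2)) w.1 v)) (x : Euc m) (hx : x ≠ 0) :
    0 < componentsBilin φ g (φ (F w)) (L (x, 0)) (L (x, 0)) := by
  obtain ⟨v, hv⟩ := exists_mfderiv_chart_eq h.ψ_mem (h.mem_source w hw) x
  have h1 := h.mfderiv_leaf hw v
  rw [hv] at h1
  rw [← h1]
  refine lt_of_lt_of_eq (hpos v ?_)
    (componentsBilin_mfderiv h.φ_mem g (h.map_mem_source w hw) _ _).symm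
  rintro rfl
  rw [map_zero] at hv
  exact hx hv.symm

/-- `unitNormal` is defined by choice with default value 0. The rescaled `normalVec` shows that the
defining conditions can be met, and uniqueness identifies whatever vector was chosen with it. -/
theorem mfderiv_unitNormal (h : IsAdaptedChart F N φ ψ L) (hw : w ∈ N) {g g₀ : BilinField n M}
    {T : VectorField n M}
    (hc : NormalCondition (componentsBilin φ g (φ (F w))) (componentsBilin φ g₀ (φ (F w))) L
      (mfderiv (𝓡 n) (𝓡 n) φ (F w) (T (F w)))) :
    mfderiv (𝓡 n) (𝓡 n) φ (F w) (unitNormal (m := m) g g₀ T (fun z => F (z, w.2)) w.1) =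
      (√(-componentsBilin φ g (φ (F w))
        (normalVec (componentsBilin φ g (φ (F w))) (leafBasis L)
          (mfderiv (𝓡 n) (𝓡 n) φ (F w) (T (F w))))
        (normalVec (componentsBilin φ g (φ (F w))) (leafBasis L)
          (mfderiv (𝓡 n) (𝓡 n) φ (F w) (T (F w))))))⁻¹ •
      normalVec (componentsBilin φ g (φ (F w))) (leafBasis L)
        (mfderiv (𝓡 n) (𝓡 n) φ (F w) (T (F w))) := by
  set B := componentsBilin φ g (φ (F w)) with hB
  set B₀ := componentsBilin φ g₀ (φ (F w)) with hB₀
  set τ : Euc n := mfderiv (𝓡 n) (𝓡 n) φ (F w) (T (F w)) with hτ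
  set W := normalVec B (leafBasis L) τ with hWdef
  have hp := h.map_mem_source w hw
  have hW : ∀ j, B W (leafBasis L j) = 0 := normalVec_orthogonal hc.det_ne_zero τ
  have hWW : B W W < 0 := hc.timelike
  have hWτ : B₀ W τ < 0 := hc.future
  have hs : 0 < (√(-B W W))⁻¹ := inv_pos.2 (Real.sqrt_pos.2 (neg_pos.2 hWW))
  have hWL : ∀ x : Euc m, B ((√(-B W W))⁻¹ • W) (L (x, 0)) = 0 := fun x => by
    rw [apply_zero_eq_sum, map_sum]
    refine Finset.sum_eq_zero fun i _ => ?_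
    simp only [map_smul, LinearMap.smul_apply, hW, smul_zero]
  have hex : ∃ ν, IsFutureUnitNormal (m := m) g g₀ T (fun z => F (z, w.2)) w.1 ν := by
    obtain ⟨ν, hν⟩ := exists_mfderiv_chart_eq h.φ_mem hp ((√(-B W W))⁻¹ • W)
    refine ⟨ν, ?_, fun v => ?_, ?_⟩
    · refine (componentsBilin_mfderiv h.φ_mem g hp ν ν).symm.trans ?_
      rw [hν, ← hB]
      simp only [map_smul, LinearMap.smul_apply, smul_eq_mul]
      rw [← mul_assoc, ← mul_inv, Real.mul_self_sqrt (neg_pos.2 hWW).le, inv_neg, neg_mul,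
        inv_mul_cancel₀ hWW.ne]
    · refine (componentsBilin_mfderiv h.φ_mem g hp ν _).symm.trans ?_
      rw [h.mfderiv_leaf hw, hν, ← hB]
      exact hWL _
    · refine lt_of_eq_of_lt (componentsBilin_mfderiv h.φ_mem g₀ hp ν _).symm ?_
      rw [hν, ← hB₀, ← hτ]
      simp only [map_smul, LinearMap.smul_apply, smul_eq_mul]
      exact mul_neg_of_pos_of_neg hs hWτ
  have hν : IsFutureUnitNormal (m := m) g g₀ T (fun z => F (z, w.2)) w.1
      (unitNormal (m := m) g g₀ T (fun z => F (z, w.2)) w.1) := by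
    rw [unitNormal, dif_pos hex]
    exact hex.choose_spec
  refine eq_unit_smul_of_orthogonal (B₀ := B₀) hc.det_ne_zero hW hWW hWτ (fun j => ?_) ?_ ?_
  · have h1 := hν.2.1 (coordField ψ j w.1)
    have h2 := componentsBilin_mfderiv h.φ_mem g hp
      (unitNormal (m := m) g g₀ T (fun z => F (z, w.2)) w.1)
      (mfderiv (𝓡 m) (𝓡 n) (fun z => F (z, w.2)) w.1 (coordField ψ j w.1))
    rw [h.mfderiv_leaf hw, mfderiv_coordField h.ψ_mem (h.mem_source w hw)] at h2
    exact h2.trans h1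
  · exact (componentsBilin_mfderiv h.φ_mem g hp _ _).trans hν.1
  · exact lt_of_eq_of_lt (componentsBilin_mfderiv h.φ_mem g₀ hp _ _) hν.2.2

/-- The mean curvature of the leaves, in terms of Christoffel symbols in an adapted chart. -/
theorem meanCurvature_eq (h : IsAdaptedChart F N φ ψ L) (hw : w ∈ N) {g g₀ : BilinField n M}
    {T : VectorField n M} (hg : ∀ p v w, g p v w = g p w v) (hd : CompDiffAt φ g (φ (F w)))
    (hc : NormalCondition (componentsBilin φ g (φ (F w))) (componentsBilin φ g₀ (φ (F w))) L
      (mfderiv (𝓡 n) (𝓡 n) φ (F w) (T (F w)))) :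
    meanCurvature m g g₀ T (fun z => F (z, w.2)) w.1 =
      ∑ q, curvCoeff (componentsBilin φ g (φ (F w))) L
        (mfderiv (𝓡 n) (𝓡 n) φ (F w) (T (F w))) q * chrBasis φ g L q (F w) := by
  have hp := h.map_mem_source w hw
  set c := chartAt (Euc m) w.1 with hcdef
  have hcA : c ∈ IsManifold.maximalAtlas (𝓡 m) ∞ S := IsManifold.chart_mem_maximalAtlas _
  have hz : w.1 ∈ c.source := mem_chart_source _ _
  have hun := h.mfderiv_unitNormal hw hc
  set B := componentsBilin φ g (φ (F w)) with hB
  set τ : Euc n := mfderiv (𝓡 n) (𝓡 n) φ (F w) (T (F w)) with hτ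
  set W := normalVec B (leafBasis L) τ with hWdef
  set ν := unitNormal (m := m) g g₀ T (fun z => F (z, w.2)) w.1 with hν
  have hW : ∀ j, B W (leafBasis L j) = 0 := normalVec_orthogonal hc.det_ne_zero τ
  have horth : ∀ x, B (mfderiv (𝓡 n) (𝓡 n) φ (F w) ν) (L (x, 0)) = 0 := fun x => by
    rw [hun, apply_zero_eq_sum, map_sum]
    refine Finset.sum_eq_zero fun i _ => ?_
    simp only [map_smul, LinearMap.smul_apply, hW, smul_zero]
  -- The mean curvature is defined with the coordinate frame of the preferred chart of `S`. The
  -- Jacobian matrix P expresses that frame in the constant basis of the adapted chart, so Gram and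
  -- curvature matrices both change by congruence with P.
  let P : Matrix (Fin m) (Fin m) ℝ := Matrix.of fun a i =>
    (fderiv ℝ (ψ ∘ c.symm) (c w.1) (EuclideanSpace.single i 1)) a
  let Q : Matrix (Fin m) (Fin m) ℝ := Matrix.of fun a i =>
    (fderiv ℝ (c ∘ ψ.symm) (ψ w.1) (EuclideanSpace.single i 1)) a
  let K : Matrix (Fin m) (Fin m) ℝ := Matrix.of fun i j =>
    christoffel φ g (φ (F w)) (leafBasis L i) (leafBasis L j) (mfderiv (𝓡 n) (𝓡 n) φ (F w) ν)
  have hfv : ∀ i, frameVec ψ L w.1 i (c w.1) = ∑ a, P a i • leafBasis L a := fun i =>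
    apply_zero_eq_sum L _
  have hQP : Q * P = 1 := by
    ext i j
    have h1 := mfderiv_chart_eq_fderiv_transition h.ψ_mem hcA (h.mem_source w hw) hz
      (coordField c j w.1)
    rw [mfderiv_chart_eq_fderiv_transition hcA h.ψ_mem hz (h.mem_source w hw),
      mfderiv_coordField hcA hz] at h1
    have h2 : ∀ x : Euc m, x = ∑ l, x l • EuclideanSpace.single l (1 : ℝ) := fun x => by
      ext j; simp [Finset.sum_apply, Pi.single_apply]
    have h3 := congrArg (fun x : Euc m => x i) (h1.trans (congrArg _ (h2 _)))
    rw [map_sum] at h3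
    simp only [map_smul] at h3
    rw [Matrix.mul_apply, Matrix.one_apply]
    simp only [P, Q, Matrix.of_apply]
    have h4 : ∀ (f : Fin m → Euc m), (∑ l, f l) i = ∑ l, f l i := fun f => by
      simp
    rw [h4] at h3
    simp only [PiLp.smul_apply, smul_eq_mul, PiLp.single_apply] at h3
    rw [h3]
    exact Finset.sum_congr rfl fun l _ => mul_comm _ _
  have hG : (Matrix.of fun i j => g (F w)
      (mfderiv (𝓡 m) (𝓡 n) (fun z => F (z, w.2)) w.1 (coordField c i w.1))
      (mfderiv (𝓡 m) (𝓡 n) (fun z => F (z, w.2)) w.1 (coordField c j w.1)) :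
      Matrix (Fin m) (Fin m) ℝ) = P.transpose * gram B (leafBasis L) * P := by
    ext i j
    have h1 := componentsBilin_mfderiv h.φ_mem g hp
      (mfderiv (𝓡 m) (𝓡 n) (fun z => F (z, w.2)) w.1 (coordField c i w.1))
      (mfderiv (𝓡 m) (𝓡 n) (fun z => F (z, w.2)) w.1 (coordField c j w.1))
    rw [h.mfderiv_leaf_coordField hw hz, h.mfderiv_leaf_coordField hw hz, ← hB, hfv, hfv] at h1
    refine h1.symm.trans ?_
    simp only [map_sum, map_smul, LinearMap.sum_apply, LinearMap.smul_apply, smul_eq_mul,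
      Matrix.mul_apply, Matrix.transpose_apply, gram, Matrix.of_apply, Finset.sum_mul,
      Finset.mul_sum]
    refine Finset.sum_congr rfl fun a _ => Finset.sum_congr rfl fun b _ => ?_
    ring
  have hbil : ∀ (u : Euc n) i j, christoffel φ g (φ (F w)) (∑ a, P a i • leafBasis L a)
      (∑ a, P a j • leafBasis L a) u = ∑ a, P a i * ∑ b, P b j *
        christoffel φ g (φ (F w)) (leafBasis L a) (leafBasis L b) u := fun u i j => by
    rw [(isLinearMap_christoffel_left hd _ _).apply_sum_smul]
    simp only [(isLinearMap_christoffel_mid hd _ _).apply_sum_smul]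
  have hK : ∀ i j, innerCovDeriv g (fun z => F (z, w.2)) (fun z' => mfderiv (𝓡 m) (𝓡 n)
      (fun z => F (z, w.2)) z' (coordField c j z')) w.1 (coordField c i w.1) ν =
      (P.transpose * K * P) i j := by
    intro i j
    rw [h.innerCovDeriv_eq hw hg hd horth, hfv, hfv]
    refine (hbil _ i j).trans ?_
    simp only [Matrix.mul_apply, Matrix.transpose_apply, K, Matrix.of_apply, Finset.sum_mul,
      Finset.mul_sum]
    rw [Finset.sum_comm]
    refine Finset.sum_congr rfl fun a _ => Finset.sum_congr rfl fun b _ => ?_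
    ring
  change (-1) * ∑ i, ∑ j, (Matrix.of fun i j => g (F w)
      (mfderiv (𝓡 m) (𝓡 n) (fun z => F (z, w.2)) w.1 (coordField c i w.1))
      (mfderiv (𝓡 m) (𝓡 n) (fun z => F (z, w.2)) w.1 (coordField c j w.1)) :
      Matrix (Fin m) (Fin m) ℝ)⁻¹ i j * innerCovDeriv g (fun z => F (z, w.2)) (fun z' =>
      mfderiv (𝓡 m) (𝓡 n) (fun z => F (z, w.2)) z' (coordField c j z')) w.1
      (coordField c i w.1) ν = _
  simp only [hG, hK]
  rw [sum_inv_mul_congruence hQP, Fintype.sum_prod_type]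
  simp only [Fintype.sum_prod_type, Finset.mul_sum]
  refine Finset.sum_congr rfl fun i _ => Finset.sum_congr rfl fun j _ => ?_
  have hWs : (√(-B W W))⁻¹ • W =
      ∑ k, ((√(-B W W))⁻¹ * W k) • EuclideanSpace.single k (1 : ℝ) := by
    ext j; simp [Finset.sum_apply, Pi.single_apply]
  simp only [K, Matrix.of_apply]
  rw [hun, hWs, (isLinearMap_christoffel_right hd _ _).apply_sum_smul, Finset.mul_sum,
    Finset.mul_sum]
  refine Finset.sum_congr rfl fun k _ => ?_
  simp only [curvCoeff, chrBasis, ← hWdef]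
  ring

end IsAdaptedChart

end LeafCurvature

/-! ### Smooth vector fields in charts, and openness of the adapted map. -/

section ChartVectorField

variable {n : ℕ} {M : Type*} [TopologicalSpace M] [ChartedSpace (Euc n) M]
  {φ : OpenPartialHomeomorph M (Euc n)}

/-- The vector field `X` in the chart `φ`. -/
noncomputable def chartField (φ : OpenPartialHomeomorph M (Euc n)) (X : VectorField n M)
    (y : Euc n) : Euc n :=
  mfderiv (𝓡 n) (𝓡 n) φ (φ.symm y) (X (φ.symm y))

theorem inverse_eq_of_eq_equiv {E F : Type*} [TopologicalSpace E] [AddCommGroup E] [Module ℝ E]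
    [TopologicalSpace F] [AddCommGroup F] [Module ℝ F] {A : E →L[ℝ] F} (e : E ≃L[ℝ] F)
    (h : A = e) {v : F} {u : E} (hu : A u = v) : A.inverse v = u := by
  rw [h, ContinuousLinearMap.inverse_equiv, ← hu, h]
  exact e.symm_apply_apply u

theorem mfderiv_chart_symm_of_mfderiv_chart (hφ : φ ∈ IsManifold.maximalAtlas (𝓡 n) ∞ M)
    {y : Euc n} (hy : y ∈ φ.target) (v : TangentSpace (𝓡 n) (φ.symm y)) :
    mfderiv (𝓡 n) (𝓡 n) φ.symm y (mfderiv (𝓡 n) (𝓡 n) φ (φ.symm y) v : Euc n) = v := by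
  have h1 := mfderiv_chart_symm_comp hφ (φ.map_target hy) v
  rw [φ.right_inv hy] at h1
  exact h1

theorem contDiffAt_chartField [IsManifold (𝓡 n) ∞ M]
    (hφ : φ ∈ IsManifold.maximalAtlas (𝓡 n) ∞ M) {X : VectorField n M}
    (hX : IsSmoothVectorField X) {y : Euc n} (hy : y ∈ φ.target) :
    ContDiffAt ℝ ∞ (chartField φ X) y := by
  have : IsManifold (𝓡 n) 1 M := IsManifold.of_le (n := ∞) (by simp)
  let e : ∀ z ∈ φ.target, Euc n ≃L[ℝ] TangentSpace (𝓡 n) (φ.symm z) := fun z hz =>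
    ContinuousLinearEquiv.equivOfInverse (mfderiv (𝓡 n) (𝓡 n) φ.symm z)
      (mfderiv (𝓡 n) (𝓡 n) φ (φ.symm z)) (mfderiv_chart_comp_symm hφ hz)
      (mfderiv_chart_symm_of_mfderiv_chart hφ hz)
  have h1 := ContMDiffAt.mpullback_vectorField_preimage (m := ∞) (n := ∞) (hX (φ.symm y))
    (contMDiffAt_symm_of_mem_maximalAtlas hφ hy) ⟨e y hy, rfl⟩ (by simp)
  have h2 := contMDiffAt_vectorSpace_iff_contDiffAt.1 h1
  refine h2.congr_of_eventuallyEq ?_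
  filter_upwards [φ.open_target.mem_nhds hy] with z hz
  exact (inverse_eq_of_eq_equiv (A := mfderiv (𝓡 n) (𝓡 n) φ.symm z) (e z hz) rfl
    (mfderiv_chart_symm_of_mfderiv_chart hφ hz (X (φ.symm z)))).symm

theorem chartField_apply {X : VectorField n M} {p : M} (hp : p ∈ φ.source) :
    chartField φ X (φ p) = mfderiv (𝓡 n) (𝓡 n) φ p (X p) := by
  unfold chartField
  rw [φ.left_inv hp]

theorem continuousAt_mfderiv_vectorField [IsManifold (𝓡 n) ∞ M]
    (hφ : φ ∈ IsManifold.maximalAtlas (𝓡 n) ∞ M) {X : VectorField n M}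
    (hX : IsSmoothVectorField X) {p : M} (hp : p ∈ φ.source) :
    ContinuousAt (fun p => (mfderiv (𝓡 n) (𝓡 n) φ p (X p) : Euc n)) p := by
  have h1 : ContinuousAt (fun p => chartField φ X (φ p)) p :=
    ((contDiffAt_chartField hφ hX (φ.map_source hp)).continuousAt).comp (φ.continuousAt hp)
  refine h1.congr ?_
  filter_upwards [φ.open_source.mem_nhds hp] with q hq using chartField_apply hq

end ChartVectorField

namespace IsAdaptedChart

variable {m n : ℕ} {M : Type*} [TopologicalSpace M] [ChartedSpace (Euc n) M]
  {S : Type*} [TopologicalSpace S] [ChartedSpace (Euc m) S]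
  {F : S × ℝ → M} {N : Set (S × ℝ)} {φ : OpenPartialHomeomorph M (Euc n)}
  {ψ : OpenPartialHomeomorph S (Euc m)} {L : (Euc m × ℝ) ≃L[ℝ] Euc n} {w : S × ℝ}

/-- The map `F` of an adapted chart is open. -/
theorem nhds_le_map (h : IsAdaptedChart F N φ ψ L) (hw : w ∈ N) : 𝓝 (F w) ≤ map F (𝓝 w) := by
  have hp := h.map_mem_source w hw
  have hs := h.mem_source w hw
  -- A local right inverse of `F`, continuous at `F w`, written down from the two charts; openness
  -- follows by pulling back along it.
  let G : M → S × ℝ := fun p => (ψ.symm (L.symm (φ p)).1, (L.symm (φ p)).2)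
  have hG₀ : L.symm (φ (F w)) = (ψ w.1, w.2) := by rw [h.eq w hw, L.symm_apply_apply]
  have hGw : G (F w) = w := by
    simp only [G, hG₀, ψ.left_inv hs]
  have hcL : ContinuousAt (fun p => L.symm (φ p)) (F w) :=
    L.symm.continuous.continuousAt.comp (φ.continuousAt hp)
  have hc : ContinuousAt G (F w) := by
    refine ContinuousAt.prodMk (ContinuousAt.comp (g := ψ.symm) ?_
      (continuousAt_fst.comp hcL)) (continuousAt_snd.comp hcL)
    simp only [hG₀]
    exact ψ.continuousAt_symm (ψ.map_source hs)
  have hev : ∀ᶠ p in 𝓝 (F w), F (G p) = p := by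
    have h1 : ∀ᶠ p in 𝓝 (F w), G p ∈ N :=
      hc.preimage_mem_nhds (by rw [hGw]; exact h.isOpen.mem_nhds hw)
    have h2 : ∀ᶠ p in 𝓝 (F w), (L.symm (φ p)).1 ∈ ψ.target := by
      refine (continuousAt_fst.comp hcL).preimage_mem_nhds ?_
      simp only [Function.comp_apply, hG₀]
      exact ψ.open_target.mem_nhds (ψ.map_source hs)
    filter_upwards [h1, h2, φ.open_source.mem_nhds hp] with p h3 h4 h5
    rw [h.apply_eq h3]
    simp only [G, ψ.right_inv h4, Prod.mk.eta, L.apply_symm_apply, φ.left_inv h5]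
  intro s hs
  rw [mem_map] at hs
  have h1 := hc.preimage_mem_nhds (by rw [hGw]; exact hs)
  filter_upwards [h1, hev] with p h2 h3
  rw [← h3]
  exact h2

theorem eventually_of_leaf (h : IsAdaptedChart F N φ ψ L) (hw : w ∈ N) {P : M → Prop}
    (hP : ∀ᶠ w' in 𝓝 w, P (F w')) : ∀ᶠ p in 𝓝 (F w), P p :=
  h.nhds_le_map hw hP

end IsAdaptedChart

/-! ### Normal condition and coefficients as functions on the manifold. -/

section LeafCurvatureLimits

variable {m n : ℕ} {M : Type*} [TopologicalSpace M] [ChartedSpace (Euc n) M]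
  [IsManifold (𝓡 n) ∞ M]
  {S : Type*} [TopologicalSpace S] [ChartedSpace (Euc m) S] [IsManifold (𝓡 m) ∞ S]
  {F : S × ℝ → M} {N : Set (S × ℝ)} {φ : OpenPartialHomeomorph M (Euc n)}
  {ψ : OpenPartialHomeomorph S (Euc m)} {L : (Euc m × ℝ) ≃L[ℝ] Euc n} {w₀ : S × ℝ}
  {g : BilinField n M} {T : VectorField n M}

/-- The normal condition at the point `p`, in the chart `φ`. -/
def NormalConditionAt (φ : OpenPartialHomeomorph M (Euc n)) (g g₀ : BilinField n M)
    (T : VectorField n M) (L : (Euc m × ℝ) ≃L[ℝ] Euc n) (p : M) : Prop :=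
  NormalCondition (componentsBilin φ g (φ p)) (componentsBilin φ g₀ (φ p)) L
    (mfderiv (𝓡 n) (𝓡 n) φ p (T p))

/-- The coefficients of the mean curvature of the leaves at the point `p`. -/
noncomputable def curvCoeffAt (φ : OpenPartialHomeomorph M (Euc n)) (g : BilinField n M)
    (T : VectorField n M) (L : (Euc m × ℝ) ≃L[ℝ] Euc n) (q : Fin m × Fin m × Fin n) (p : M) : ℝ :=
  curvCoeff (componentsBilin φ g (φ p)) L (mfderiv (𝓡 n) (𝓡 n) φ p (T p)) q

theorem IsLocallyLipschitz.continuousAt_componentsBilin (hg : IsLocallyLipschitz g)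
    (hφ : φ ∈ IsManifold.maximalAtlas (𝓡 n) ∞ M) {p : M} (hp : p ∈ φ.source) (v w : Euc n) :
    ContinuousAt (fun p => componentsBilin φ g (φ p) v w) p :=
  ContinuousAt.comp (g := comp₂ φ g v w)
    (hg.lipschitzNear hφ (φ.map_source hp) v w).eventually_continuousAt.self_of_nhds
    (φ.continuousAt hp)

theorem eventually_normalConditionAt (hg : IsLocallyLipschitz g)
    (hφ : φ ∈ IsManifold.maximalAtlas (𝓡 n) ∞ M) (hT : IsSmoothVectorField T) {p : M}
    (hp : p ∈ φ.source) (h : NormalConditionAt φ g g T L p) :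
    ∀ᶠ q in 𝓝 p, NormalConditionAt φ g g T L q :=
  eventually_normalCondition (hg.continuousAt_componentsBilin hφ hp)
    (continuousAt_mfderiv_vectorField hφ hT hp) (hg.continuousAt_componentsBilin hφ hp) h

theorem continuousAt_curvCoeffAt (hg : IsLocallyLipschitz g)
    (hφ : φ ∈ IsManifold.maximalAtlas (𝓡 n) ∞ M) (hT : IsSmoothVectorField T) {p : M}
    (hp : p ∈ φ.source) (h : NormalConditionAt φ g g T L p) (r : Fin m × Fin m × Fin n) :
    ContinuousAt (curvCoeffAt φ g T L r) p :=
  tendsto_curvCoeff (hg.continuousAt_componentsBilin hφ hp)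
    (continuousAt_mfderiv_vectorField hφ hT hp) h r

theorem IsAdaptedChart.normalConditionAt (h : IsAdaptedChart F N φ ψ L) (hw : w₀ ∈ N)
    (hg : ∀ p v w, g p v w = g p w v) (hT : IsTimelike g T)
    (hpos : ∀ v : TangentSpace (𝓡 m) w₀.1, v ≠ 0 → 0 < g (F w₀)
      (mfderiv (𝓡 m) (𝓡 n) (fun z => F (z, w₀.2)) w₀.1 v)
      (mfderiv (𝓡 m) (𝓡 n) (fun z => F (z, w₀.2)) w₀.1 v)) :
    NormalConditionAt φ g g T L (F w₀) :=
  NormalCondition.of_pos (h.componentsBilin_leaf_pos hw hpos) (fun _ _ => hg _ _ _) <| by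
    rw [componentsBilin_mfderiv h.φ_mem g (h.map_mem_source w₀ hw)]
    exact hT _

/-- A fixed linear combination of three derivatives of components is the form to which linearity of
the convolution applies directly. -/
theorem chrBasis_eq (g : BilinField n M) (r : Fin m × Fin m × Fin n) (p : M) :
    chrBasis φ g L r p = ∑ i : Fin 3, (![1/2, 1/2, -1/2] : Fin 3 → ℝ) i *
      (![derivComp φ g (leafBasis L r.2.1) (EuclideanSpace.single r.2.2 1)
          (leafBasis L r.1),
        derivComp φ g (leafBasis L r.1) (EuclideanSpace.single r.2.2 1)
          (leafBasis L r.2.1),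
        derivComp φ g (leafBasis L r.1) (leafBasis L r.2.1)
          (EuclideanSpace.single r.2.2 1)] : Fin 3 → M → ℝ) i p := by
  simp only [Fin.sum_univ_three, Matrix.cons_val_zero, Matrix.cons_val_one, Matrix.cons_val]
  change (derivComp _ _ _ _ _ _ + derivComp _ _ _ _ _ _ -
    derivComp _ _ _ _ _ _) / 2 = _
  ring

end LeafCurvatureLimits

/-! ### Comparing the approximating metrics with the convolved metric. -/

section NarrowApproximation

variable {n : ℕ} {M : Type*} [TopologicalSpace M] [ChartedSpace (Euc n) M]
  {φ : OpenPartialHomeomorph M (Euc n)} {D : RegularisationData n M} {g : BilinField n M}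
  {gc : ℝ → BilinField n M} {y₀ : Euc n}

theorem eventually_Ioc_zero_one : ∀ᶠ ε : ℝ in 𝓝[>] 0, ε ∈ Ioc (0 : ℝ) 1 := by
  filter_upwards [self_mem_nhdsWithin, mem_nhdsWithin_of_mem_nhds (Iic_mem_nhds one_pos)]
    with ε h1 h2 using ⟨h1, h2⟩

theorem IsSmoothBilin.contDiffAt_comp₂ (hg : IsSmoothBilin g)
    (hφ : φ ∈ IsManifold.maximalAtlas (𝓡 n) ∞ M) {y : Euc n} (hy : y ∈ φ.target) (v w : Euc n) :
    ContDiffAt ℝ ∞ (comp₂ φ g v w) y :=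
  (hg φ hφ v w).contDiffAt (φ.open_target.mem_nhds hy)

theorem IsSmoothBilin.compDiffAt (hg : IsSmoothBilin g)
    (hφ : φ ∈ IsManifold.maximalAtlas (𝓡 n) ∞ M) {y : Euc n} (hy : y ∈ φ.target) :
    CompDiffAt φ g y := fun v w => (hg.contDiffAt_comp₂ hφ hy v w).differentiableAt (by simp)

namespace IsNarrowApproximation

/-- Uniform convergence on one compact neighbourhood of `y₀` is converted into a joint limit in
scale and point. Only the orders 0 and 1 are used afterwards. -/
theorem tendsto_iteratedFDeriv (hgc : IsNarrowApproximation D g gc)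
    (hφ : φ ∈ IsManifold.maximalAtlas (𝓡 n) ∞ M) (hy₀ : y₀ ∈ φ.target) (v w : Euc n) (j : ℕ) :
    Tendsto (fun q : ℝ × Euc n => iteratedFDeriv ℝ j (fun y => comp₂ φ (gc q.1) v w y -
      components φ (D.convBilin g q.1) y v w) q.2) (𝓝[>] 0 ×ˢ 𝓝 y₀) (𝓝 0) := by
  obtain ⟨K, hK, hKt, hKc⟩ := local_compact_nhds (φ.open_target.mem_nhds hy₀)
  have h := Metric.tendstoUniformlyOn_iff.1 (hgc.tendsto φ hφ v w j K hKt hKc)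
  rw [Metric.tendsto_nhds]
  intro η hη
  have h1 : ∀ᶠ y in 𝓝 y₀, y ∈ K := hK
  filter_upwards [(h η hη).prod_mk h1] with q hq
  rw [dist_comm]
  exact hq.1 q.2 hq.2

theorem tendsto_comp₂ (hgc : IsNarrowApproximation D g gc)
    (hφ : φ ∈ IsManifold.maximalAtlas (𝓡 n) ∞ M) (hg : IsLocallyLipschitz g)
    (hy₀ : y₀ ∈ φ.target) (v w : Euc n) :
    Tendsto (fun q : ℝ × Euc n => comp₂ φ (gc q.1) v w q.2) (𝓝[>] 0 ×ˢ 𝓝 y₀)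
      (𝓝 (comp₂ φ g v w y₀)) := by
  have h1 : Tendsto (fun q : ℝ × Euc n => comp₂ φ (gc q.1) v w q.2 -
      components φ (D.convBilin g q.1) q.2 v w) (𝓝[>] 0 ×ˢ 𝓝 y₀) (𝓝 0) := by
    have := tendsto_norm_zero.comp (hgc.tendsto_iteratedFDeriv hφ hy₀ v w 0)
    refine tendsto_zero_iff_norm_tendsto_zero.2 (this.congr fun q => ?_)
    rw [Function.comp_apply, norm_iteratedFDeriv_zero]
  have h2 := h1.add (RegularisationData.tendsto_components_convBilin (D := D) hφ hg hy₀ v w)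
  simpa using h2

/-- Up to an error tending to zero, the derivatives of the components of the approximating metrics
are the convolutions of the derivatives of the components of `g`. -/
theorem tendsto_fderiv_comp₂_sub (hgc : IsNarrowApproximation D g gc)
    (hφ : φ ∈ IsManifold.maximalAtlas (𝓡 n) ∞ M) (hg : IsLocallyLipschitz g)
    (hy₀ : y₀ ∈ φ.target) (v w a : Euc n) :
    Tendsto (fun q : ℝ × Euc n => fderiv ℝ (comp₂ φ (gc q.1) v w) q.2 a -
      D.conv (derivComp φ g v w a) q.1 (φ.symm q.2)) (𝓝[>] 0 ×ˢ 𝓝 y₀) (𝓝 0) := by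
  have hc := RegularisationData.tendsto_fderiv_components_convBilin (D := D) hφ hg hy₀ v w a
  have h1 : Tendsto (fun q : ℝ × Euc n => fderiv ℝ (fun y => comp₂ φ (gc q.1) v w y -
      components φ (D.convBilin g q.1) y v w) q.2 a) (𝓝[>] 0 ×ˢ 𝓝 y₀) (𝓝 0) := by
    have h2 := tendsto_norm_zero.comp (hgc.tendsto_iteratedFDeriv hφ hy₀ v w 1)
    have h3 := h2.mul_const ‖a‖
    rw [zero_mul] at h3
    refine squeeze_zero_norm (fun q => ?_) h3
    rw [Function.comp_apply, norm_iteratedFDeriv_one]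
    exact ContinuousLinearMap.le_opNorm _ _
  have h4 := h1.add hc.2
  rw [zero_add] at h4
  refine h4.congr' ?_
  filter_upwards [hc.1, eventually_Ioc_zero_one.prod_mk (φ.open_target.mem_nhds hy₀)]
    with q h5 h6
  rw [fderiv_fun_sub ((hgc.smooth q.1 h6.1).compDiffAt hφ h6.2 v w) h5]
  simp

end IsNarrowApproximation

end NarrowApproximation

/-! ### Asymptotics of the mean curvature under regularisation. -/

section CurvatureLimits

variable {m n : ℕ} {M : Type*} [TopologicalSpace M] [ChartedSpace (Euc n) M]
  [IsManifold (𝓡 n) ∞ M] {φ φ' : OpenPartialHomeomorph M (Euc n)}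
  {L : (Euc m × ℝ) ≃L[ℝ] Euc n} {D : RegularisationData n M}
  {g : BilinField n M} {gc : ℝ → BilinField n M} {T : VectorField n M} {p₀ : M}

theorem locEssBounded_derivComp_symm (hg : IsLocallyLipschitz g)
    (hφ : φ ∈ IsManifold.maximalAtlas (𝓡 n) ∞ M) (hφ' : φ' ∈ IsManifold.maximalAtlas (𝓡 n) ∞ M)
    (hp : p₀ ∈ φ.source) (hp' : p₀ ∈ φ'.source) (v w a : Euc n) :
    LocEssBounded (fun x => derivComp φ g v w a (φ'.symm x)) (φ' p₀) := by
  have := locEssBounded_derivComp hφ hφ' hg (φ.map_source hp) (by rwa [φ.left_inv hp]) v w a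
  rwa [φ.left_inv hp] at this

theorem locEssBounded_chrBasis (hg : IsLocallyLipschitz g)
    (hφ : φ ∈ IsManifold.maximalAtlas (𝓡 n) ∞ M) (hφ' : φ' ∈ IsManifold.maximalAtlas (𝓡 n) ∞ M)
    (hp : p₀ ∈ φ.source) (hp' : p₀ ∈ φ'.source) (r : Fin m × Fin m × Fin n) :
    LocEssBounded (fun x => chrBasis φ g L r (φ'.symm x)) (φ' p₀) := by
  simp only [chrBasis_eq]
  refine LocEssBounded.sum _ fun i _ => LocEssBounded.const_mul ?_ _
  fin_cases i <;> exact locEssBounded_derivComp_symm hg hφ hφ' hp hp' _ _ _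

theorem eventually_compDiffAt_transition (hg : IsLocallyLipschitz g)
    (hφ : φ ∈ IsManifold.maximalAtlas (𝓡 n) ∞ M) (hφ' : φ' ∈ IsManifold.maximalAtlas (𝓡 n) ∞ M)
    (hp : p₀ ∈ φ.source) (hp' : p₀ ∈ φ'.source) :
    ∀ᶠ x in 𝓝 (φ' p₀) ⊓ ae volume, CompDiffAt φ g (φ (φ'.symm x)) := by
  have hy : φ'.symm (φ' p₀) ∈ φ.source := by rwa [φ'.left_inv hp']
  filter_upwards [hg.eventually_compDiffAt hφ' (φ'.map_source hp'), mem_inf_of_left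
    (eventually_mem_target_transition (φ'.map_source hp') hy)] with x h1 h2
  refine CompDiffAt.transition hφ hφ' (φ.map_source h2.2) ?_ ?_
  · rw [φ.left_inv h2.2]; exact φ'.map_target h2.1
  · rwa [Function.comp_apply, φ.left_inv h2.2, φ'.right_inv h2.1]

theorem tendsto_symm_nhds (hp' : p₀ ∈ φ'.source) :
    Tendsto φ'.symm (𝓝 (φ' p₀)) (𝓝 p₀) := by
  have := φ'.continuousAt_symm (φ'.map_source hp')
  rwa [ContinuousAt, φ'.left_inv hp'] at this

theorem eventually_continuousAt_comp_symm (hp' : p₀ ∈ φ'.source) {c : M → ℝ}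
    (hc : ∀ᶠ p in 𝓝 p₀, ContinuousAt c p) :
    ∀ᶠ x in 𝓝 (φ' p₀), ContinuousAt (fun x => c (φ'.symm x)) x := by
  filter_upwards [(tendsto_symm_nhds hp').eventually hc,
    φ'.open_target.mem_nhds (φ'.map_source hp')] with x h1 h2
  exact ContinuousAt.comp (g := c) h1 (φ'.continuousAt_symm h2)

variable (φ g T L p₀) in
/-- The function `f` is near `p₀` the mean curvature of the leaves, almost everywhere. -/
def IsCurvatureNear (f : M → ℝ) : Prop :=
  ∀ᶠ p in 𝓝 p₀, CompDiffAt φ g (φ p) → f p = ∑ r, curvCoeffAt φ g T L r p * chrBasis φ g L r p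

theorem eventually_continuousAt_curvCoeffAt (hg : IsLocallyLipschitz g)
    (hφ : φ ∈ IsManifold.maximalAtlas (𝓡 n) ∞ M) (hT : IsSmoothVectorField T)
    (hp : p₀ ∈ φ.source) (hc : NormalConditionAt φ g g T L p₀) (r : Fin m × Fin m × Fin n) :
    ∀ᶠ p in 𝓝 p₀, ContinuousAt (curvCoeffAt φ g T L r) p := by
  filter_upwards [eventually_normalConditionAt hg hφ hT hp hc, φ.open_source.mem_nhds hp]
    with p h1 h2 using continuousAt_curvCoeffAt hg hφ hT h2 h1 r

theorem IsCurvatureNear.locEssBounded {f : M → ℝ} (hf : IsCurvatureNear φ L g T p₀ f)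
    (hg : IsLocallyLipschitz g) (hφ : φ ∈ IsManifold.maximalAtlas (𝓡 n) ∞ M)
    (hφ' : φ' ∈ IsManifold.maximalAtlas (𝓡 n) ∞ M) (hT : IsSmoothVectorField T)
    (hp : p₀ ∈ φ.source) (hp' : p₀ ∈ φ'.source) (hc : NormalConditionAt φ g g T L p₀) :
    LocEssBounded (fun x => f (φ'.symm x)) (φ' p₀) := by
  have h1 : LocEssBounded (fun x => ∑ r, curvCoeffAt φ g T L r (φ'.symm x) *
      chrBasis φ g L r (φ'.symm x)) (φ' p₀) :=
    LocEssBounded.sum _ fun r _ => (LocEssBounded.of_continuousAt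
      (eventually_continuousAt_comp_symm hp' (eventually_continuousAt_curvCoeffAt hg hφ hT hp hc r))).mul
      (locEssBounded_chrBasis hg hφ hφ' hp hp' r)
  refine h1.congr ?_
  filter_upwards [eventually_compDiffAt_transition hg hφ hφ' hp hp',
    mem_inf_of_left ((tendsto_symm_nhds hp').eventually hf)] with x h2 h3
  exact (h3 h2).symm

/-- Upper bounds pass to the convolution asymptotically, so they are applied to `f` and to `-f`; the
additional 1 absorbs the error. -/
theorem RegularisationData.eventually_abs_conv_le {f : M → ℝ} (hf : D.LocBdd f p₀) :
    ∃ C, ∀ᶠ q : ℝ × M in 𝓝[>] 0 ×ˢ 𝓝 p₀, |D.conv f q.1 q.2| ≤ C := by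
  obtain ⟨I, hI, -⟩ := D.exists_finset p₀
  have hbd : ∃ C, ∀ α, p₀ ∈ (D.chart α).source →
      ∀ᶠ y in 𝓝 (D.chart α p₀) ⊓ ae volume, |f ((D.chart α).symm y)| ≤ C := by
    -- Each chart around `p₀` comes with its own essential bound. Local finiteness leaves finitely
    -- many such charts and hence a common bound.
    obtain ⟨t, ht, hfin⟩ := D.locallyFinite p₀
    have hch : ∀ α, ∃ C, p₀ ∈ (D.chart α).source →
        ∀ᶠ y in 𝓝 (D.chart α p₀) ⊓ ae volume, |f ((D.chart α).symm y)| ≤ C := fun α => by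
      by_cases h : p₀ ∈ (D.chart α).source
      · obtain ⟨C, hC⟩ := (hf α h).bdd
        exact ⟨C, fun _ => hC⟩
      · exact ⟨0, fun h' => absurd h' h⟩
    choose C hC using hch
    obtain ⟨B, hB⟩ := (hfin.image C).bddAbove
    refine ⟨B, fun α hα => (hC α hα).mono fun y hy => hy.trans (hB ⟨α, ?_, rfl⟩)⟩
    exact ⟨p₀, hα, mem_of_mem_nhds ht⟩
  obtain ⟨C, hC⟩ := hbd
  refine ⟨C + 1, ?_⟩
  have h1 := eventually_conv_le (D := D) hf (lt_add_one C)
    fun α hα => (hC α hα).mono fun y hy => (le_abs_self _).trans hy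
  have h2 := eventually_conv_le (D := D) (hf.const_mul (-1)) (lt_add_one C)
    fun α hα => (hC α hα).mono fun y hy => by
      have := (neg_le_abs (f ((D.chart α).symm y))).trans hy
      linarith
  have h3 := eventually_conv_sum (D := D) (κ := Unit) (fun _ => (-1 : ℝ)) fun _ => hf
  filter_upwards [h1, h2, h3] with q h4 h5 h6
  simp only [Finset.univ_unique, Finset.sum_singleton] at h6
  rw [h6] at h5
  exact abs_le.2 ⟨by linarith, h4⟩

theorem tendsto_prod_chart (hp : p₀ ∈ φ.source) :
    Tendsto (fun q : ℝ × M => (q.1, φ q.2)) (𝓝[>] 0 ×ˢ 𝓝 p₀) (𝓝[>] 0 ×ˢ 𝓝 (φ p₀)) :=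
  tendsto_fst.prodMk ((φ.continuousAt hp).tendsto.comp tendsto_snd)

theorem locBdd_chrBasis (hg : IsLocallyLipschitz g)
    (hφ : φ ∈ IsManifold.maximalAtlas (𝓡 n) ∞ M) (hp : p₀ ∈ φ.source) (r : Fin m × Fin m × Fin n) :
    D.LocBdd (chrBasis φ g L r) p₀ :=
  fun α hα => locEssBounded_chrBasis hg hφ (D.chart_mem α) hp hα r

theorem IsNarrowApproximation.tendsto_chrBasis_sub (hgc : IsNarrowApproximation D g gc)
    (hg : IsLocallyLipschitz g) (hφ : φ ∈ IsManifold.maximalAtlas (𝓡 n) ∞ M)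
    (hp : p₀ ∈ φ.source) (r : Fin m × Fin m × Fin n) :
    Tendsto (fun q : ℝ × M => chrBasis φ (gc q.1) L r q.2 - D.conv (chrBasis φ g L r) q.1 q.2)
      (𝓝[>] 0 ×ˢ 𝓝 p₀) (𝓝 0) := by
  have hd : ∀ v w a, Tendsto (fun q : ℝ × M => derivComp φ (gc q.1) v w a q.2 -
      D.conv (derivComp φ g v w a) q.1 q.2) (𝓝[>] 0 ×ˢ 𝓝 p₀) (𝓝 0) := fun v w a => by
    refine ((hgc.tendsto_fderiv_comp₂_sub hφ hg (φ.map_source hp) v w a).comp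
      (tendsto_prod_chart hp)).congr' ?_
    have : ∀ᶠ p in 𝓝 p₀, p ∈ φ.source := φ.open_source.mem_nhds hp
    filter_upwards [this.prod_inr _] with q hq
    simp only [Function.comp_apply, φ.left_inv hq]
    rfl
  let f : Fin 3 → BilinField n M → M → ℝ := fun i g =>
    (![derivComp φ g (leafBasis L r.2.1) (EuclideanSpace.single r.2.2 1) (leafBasis L r.1),
        derivComp φ g (leafBasis L r.1) (EuclideanSpace.single r.2.2 1) (leafBasis L r.2.1),
        derivComp φ g (leafBasis L r.1) (leafBasis L r.2.1) (EuclideanSpace.single r.2.2 1)] :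
        Fin 3 → M → ℝ) i
  have hf : ∀ i, Tendsto (fun q : ℝ × M => f i (gc q.1) q.2 - D.conv (f i g) q.1 q.2)
      (𝓝[>] 0 ×ˢ 𝓝 p₀) (𝓝 0) := fun i => by
    fin_cases i <;> exact hd _ _ _
  have hb : ∀ i, D.LocBdd (f i g) p₀ := fun i α hα => by
    fin_cases i <;> exact locEssBounded_derivComp_symm hg hφ (D.chart_mem α) hp hα _ _ _
  have hsum := tendsto_finsetSum Finset.univ fun i _ =>
    (hf i).const_mul ((![1/2, 1/2, -1/2] : Fin 3 → ℝ) i)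
  simp only [mul_zero, Finset.sum_const_zero] at hsum
  refine hsum.congr' ?_
  filter_upwards [RegularisationData.eventually_conv_sum (D := D) (![1/2, 1/2, -1/2] : Fin 3 → ℝ) hb]
    with q hq
  have h1 : chrBasis φ g L r = fun p => ∑ i : Fin 3, (![1/2, 1/2, -1/2] : Fin 3 → ℝ) i * f i g p :=
    funext fun p => chrBasis_eq g r p
  have h2 : chrBasis φ (gc q.1) L r q.2 =
      ∑ i : Fin 3, (![1/2, 1/2, -1/2] : Fin 3 → ℝ) i * f i (gc q.1) q.2 := chrBasis_eq _ r _
  rw [h1, h2, hq, ← Finset.sum_sub_distrib]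
  exact Finset.sum_congr rfl fun i _ => mul_sub _ _ _

theorem IsNarrowApproximation.tendsto_componentsBilin (hgc : IsNarrowApproximation D g gc)
    (hg : IsLocallyLipschitz g) (hφ : φ ∈ IsManifold.maximalAtlas (𝓡 n) ∞ M)
    (hp : p₀ ∈ φ.source) (v w : Euc n) :
    Tendsto (fun q : ℝ × M => componentsBilin φ (gc q.1) (φ q.2) v w)
      (𝓝[>] 0 ×ˢ 𝓝 p₀) (𝓝 (componentsBilin φ g (φ p₀) v w)) := by
  have h : Tendsto (fun q : ℝ × M => comp₂ φ (gc q.1) v w (φ q.2)) (𝓝[>] 0 ×ˢ 𝓝 p₀)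
      (𝓝 (comp₂ φ g v w (φ p₀))) :=
    (hgc.tendsto_comp₂ hφ hg (φ.map_source hp) v w).comp (tendsto_prod_chart hp)
  exact h

/-- Asymptotically, the mean curvature of the leaves for the approximating metrics is the
convolution of the mean curvature for `g`. -/
theorem IsNarrowApproximation.tendsto_sum_curvCoeffAt_sub (hgc : IsNarrowApproximation D g gc)
    (hg : IsLocallyLipschitz g) (hφ : φ ∈ IsManifold.maximalAtlas (𝓡 n) ∞ M)
    (hT : IsSmoothVectorField T) (hp : p₀ ∈ φ.source) (hc : NormalConditionAt φ g g T L p₀)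
    {f : M → ℝ} (hf : IsCurvatureNear φ L g T p₀ f) :
    Tendsto (fun q : ℝ × M => ∑ r, curvCoeffAt φ (gc q.1) T L r q.2 * chrBasis φ (gc q.1) L r q.2 -
      D.conv f q.1 q.2) (𝓝[>] 0 ×ˢ 𝓝 p₀) (𝓝 0) := by
  -- The same sum with its coefficients frozen at `p₀`. It approximates `f` almost everywhere near
  -- `p₀`, and its convolution can be computed termwise by linearity.
  set h : M → ℝ := fun p => ∑ r, curvCoeffAt φ g T L r p₀ * chrBasis φ g L r p with hh
  have hbΓ : ∀ r, D.LocBdd (chrBasis φ g L r) p₀ := locBdd_chrBasis hg hφ hp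
  have hbh : D.LocBdd h p₀ := .sum _ fun r _ => (hbΓ r).const_mul _
  have hbf : D.LocBdd f p₀ := fun α hα => hf.locEssBounded hg hφ (D.chart_mem α) hT hp hα hc
  have hfh : Tendsto (fun q : ℝ × M => D.conv f q.1 q.2 - D.conv h q.1 q.2) (𝓝[>] 0 ×ˢ 𝓝 p₀)
      (𝓝 0) := by
    refine RegularisationData.tendsto_conv_sub hbf hbh fun η hη α hα => ?_
    have h1 : Tendsto (fun x => ∑ r, (curvCoeffAt φ g T L r ((D.chart α).symm x) *
        chrBasis φ g L r ((D.chart α).symm x) - curvCoeffAt φ g T L r p₀ *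
        chrBasis φ g L r ((D.chart α).symm x))) (𝓝 (D.chart α p₀) ⊓ ae volume) (𝓝 0) := by
      have h2 : ∀ r, Tendsto (fun x => curvCoeffAt φ g T L r ((D.chart α).symm x) *
          chrBasis φ g L r ((D.chart α).symm x) - curvCoeffAt φ g T L r p₀ *
          chrBasis φ g L r ((D.chart α).symm x)) (𝓝 (D.chart α p₀) ⊓ ae volume) (𝓝 0) := fun r => by
        obtain ⟨C, hC⟩ := (hbΓ r α hα).bdd
        exact tendsto_sub_mul_of_bounded (((continuousAt_curvCoeffAt hg hφ hT hp hc r).tendsto.comp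
          (tendsto_symm_nhds hα)).mono_left inf_le_left) hC
      have h3 := tendsto_finsetSum Finset.univ fun r _ => h2 r
      rwa [Finset.sum_const_zero] at h3
    filter_upwards [Metric.tendsto_nhds.1 h1 η hη, eventually_compDiffAt_transition hg hφ
      (D.chart_mem α) hp hα, mem_inf_of_left ((tendsto_symm_nhds hα).eventually hf)] with x h2 h3 h4
    rw [Real.dist_0_eq_abs, Finset.sum_sub_distrib] at h2
    rw [h4 h3]
    exact h2.le
  have hBq := hgc.tendsto_componentsBilin hg hφ hp
  have hτ : Tendsto (fun q : ℝ × M => (mfderiv (𝓡 n) (𝓡 n) φ q.2 (T q.2) : Euc n))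
      (𝓝[>] 0 ×ˢ 𝓝 p₀) (𝓝 (mfderiv (𝓡 n) (𝓡 n) φ p₀ (T p₀))) :=
    (continuousAt_mfderiv_vectorField hφ hT hp).tendsto.comp tendsto_snd
  have hC : ∀ r, Tendsto (fun q : ℝ × M => curvCoeffAt φ (gc q.1) T L r q.2) (𝓝[>] 0 ×ˢ 𝓝 p₀)
      (𝓝 (curvCoeffAt φ g T L r p₀)) := tendsto_curvCoeff hBq hτ hc
  -- The product is split into the error of the Christoffel symbol and the error of the coefficient;
  -- in the second the convolved symbol is merely bounded.
  have hr : ∀ r, Tendsto (fun q : ℝ × M => curvCoeffAt φ (gc q.1) T L r q.2 *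
      (chrBasis φ (gc q.1) L r q.2 - D.conv (chrBasis φ g L r) q.1 q.2) +
      (curvCoeffAt φ (gc q.1) T L r q.2 * D.conv (chrBasis φ g L r) q.1 q.2 -
        curvCoeffAt φ g T L r p₀ * D.conv (chrBasis φ g L r) q.1 q.2)) (𝓝[>] 0 ×ˢ 𝓝 p₀)
      (𝓝 0) := fun r => by
    obtain ⟨C, hC'⟩ := RegularisationData.eventually_abs_conv_le (hbΓ r)
    have := ((hC r).mul (hgc.tendsto_chrBasis_sub (L := L) hg hφ hp r)).add
      (tendsto_sub_mul_of_bounded (hC r) hC')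
    simpa only [mul_zero, add_zero] using this
  have hsum := (tendsto_finsetSum Finset.univ fun r _ => hr r).sub hfh
  rw [Finset.sum_const_zero, sub_zero] at hsum
  refine hsum.congr' ?_
  filter_upwards [RegularisationData.eventually_conv_sum (D := D)
    (fun r => curvCoeffAt φ g T L r p₀) hbΓ] with q hq
  rw [hh, hq, sub_sub_eq_add_sub, sub_left_inj, ← Finset.sum_add_distrib]
  exact Finset.sum_congr rfl fun r _ => by ring

theorem IsNarrowApproximation.eventually_normalConditionAt (hgc : IsNarrowApproximation D g gc)
    (hg : IsLocallyLipschitz g) (hφ : φ ∈ IsManifold.maximalAtlas (𝓡 n) ∞ M)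
    (hT : IsSmoothVectorField T) (hp : p₀ ∈ φ.source) (hc : NormalConditionAt φ g g T L p₀) :
    ∀ᶠ q : ℝ × M in 𝓝[>] 0 ×ˢ 𝓝 p₀, NormalConditionAt φ (gc q.1) g T L q.2 :=
  eventually_normalCondition (hgc.tendsto_componentsBilin hg hφ hp)
    ((continuousAt_mfderiv_vectorField hφ hT hp).tendsto.comp tendsto_snd)
    (fun v w => (hg.continuousAt_componentsBilin hφ hp v w).tendsto.comp tendsto_snd) hc

end CurvatureLimits

/-! ### Null sets and local essential boundedness on the manifold. -/

section NullSets

variable {n : ℕ} {M : Type*} [TopologicalSpace M] [ChartedSpace (Euc n) M]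
  {φ : OpenPartialHomeomorph M (Euc n)} {E E' : Set M} {f : M → ℝ}

theorem IsNullSet.mono (h : IsNullSet n E) (hE : E' ⊆ E) : IsNullSet n E' := fun φ hφ =>
  measure_mono_null (image_mono (inter_subset_inter_left _ hE)) (h φ hφ)

theorem IsNullSet.union (h : IsNullSet n E) (h' : IsNullSet n E') : IsNullSet n (E ∪ E') :=
  fun φ hφ => by
    rw [union_inter_distrib_right, image_union]
    exact measure_union_null (h φ hφ) (h' φ hφ)

/-- To be a null set can be checked in one chart. -/
theorem IsNullSet.of_chart (hφ : φ ∈ IsManifold.maximalAtlas (𝓡 n) ∞ M) (hE : E ⊆ φ.source)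
    (h : volume (φ '' E) = 0) : IsNullSet n E := by
  intro φ' hφ'
  have h1 : φ' '' (E ∩ φ'.source) = (φ' ∘ φ.symm) '' (φ '' (E ∩ φ'.source)) := by
    rw [← image_comp]
    refine image_congr fun p hp => ?_
    simp [φ.left_inv (hE hp.1)]
  rw [h1]
  refine addHaar_image_eq_zero_of_differentiableOn_of_addHaar_eq_zero _ ?_
    (measure_mono_null (image_mono inter_subset_left) h)
  rintro _ ⟨p, hp, rfl⟩
  refine ((contDiffAt_transition hφ hφ' (φ.map_source (hE hp.1)) ?_).differentiableAt
    (by simp)).differentiableWithinAt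
  rw [φ.left_inv (hE hp.1)]
  exact hp.2

/-- Functions which are locally essentially bounded in all charts are in `L^∞_loc`. -/
theorem MemLinftyLoc.of_locEssBounded [IsManifold (𝓡 n) ∞ M] {A : Set M}
    (h : ∀ φ ∈ IsManifold.maximalAtlas (𝓡 n) ∞ M, ∀ p ∈ A, p ∈ φ.source →
      LocEssBounded (fun x => f (φ.symm x)) (φ p)) : MemLinftyLoc n f A := by
  constructor
  · intro φ hφ
    have h1 : ∀ y ∈ φ.target ∩ φ.symm ⁻¹' A, ∃ s ∈ 𝓝 y, AEStronglyMeasurable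
        (fun x => f (φ.symm x)) (volume.restrict s) := fun y hy => by
      have := (h φ hφ _ hy.2 (φ.map_target hy.1)).meas
      rwa [φ.right_inv hy.1] at this
    choose! s hs hsm using h1
    -- Measurability is known only on a neighbourhood of each point; the Lindelöf property reduces
    -- the cover to countably many of them.
    obtain ⟨t, ht, htc, htU⟩ := TopologicalSpace.countable_cover_nhdsWithin
      (f := s) fun y hy => mem_nhdsWithin_of_mem_nhds (hs y hy)
    have h2 : AEStronglyMeasurable (fun x => f (φ.symm x))
        (volume.restrict (⋃ y : t, s y)) := by
      have : Countable t := htc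
      exact aestronglyMeasurable_iUnion_iff.2 fun y => hsm y (ht y.2)
    refine h2.mono_measure (Measure.restrict_mono ?_ le_rfl)
    rwa [biUnion_eq_iUnion] at htU
  · intro K hKA hK
    refine hK.induction_on (p := fun s => ∃ C : ℝ, IsNullSet n {p ∈ s | C < |f p|}) ?_ ?_ ?_ ?_
    · exact ⟨0, fun φ _ => by simp⟩
    · rintro s t hst ⟨C, hC⟩
      exact ⟨C, hC.mono fun p hp => ⟨hst hp.1, hp.2⟩⟩
    · rintro s t ⟨C, hC⟩ ⟨C', hC'⟩
      refine ⟨max C C', (hC.union hC').mono ?_⟩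
      rintro p ⟨hp | hp, h⟩
      · exact Or.inl ⟨hp, (le_max_left _ _).trans_lt h⟩
      · exact Or.inr ⟨hp, (le_max_right _ _).trans_lt h⟩
    · intro p hp
      have hφ := IsManifold.chart_mem_maximalAtlas (I := 𝓡 n) (n := ∞) p
      set φ := chartAt (Euc n) p
      have hps : p ∈ φ.source := mem_chart_source _ _
      obtain ⟨C, hC⟩ := (h φ hφ p (hKA hp) hps).bdd
      obtain ⟨r, hr, hr'⟩ := eventually_inf_ae_iff.1 hC
      refine ⟨φ.source ∩ φ ⁻¹' Metric.ball (φ p) r, mem_nhdsWithin_of_mem_nhds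
        (inter_mem (φ.open_source.mem_nhds hps)
          ((φ.continuousAt hps).preimage_mem_nhds (Metric.ball_mem_nhds _ hr))), C,
        IsNullSet.of_chart hφ (fun q hq => hq.1.1) (measure_mono_null ?_ hr')⟩
      rintro _ ⟨q, ⟨⟨hq1, hq2⟩, hq3⟩, rfl⟩
      simp only [mem_compl_iff, mem_ofPred_eq, not_forall, not_le]
      refine ⟨hq2, ?_⟩
      rwa [φ.left_inv hq1]

end NullSets

/-! ### The mean curvature of the leaves of an admissible slab. -/

section Slabs

variable {m : ℕ} {M : Type*} [TopologicalSpace M] [ChartedSpace (Euc (m + 1)) M]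
  {S : Type*} [TopologicalSpace S] [ChartedSpace (Euc m) S]
  {g g₀ : BilinField (m + 1) M} {T X : VectorField (m + 1) M} {ι : S → M} {U : Set S}
  {𝒜 : Set (S × ℝ)} {w₀ : S × ℝ}

/-- A linear isomorphism which splits off the last coordinate. -/
noncomputable def splitLast (m : ℕ) : (Euc m × ℝ) ≃L[ℝ] Euc (m + 1) :=
  ContinuousLinearEquiv.ofFinrankEq (by simp)

/-- The definition chooses a preimage under the flow-out; injectivity on `𝒜` forces that choice to
be the given point. -/
theorem slabMeanCurvature_flowOut (h𝒜 : InjOn (flowOut X ι) 𝒜) (hw : w₀ ∈ 𝒜) :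
    slabMeanCurvature m g g₀ T X ι 𝒜 (flowOut X ι w₀) =
      meanCurvature m g g₀ T (fun z => flowOut X ι (z, w₀.2)) w₀.1 := by
  have h : ∃ w ∈ 𝒜, flowOut X ι w = flowOut X ι w₀ := ⟨w₀, hw, rfl⟩
  have h1 : h.choose = w₀ := h𝒜 h.choose_spec.1 hw h.choose_spec.2
  rw [slabMeanCurvature, dif_pos h, h1]

variable [IsManifold (𝓡 (m + 1)) ∞ M] [IsManifold (𝓡 m) ∞ S] {D : RegularisationData (m + 1) M}
  {gc : ℝ → BilinField (m + 1) M}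

/-- Near each point of an admissible set there are adapted charts. -/
theorem IsAdmissible.exists_adapted (h𝒜 : IsAdmissible m g X ι U 𝒜) (hw : w₀ ∈ 𝒜)
    (hg : IsLorentzian g) (hgl : IsLocallyLipschitz g) (hT : IsSmoothVectorField T)
    (hTt : IsTimelike g T) :
    ∃ N φ ψ, w₀ ∈ N ∧ IsAdaptedChart (flowOut X ι) N φ ψ (splitLast m) ∧
      NormalConditionAt φ g g T (splitLast m) (flowOut X ι w₀) ∧
      IsCurvatureNear φ (splitLast m) g T (flowOut X ι w₀) (slabMeanCurvature m g g T X ι 𝒜) := by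
  obtain ⟨N, φ, ψ, hN, h⟩ := exists_isAdaptedChart (splitLast m) (h𝒜.isLocalDiffeomorphOn ⟨w₀, hw⟩)
  have hc : NormalConditionAt φ g g T (splitLast m) (flowOut X ι w₀) :=
    h.normalConditionAt hN (fun p => (hg p).1) hTt (h𝒜.leaves_spacelike w₀ hw)
  refine ⟨N, φ, ψ, hN, h, hc, h.eventually_of_leaf hN ?_⟩
  filter_upwards [h.isOpen.mem_nhds hN, h𝒜.isOpen.mem_nhds hw, (h.continuousAt hN).eventually
    (eventually_normalConditionAt hgl h.φ_mem hT (h.map_mem_source _ hN) hc)] with w h1 h2 h3 hd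
  rw [slabMeanCurvature_flowOut h𝒜.injOn h2]
  exact h.meanCurvature_eq h1 (fun p => (hg p).1) hd h3

theorem IsAdmissible.locEssBounded_slabMeanCurvature (h𝒜 : IsAdmissible m g X ι U 𝒜)
    (hg : IsLorentzian g) (hgl : IsLocallyLipschitz g) (hT : IsSmoothVectorField T)
    (hTt : IsTimelike g T) {φ : OpenPartialHomeomorph M (Euc (m + 1))}
    (hφ : φ ∈ IsManifold.maximalAtlas (𝓡 (m + 1)) ∞ M) {p : M} (hp : p ∈ flowOut X ι '' 𝒜)
    (hpφ : p ∈ φ.source) :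
    LocEssBounded (fun x => slabMeanCurvature m g g T X ι 𝒜 (φ.symm x)) (φ p) := by
  obtain ⟨w, hw, rfl⟩ := hp
  obtain ⟨N, φ', ψ, hN, h, hc, hcurv⟩ := h𝒜.exists_adapted hw hg hgl hT hTt
  exact hcurv.locEssBounded hgl h.φ_mem hφ hT (h.map_mem_source _ hN) hpφ hc

theorem IsAdmissible.memLinftyLoc (h𝒜 : IsAdmissible m g X ι U 𝒜)
    (hg : IsLorentzian g) (hgl : IsLocallyLipschitz g) (hT : IsSmoothVectorField T)
    (hTt : IsTimelike g T) :
    MemLinftyLoc (m + 1) (slabMeanCurvature m g g T X ι 𝒜) (flowOut X ι '' 𝒜) :=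
  MemLinftyLoc.of_locEssBounded fun _ hφ _ hp hpφ =>
    h𝒜.locEssBounded_slabMeanCurvature hg hgl hT hTt hφ hp hpφ

/-- Local convergence of the mean curvature of the leaves. -/
theorem IsAdmissible.tendsto_meanCurvature_sub (h𝒜 : IsAdmissible m g X ι U 𝒜) (hw : w₀ ∈ 𝒜)
    (hg : IsLorentzian g) (hgl : IsLocallyLipschitz g) (hT : IsSmoothVectorField T)
    (hTt : IsTimelike g T) (hgc : IsNarrowApproximation D g gc) :
    Tendsto (fun q : ℝ × (S × ℝ) =>
      meanCurvature m (gc q.1) g T (fun z => flowOut X ι (z, q.2.2)) q.2.1 -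
        D.conv (slabMeanCurvature m g g T X ι 𝒜) q.1 (flowOut X ι q.2)) (𝓝[>] 0 ×ˢ 𝓝 w₀)
      (𝓝 0) := by
  obtain ⟨N, φ, ψ, hN, h, hc, hcurv⟩ := h𝒜.exists_adapted hw hg hgl hT hTt
  have hp := h.map_mem_source _ hN
  have hF : Tendsto (fun q : ℝ × (S × ℝ) => (q.1, flowOut X ι q.2)) (𝓝[>] 0 ×ˢ 𝓝 w₀)
      (𝓝[>] 0 ×ˢ 𝓝 (flowOut X ι w₀)) :=
    tendsto_fst.prodMk ((h.continuousAt hN).tendsto.comp tendsto_snd)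
  refine ((hgc.tendsto_sum_curvCoeffAt_sub hgl h.φ_mem hT hp hc hcurv).comp hF).congr' ?_
  filter_upwards [hF.eventually (hgc.eventually_normalConditionAt hgl h.φ_mem hT hp hc),
    eventually_Ioc_zero_one.prod_mk (h.isOpen.mem_nhds hN)] with q h1 h2
  simp only [Function.comp_apply]
  rw [h.meanCurvature_eq h2.2 (fun p => (hgc.lorentzian q.1 h2.1 p).1)
    ((hgc.smooth q.1 h2.1).compDiffAt h.φ_mem (φ.map_source (h.map_mem_source _ h2.2))) h1]
  rfl

end Slabs

/-! ### Integral curves on the manifold. -/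

section Flow

variable {n : ℕ} {M : Type*} [TopologicalSpace M] [ChartedSpace (Euc n) M] [IsManifold (𝓡 n) ∞ M]
  {φ : OpenPartialHomeomorph M (Euc n)} {X : VectorField n M}

theorem FlowsTo.unique [T2Space M] (hX : IsSmoothVectorField X) {p q q' : M} {t : ℝ}
    (h : FlowsTo X p t q) (h' : FlowsTo X p t q') : q = q' := by
  obtain ⟨γ, a, b, h0, ht, hγ, hγ0, hγt⟩ := h
  obtain ⟨γ', a', b', h0', ht', hγ', hγ0', hγt'⟩ := h'
  have : IsManifold (𝓡 n) 1 M := IsManifold.of_le (n := ∞) (by simp)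
  have heq := isMIntegralCurveOn_Ioo_eqOn_of_contMDiff_boundaryless (I := 𝓡 n) (t₀ := 0)
    (a := max a a') (b := min b b') ⟨max_lt h0.1 h0'.1, lt_min h0.2 h0'.2⟩ (hX.of_le (by simp))
    (hγ.mono (Ioo_subset_Ioo (le_max_left _ _) (min_le_left _ _)))
    (hγ'.mono (Ioo_subset_Ioo (le_max_right _ _) (min_le_right _ _))) (hγ0.trans hγ0'.symm)
  rw [← hγt, ← hγt']
  exact heq ⟨max_lt ht.1 ht'.1, lt_min ht.2 ht'.2⟩

/-- The local flow of a vector field in a chart. -/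
theorem exists_chart_flow (hφ : φ ∈ IsManifold.maximalAtlas (𝓡 n) ∞ M)
    (hX : IsSmoothVectorField X) {y₀ : Euc n} (hy₀ : y₀ ∈ φ.target) :
    ∃ δ > 0, ∃ u : Euc n × ℝ → Euc n, ContDiffOn ℝ ∞ u (Metric.ball y₀ δ ×ˢ Ioo (-δ) δ) ∧
      MapsTo u (Metric.ball y₀ δ ×ˢ Ioo (-δ) δ) φ.target ∧
      ∀ x ∈ Metric.ball y₀ δ, u (x, 0) = x ∧
        ∀ t ∈ Ioo (-δ) δ, HasDerivAt (fun s => u (x, s)) (chartField φ X (u (x, t))) t := by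
  obtain ⟨r, hr, hrt⟩ := Metric.isOpen_iff.1 φ.open_target y₀ hy₀
  -- The field is smooth only on the target of the chart. A cut-off equal to one on the ball of
  -- radius r / 4 extends it to the whole space, and the flow agrees with that of the original field
  -- as long as it stays in this ball.
  let β : ContDiffBump y₀ := ⟨r / 4, r / 2, by positivity, by linarith⟩
  have hf : ContDiff ℝ ∞ fun y => β y • chartField φ X y := by
    refine contDiff_iff_contDiffAt.2 fun y => ?_
    by_cases hy : y ∈ φ.target
    · exact β.contDiff.contDiffAt.smul (contDiffAt_chartField hφ hX hy)
    · have hy' : y ∉ tsupport β := fun h => hy <| hrt <| by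
        rw [β.tsupport_eq] at h
        exact Metric.closedBall_subset_ball (by change r / 2 < r; linarith) h
      refine (contDiffAt_const (c := (0 : Euc n))).congr_of_eventuallyEq ?_
      filter_upwards [(isClosed_tsupport β).isOpen_compl.mem_nhds hy'] with z hz
      rw [image_eq_zero_of_notMem_tsupport hz, zero_smul]
  obtain ⟨δ, hδ, u, hu, hu'⟩ := exists_contDiffOn_flow hf y₀
  have hy0 : ((y₀, 0) : Euc n × ℝ) ∈ Metric.ball y₀ δ ×ˢ Ioo (-δ) δ :=
    ⟨Metric.mem_ball_self hδ, neg_lt_zero.2 hδ, hδ⟩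
  have hcont : ContinuousAt u (y₀, 0) :=
    hu.continuousOn.continuousAt ((Metric.isOpen_ball.prod isOpen_Ioo).mem_nhds hy0)
  have hu0 : u (y₀, 0) = y₀ := (hu' y₀ hy0.1).1
  have hnear : u ⁻¹' Metric.ball y₀ (r / 4) ∈ 𝓝 (y₀, (0 : ℝ)) :=
    hcont.preimage_mem_nhds (by rw [hu0]; exact Metric.ball_mem_nhds _ (by positivity))
  obtain ⟨δ', hδ', hsub⟩ := Metric.mem_nhds_iff.1 hnear
  have hbox : Metric.ball y₀ (min δ δ') ×ˢ Ioo (-min δ δ') (min δ δ') ⊆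
      (Metric.ball y₀ δ ×ˢ Ioo (-δ) δ) ∩ u ⁻¹' Metric.ball y₀ (r / 4) := by
    rintro ⟨x, t⟩ ⟨hx, ht⟩
    refine ⟨⟨Metric.ball_subset_ball (min_le_left _ _) hx,
      ⟨(neg_le_neg (min_le_left _ _)).trans_lt ht.1, ht.2.trans_le (min_le_left _ _)⟩⟩, hsub ?_⟩
    rw [Metric.mem_ball, Prod.dist_eq]
    refine max_lt ((Metric.mem_ball.1 hx).trans_le (min_le_right _ _)) ?_
    rw [Real.dist_0_eq_abs]
    exact (abs_lt.2 ht).trans_le (min_le_right _ _)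
  refine ⟨min δ δ', lt_min hδ hδ', u, hu.mono fun q hq => (hbox hq).1, fun q hq => hrt
    (Metric.ball_subset_ball (by linarith) (hbox hq).2), fun x hx => ⟨(hu' x
      (Metric.ball_subset_ball (min_le_left _ _) hx)).1, fun t ht => ?_⟩⟩
  have hq := hbox (mk_mem_prod hx ht)
  have h1 := (hu' x hq.1.1).2 t hq.1.2
  rwa [β.one_of_mem_closedBall (Metric.ball_subset_closedBall hq.2), one_smul] at h1

theorem flowsTo_of_chart_flow (hφ : φ ∈ IsManifold.maximalAtlas (𝓡 n) ∞ M) {δ : ℝ} {x : Euc n}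
    {c : ℝ → Euc n} (hc0 : c 0 = x) (hc : ∀ t ∈ Ioo (-δ) δ, c t ∈ φ.target)
    (hd : ∀ t ∈ Ioo (-δ) δ, HasDerivAt c (chartField φ X (c t)) t) {t : ℝ} (ht : t ∈ Ioo (-δ) δ) :
    FlowsTo X (φ.symm x) t (φ.symm (c t)) := by
  have hδ : 0 < δ := by linarith [ht.1, ht.2]
  refine ⟨fun s => φ.symm (c s), -δ, δ, ⟨neg_lt_zero.2 hδ, hδ⟩, ht, fun s hs => ?_, congrArg φ.symm hc0,
    rfl⟩
  have h1 : HasMFDerivAt 𝓘(ℝ, ℝ) (𝓡 n) c s _ := (hd s hs).hasFDerivAt.hasMFDerivAt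
  have h2 := (mdifferentiableAt_chart_symm hφ (hc s hs)).hasMFDerivAt.comp s h1
  refine HasMFDerivAt.hasMFDerivWithinAt ?_
  refine h2.congr_mfderiv (ContinuousLinearMap.ext fun (r : ℝ) => ?_)
  have h3 := mfderiv_chart_symm_of_mfderiv_chart hφ (hc s hs) (X (φ.symm (c s)))
  change mfderiv (𝓡 n) (𝓡 n) φ.symm (c s) (r • chartField φ X (c s)) = r • X (φ.symm (c s))
  have h4 := map_smul (mfderiv (𝓡 n) (𝓡 n) φ.symm (c s)) r (chartField φ X (c s))
  refine h4.trans ?_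
  exact congrArg (fun v => r • v) h3

end Flow

/-! ### The flow-out is a diffeomorphism near the hypersurface. -/

section FlowBox

variable {m : ℕ} {M : Type*} [TopologicalSpace M] [ChartedSpace (Euc (m + 1)) M]
  [IsManifold (𝓡 (m + 1)) ∞ M]
  {S : Type*} [TopologicalSpace S] [ChartedSpace (Euc m) S] [IsManifold (𝓡 m) ∞ S]
  {g : BilinField (m + 1) M} {X : VectorField (m + 1) M} {ι : S → M}

theorem flowOut_eq [T2Space M] (hX : IsSmoothVectorField X) {w : S × ℝ} {q : M}
    (h : FlowsTo X (ι w.1) w.2 q) : flowOut X ι w = q := by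
  have hex : ∃ q, FlowsTo X (ι w.1) w.2 q := ⟨q, h⟩
  rw [flowOut, dif_pos hex]
  exact hex.choose_spec.unique hX h

/-- The starting value of the integral curve settles the matter, so uniqueness of integral curves is
not required. -/
theorem flowOut_zero {z : S} (h : (z, (0 : ℝ)) ∈ flowOutDomain X ι) :
    flowOut X ι (z, 0) = ι z := by
  have hex : ∃ q, FlowsTo X (ι z) 0 q := h
  rw [flowOut, dif_pos hex]
  obtain ⟨γ, a, b, -, -, -, h0, h1⟩ := hex.choose_spec
  exact h1.symm.trans h0

/-- A spacelike hypersurface, in charts: the derivative of the flow-out is invertible. -/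
theorem injective_of_spacelike {B : Euc (m + 1) →ₗ[ℝ] Euc (m + 1) →ₗ[ℝ] ℝ}
    {A : (Euc m × ℝ) →L[ℝ] Euc (m + 1)} (hpos : ∀ v, v ≠ 0 → 0 < B (A (v, 0)) (A (v, 0)))
    (hneg : B (A (0, 1)) (A (0, 1)) < 0) : Function.Injective A := by
  refine (injective_iff_map_eq_zero A).2 ?_
  rintro ⟨v, s⟩ h
  have h1 : A (v, s) = A (v, 0) + s • A (0, 1) := by
    rw [← map_smul, ← map_add]
    simp
  rw [h1] at h
  have h2 : A (v, 0) = -(s • A (0, 1)) := eq_neg_of_add_eq_zero_left h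
  -- A kernel vector would make a spacelike vector a multiple of a timelike one: the left side is
  -- positive unless v = 0, while the right side is never positive.
  have h3 : B (A (v, 0)) (A (v, 0)) = s * s * B (A (0, 1)) (A (0, 1)) := by
    rw [h2]
    simp only [map_neg, map_smul, LinearMap.neg_apply, LinearMap.smul_apply, smul_eq_mul]
    ring
  have hv : v = 0 := by
    by_contra hv
    have := hpos v hv
    rw [h3] at this
    nlinarith [mul_self_nonneg s]
  have hs : s = 0 := by
    have h4 : B (A (v, 0)) (A (v, 0)) = 0 := by
      rw [hv, show ((0, 0) : Euc m × ℝ) = 0 from rfl, map_zero, map_zero]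
    rw [h4] at h3
    have := (mul_eq_zero.1 h3.symm).resolve_right hneg.ne
    exact mul_self_eq_zero.1 this
  rw [hv, hs]
  rfl

/-- Smooth partial homeomorphisms between coordinate spaces give partial diffeomorphisms. -/
theorem exists_partialDiffeomorph {ψ : OpenPartialHomeomorph S (Euc m)}
    {φ : OpenPartialHomeomorph M (Euc (m + 1))} (hψ : ψ ∈ IsManifold.maximalAtlas (𝓡 m) ∞ S)
    (hφ : φ ∈ IsManifold.maximalAtlas (𝓡 (m + 1)) ∞ M)
    (e : OpenPartialHomeomorph (Euc m × ℝ) (Euc (m + 1))) (he : ContDiffOn ℝ ∞ e e.source)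
    (he' : ContDiffOn ℝ ∞ e.symm e.target) :
    ∃ Φ : PartialDiffeomorph ((𝓡 m).prod 𝓘(ℝ, ℝ)) (𝓡 (m + 1)) (S × ℝ) M ∞,
      Φ.source = {w | w.1 ∈ ψ.source ∧ (ψ w.1, w.2) ∈ e.source ∧ e (ψ w.1, w.2) ∈ φ.target} ∧
      ∀ w, Φ w = φ.symm (e (ψ w.1, w.2)) := by
  let c : OpenPartialHomeomorph (S × ℝ) M :=
    ((ψ.prod (OpenPartialHomeomorph.refl ℝ)).trans e).trans φ.symm
  have hsource : c.source =
      {w | w.1 ∈ ψ.source ∧ (ψ w.1, w.2) ∈ e.source ∧ e (ψ w.1, w.2) ∈ φ.target} := by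
    ext w
    simp only [c, mfld_simps]
    exact and_assoc
  have htarget : ∀ p ∈ c.target, p ∈ φ.source ∧ φ p ∈ e.target ∧ (e.symm (φ p)).1 ∈ ψ.target := by
    intro p hp
    simp only [c, mfld_simps] at hp
    exact hp
  refine ⟨⟨c.toPartialEquiv, c.open_source, c.open_target, ?_, ?_⟩, hsource, fun w => rfl⟩
  · change ContMDiffOn _ _ ∞ (fun w : S × ℝ => φ.symm (e (ψ w.1, w.2))) c.source
    have h1 : ContMDiffOn ((𝓡 m).prod 𝓘(ℝ, ℝ)) 𝓘(ℝ, Euc m × ℝ) ∞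
        (fun w : S × ℝ => (ψ w.1, w.2)) c.source := by
      refine ContMDiffOn.prodMk_space ?_ contMDiffOn_snd
      refine (contMDiffOn_of_mem_maximalAtlas hψ).comp contMDiffOn_fst fun w hw => ?_
      rw [hsource] at hw
      exact hw.1
    have h2 : ContMDiffOn ((𝓡 m).prod 𝓘(ℝ, ℝ)) (𝓡 (m + 1)) ∞
        (fun w : S × ℝ => e (ψ w.1, w.2)) c.source :=
      he.contMDiffOn.comp h1 fun w hw => by rw [hsource] at hw; exact hw.2.1
    exact (contMDiffOn_symm_of_mem_maximalAtlas hφ).comp h2 fun w hw => by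
      rw [hsource] at hw; exact hw.2.2
  · change ContMDiffOn _ _ ∞ (fun p : M => (ψ.symm (e.symm (φ p)).1, (e.symm (φ p)).2)) c.target
    have h1 : ContMDiffOn (𝓡 (m + 1)) 𝓘(ℝ, Euc m × ℝ) ∞ (fun p => e.symm (φ p)) c.target :=
      he'.contMDiffOn.comp ((contMDiffOn_of_mem_maximalAtlas hφ).mono fun p hp => (htarget p hp).1)
        fun p hp => (htarget p hp).2.1
    have h2 : ContMDiffOn (𝓡 (m + 1)) (𝓡 m) ∞ (fun p => (e.symm (φ p)).1) c.target :=
      (contDiff_fst (𝕜 := ℝ) (E := Euc m) (F := ℝ)).contMDiff.comp_contMDiffOn h1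
    have h3 : ContMDiffOn (𝓡 (m + 1)) 𝓘(ℝ, ℝ) ∞ (fun p => (e.symm (φ p)).2) c.target :=
      (contDiff_snd (𝕜 := ℝ) (E := Euc m) (F := ℝ)).contMDiff.comp_contMDiffOn h1
    exact ((contMDiffOn_symm_of_mem_maximalAtlas hψ).comp h2 fun p hp => (htarget p hp).2.2).prodMk
      h3

/-- The flow-out in coordinates. -/
theorem exists_flowBox_coord {B : Euc (m + 1) →ₗ[ℝ] Euc (m + 1) →ₗ[ℝ] ℝ}
    {κ : Euc m → Euc (m + 1)} {O : Set (Euc m)} (hO : IsOpen O)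
    (hκ : ∀ x ∈ O, ContDiffAt ℝ ∞ κ x) {x₀ : Euc m} (hx₀ : x₀ ∈ O) {δ : ℝ} (hδ : 0 < δ)
    (hOκ : ∀ x ∈ O, κ x ∈ Metric.ball (κ x₀) δ) {u : Euc (m + 1) × ℝ → Euc (m + 1)}
    (hu : ContDiffOn ℝ ∞ u (Metric.ball (κ x₀) δ ×ˢ Ioo (-δ) δ))
    {Y : Euc (m + 1) → Euc (m + 1)} (hu' : ∀ x ∈ Metric.ball (κ x₀) δ, u (x, 0) = x ∧
      ∀ t ∈ Ioo (-δ) δ, HasDerivAt (fun s => u (x, s)) (Y (u (x, t))) t)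
    (hpos : ∀ v, v ≠ 0 → 0 < B (fderiv ℝ κ x₀ v) (fderiv ℝ κ x₀ v))
    (hneg : B (Y (κ x₀)) (Y (κ x₀)) < 0) :
    ∃ e : OpenPartialHomeomorph (Euc m × ℝ) (Euc (m + 1)), (x₀, 0) ∈ e.source ∧
      e.source ⊆ O ×ˢ Ioo (-δ) δ ∧ (∀ q ∈ e.source, e q = u (κ q.1, q.2)) ∧
      ContDiffOn ℝ ∞ e e.source ∧ ContDiffOn ℝ ∞ e.symm e.target := by
  have hs : IsOpen (O ×ˢ Ioo (-δ) δ) := hO.prod isOpen_Ioo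
  have ha : ((x₀, 0) : Euc m × ℝ) ∈ O ×ˢ Ioo (-δ) δ := ⟨hx₀, neg_lt_zero.2 hδ, hδ⟩
  obtain ⟨Ψ, hΨdef⟩ : ∃ Ψ : Euc m × ℝ → Euc (m + 1), ∀ q, Ψ q = u (κ q.1, q.2) :=
    ⟨_, fun _ => rfl⟩
  have hΨ : ContDiffOn ℝ ∞ Ψ (O ×ˢ Ioo (-δ) δ) := by
    have h : ContDiffOn ℝ ∞ (fun q : Euc m × ℝ => u (κ q.1, q.2)) (O ×ˢ Ioo (-δ) δ) := by
      refine hu.comp (ContDiffOn.prodMk (fun q hq => ?_) contDiff_snd.contDiffOn) fun q hq => ?_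
      · exact ((hκ q.1 hq.1).comp q contDiffAt_fst).contDiffWithinAt
      · exact ⟨hOκ _ hq.1, hq.2⟩
    exact h.congr fun q _ => hΨdef q
  have hd : HasFDerivAt Ψ (fderiv ℝ Ψ (x₀, 0)) (x₀, 0) :=
    ((hΨ.contDiffAt (hs.mem_nhds ha)).differentiableAt (by simp)).hasFDerivAt
  -- The partial derivatives at time 0 are the differential of the hypersurface and the vector
  -- field, to which the spacelike and timelike hypotheses apply.
  have hA1 : ∀ v, fderiv ℝ Ψ (x₀, 0) (v, 0) = fderiv ℝ κ x₀ v := by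
    intro v
    have h1 := HasFDerivAt.comp (g := Ψ) (f := fun x : Euc m => (x, (0 : ℝ))) x₀ hd
      (hasFDerivAt_prodMk_left x₀ (0 : ℝ))
    have h2 : Ψ ∘ (fun x : Euc m => (x, (0 : ℝ))) =ᶠ[𝓝 x₀] κ := by
      filter_upwards [hO.mem_nhds hx₀] with x hx
      exact (hΨdef _).trans (hu' _ (hOκ x hx)).1
    rw [← h2.fderiv_eq, h1.fderiv]
    rfl
  have hA2 : fderiv ℝ Ψ (x₀, 0) (0, 1) = Y (κ x₀) := by
    have h1 := HasFDerivAt.comp (g := Ψ) (f := fun t : ℝ => (x₀, t)) 0 hd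
      (hasFDerivAt_prodMk_right x₀ (0 : ℝ))
    have h2 := (hu' (κ x₀) (Metric.mem_ball_self hδ)).2 0 ⟨neg_lt_zero.2 hδ, hδ⟩
    rw [(hu' (κ x₀) (Metric.mem_ball_self hδ)).1] at h2
    have h4 : Ψ ∘ (fun t : ℝ => (x₀, t)) = fun t => u (κ x₀, t) := funext fun t => hΨdef _
    rw [h4] at h1
    rw [← h1.hasDerivAt.unique h2]
    rfl
  have hinj : Function.Injective (fderiv ℝ Ψ (x₀, 0)) := by
    refine injective_of_spacelike (B := B) (fun v hv => ?_) ?_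
    · rw [hA1]
      exact hpos v hv
    · rwa [hA2]
  have hdim : Module.finrank ℝ (Euc m × ℝ) = Module.finrank ℝ (Euc (m + 1)) := by simp
  obtain ⟨A, hA⟩ : ∃ A : (Euc m × ℝ) ≃L[ℝ] Euc (m + 1),
      (A : (Euc m × ℝ) →L[ℝ] Euc (m + 1)) = fderiv ℝ Ψ (x₀, 0) :=
    ⟨(LinearMap.linearEquivOfInjective (fderiv ℝ Ψ (x₀, 0) : (Euc m × ℝ) →ₗ[ℝ] Euc (m + 1)) hinj
      hdim).toContinuousLinearEquiv, ContinuousLinearMap.ext fun _ => rfl⟩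
  rw [← hA] at hd
  obtain ⟨e, hae, hes, heΨ, hesymm⟩ := exists_openPartialHomeomorph_of_contDiffOn hs hΨ ha hd
  exact ⟨e, hae, hes, fun q hq => (heΨ hq).trans (hΨdef q), (hΨ.mono hes).congr heΨ, hesymm⟩

/-- Near each point of the hypersurface, the flow-out is a diffeomorphism. -/
theorem exists_flowBox [T2Space M] (hX : IsSmoothVectorField X) (hXt : IsTimelike g X)
    (hι : ContMDiff (𝓡 m) (𝓡 (m + 1)) ∞ ι) (hιs : IsSpacelikeOn m g ι univ) (z₀ : S) :
    ∃ Φ : PartialDiffeomorph ((𝓡 m).prod 𝓘(ℝ, ℝ)) (𝓡 (m + 1)) (S × ℝ) M ∞,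
      (z₀, 0) ∈ Φ.source ∧ EqOn (flowOut X ι) Φ Φ.source ∧ Φ.source ⊆ flowOutDomain X ι := by
  set φ := chartAt (Euc (m + 1)) (ι z₀)
  set ψ := chartAt (Euc m) z₀
  have hφ : φ ∈ IsManifold.maximalAtlas (𝓡 (m + 1)) ∞ M := IsManifold.chart_mem_maximalAtlas _
  have hψ : ψ ∈ IsManifold.maximalAtlas (𝓡 m) ∞ S := IsManifold.chart_mem_maximalAtlas _
  have hp : ι z₀ ∈ φ.source := mem_chart_source _ _
  have hz : z₀ ∈ ψ.source := mem_chart_source _ _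
  obtain ⟨δ, hδ, u, hu, hut, hu'⟩ := exists_chart_flow hφ hX (φ.map_source hp)
  obtain ⟨κ, hκdef⟩ : ∃ κ : Euc m → Euc (m + 1), ∀ x, κ x = φ (ι (ψ.symm x)) :=
    ⟨_, fun _ => rfl⟩
  have hκ₀ : κ (ψ z₀) = φ (ι z₀) := by rw [hκdef, ψ.left_inv hz]
  have hV : IsOpen (ι ⁻¹' (φ.source ∩ φ ⁻¹' Metric.ball (φ (ι z₀)) δ)) :=
    (φ.isOpen_inter_preimage Metric.isOpen_ball).preimage hι.continuous
  set O : Set (Euc m) :=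
    ψ.target ∩ ψ.symm ⁻¹' (ι ⁻¹' (φ.source ∩ φ ⁻¹' Metric.ball (φ (ι z₀)) δ))
  have hO : IsOpen O := ψ.isOpen_inter_preimage_symm hV
  have hκ : ∀ x ∈ O, ContDiffAt ℝ ∞ κ x := by
    intro x hx
    rw [← contMDiffAt_iff_contDiffAt, funext hκdef]
    exact ((contMDiffAt_of_mem_maximalAtlas hφ hx.2.1).comp _ hι.contMDiffAt).comp x
      (contMDiffAt_symm_of_mem_maximalAtlas hψ hx.1)
  have hx₀ : ψ z₀ ∈ O := by
    refine ⟨ψ.map_source hz, ?_⟩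
    rw [mem_preimage, ψ.left_inv hz]
    exact ⟨hp, Metric.mem_ball_self hδ⟩
  have hOκ : ∀ x ∈ O, κ x ∈ Metric.ball (κ (ψ z₀)) δ := by
    intro x hx
    rw [hκ₀, hκdef]
    exact hx.2.2
  have hκψ : ∀ v : TangentSpace (𝓡 m) z₀, fderiv ℝ κ (ψ z₀) (mfderiv (𝓡 m) (𝓡 m) ψ z₀ v) =
      mfderiv (𝓡 (m + 1)) (𝓡 (m + 1)) φ (ι z₀) (mfderiv (𝓡 m) (𝓡 (m + 1)) ι z₀ v) := by
    intro v
    have h1 := mfderiv_comp z₀ ((hκ _ hx₀).differentiableAt (by simp)).mdifferentiableAt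
      (mdifferentiableAt_chart hψ hz)
    have h2 := mfderiv_comp z₀ (mdifferentiableAt_chart hφ hp)
      (hι.contMDiffAt.mdifferentiableAt (x := z₀) (by simp))
    have h3 : κ ∘ ψ =ᶠ[𝓝 z₀] φ ∘ ι := by
      filter_upwards [ψ.open_source.mem_nhds hz] with z hz'
      simp only [hκdef, Function.comp_apply, ψ.left_inv hz']
    rw [h3.mfderiv_eq, h2, mfderiv_eq_fderiv] at h1
    exact (DFunLike.congr_fun h1 v).symm
  rw [← hκ₀] at hu hut hu'
  obtain ⟨e, hae, hes, heq, he, he'⟩ := exists_flowBox_coord (B := componentsBilin φ g (φ (ι z₀)))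
    hO hκ hx₀ hδ hOκ hu hu' (by
      intro v hv
      obtain ⟨v', rfl⟩ := exists_mfderiv_chart_eq hψ hz v
      have hv' : v' ≠ 0 := by
        rintro rfl
        exact hv (map_zero _)
      have h1 := componentsBilin_mfderiv hφ g hp (mfderiv (𝓡 m) (𝓡 (m + 1)) ι z₀ v')
        (mfderiv (𝓡 m) (𝓡 (m + 1)) ι z₀ v')
      have h2 := hιs z₀ (mem_univ _) v' hv'
      rw [← h1] at h2
      exact lt_of_lt_of_eq h2 (congrArg
        (fun x : Euc (m + 1) => componentsBilin φ g (φ (ι z₀)) x x) (hκψ v').symm)) (by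
      rw [hκ₀, chartField_apply hp]
      exact (componentsBilin_mfderiv hφ g hp _ _).trans_lt (hXt _))
  obtain ⟨Φ, hΦs, hΦ⟩ := exists_partialDiffeomorph hψ hφ e he he'
  have hflow : ∀ w ∈ Φ.source, FlowsTo X (ι w.1) w.2 (Φ w) := by
    intro w hw
    rw [hΦs] at hw
    obtain ⟨h1, h2, h3⟩ := hw
    have h4 := hes h2
    have hιw : φ.symm (κ (ψ w.1)) = ι w.1 := by
      have h5 := h4.1.2.1
      simp only [ψ.left_inv h1] at h5
      rw [hκdef, ψ.left_inv h1, φ.left_inv h5]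
    rw [hΦ, heq _ h2, ← hιw]
    have h6 := hu' _ (hOκ _ h4.1)
    exact flowsTo_of_chart_flow (c := fun t => u (κ (ψ w.1), t)) hφ h6.1
      (fun t ht => hut ⟨hOκ _ h4.1, ht⟩) h6.2 h4.2
  refine ⟨Φ, ?_, fun w hw => flowOut_eq hX (hflow w hw), fun w hw => ⟨_, hflow w hw⟩⟩
  rw [hΦs]
  refine ⟨hz, hae, ?_⟩
  rw [heq _ hae]
  exact hut ⟨hOκ _ hx₀, neg_lt_zero.2 hδ, hδ⟩

end FlowBox

/-! ### From joint limits to uniform statements. -/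

section Compactness

/-- For compact `C` the product of `l` with the neighbourhood filter of `C` is the supremum of the
products at single points. This is how joint limits at points become uniform on compact sets. -/
theorem eventually_forall_of_isCompact {α β : Type*} [TopologicalSpace β] {l : Filter α}
    {C : Set β} (hC : IsCompact C) {P : α → β → Prop}
    (h : ∀ y ∈ C, ∀ᶠ q in l ×ˢ 𝓝 y, P q.1 q.2) : ∀ᶠ x in l, ∀ y ∈ C, P x y := by
  have h1 : ∀ᶠ q in l ×ˢ 𝓝ˢ C, P q.1 q.2 := by
    rw [hC.prod_nhdsSet_eq_biSup]
    simpa only [eventually_iSup] using h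
  filter_upwards [h1.curry] with x hx y hy using hx.self_of_nhdsSet y hy

/-- Positivity needs checking only on the unit sphere, which is compact; quadratic homogeneity
extends it to all nonzero vectors. -/
theorem eventually_pos_of_tendsto {m n : ℕ} {ι : Type*} {l : Filter ι}
    {Bq : ι → Euc n →ₗ[ℝ] Euc n →ₗ[ℝ] ℝ} {B : Euc n →ₗ[ℝ] Euc n →ₗ[ℝ] ℝ}
    {L : (Euc m × ℝ) ≃L[ℝ] Euc n} (hB : ∀ v w, Tendsto (fun q => Bq q v w) l (𝓝 (B v w)))
    (hpos : ∀ x, x ≠ 0 → 0 < B (L (x, 0)) (L (x, 0))) :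
    ∀ᶠ q in l, ∀ x, x ≠ 0 → 0 < Bq q (L (x, 0)) (L (x, 0)) := by
  have h1 : ∀ᶠ q in l, ∀ x ∈ Metric.sphere (0 : Euc m) 1, 0 < Bq q (L (x, 0)) (L (x, 0)) := by
    refine eventually_forall_of_isCompact (isCompact_sphere _ _) fun x hx => ?_
    have hL : Tendsto (fun q : ι × Euc m => L (q.2, 0)) (l ×ˢ 𝓝 x) (𝓝 (L (x, 0))) :=
      (L.continuous.comp (Continuous.prodMk_left 0)).continuousAt.tendsto.comp tendsto_snd
    refine (tendsto_bilin_apply (Bq := fun q : ι × Euc m => Bq q.1)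
      (fun v w => (hB v w).comp tendsto_fst) hL hL).eventually_const_lt (hpos x ?_)
    rintro rfl
    simp at hx
  filter_upwards [h1] with q hq x hx
  have hx' : 0 < ‖x‖ := norm_pos_iff.2 hx
  have h2 := hq (‖x‖⁻¹ • x) (by simp [norm_smul, hx'.ne'])
  have h3 : L (x, 0) = ‖x‖ • L (‖x‖⁻¹ • x, 0) := by
    rw [← map_smul, Prod.smul_mk, smul_smul, mul_inv_cancel₀ hx'.ne', one_smul, smul_zero]
  rw [h3, map_smul, map_smul, LinearMap.smul_apply, smul_eq_mul, smul_eq_mul]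
  positivity

end Compactness

/-! ### Stability of spacelike leaves and of the timelike field. -/

section Leaves

variable {m n : ℕ} {M : Type*} [TopologicalSpace M] [ChartedSpace (Euc n) M]
  [IsManifold (𝓡 n) ∞ M]
  {S : Type*} [TopologicalSpace S] [ChartedSpace (Euc m) S] [IsManifold (𝓡 m) ∞ S]
  {F : S × ℝ → M} {N : Set (S × ℝ)} {φ : OpenPartialHomeomorph M (Euc n)}
  {ψ : OpenPartialHomeomorph S (Euc m)} {L : (Euc m × ℝ) ≃L[ℝ] Euc n} {w₀ : S × ℝ}
  {g : BilinField n M} {X : VectorField n M}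

/-- At the point `w`, the leaf of the map `F` through `w` is `g`-spacelike. -/
def IsSpacelikeLeafAt (g : BilinField n M) (F : S × ℝ → M) (w : S × ℝ) : Prop :=
  ∀ v : TangentSpace (𝓡 m) w.1, v ≠ 0 →
    0 < g (F (w.1, w.2)) (mfderiv (𝓡 m) (𝓡 n) (fun z => F (z, w.2)) w.1 v)
      (mfderiv (𝓡 m) (𝓡 n) (fun z => F (z, w.2)) w.1 v)

theorem mfderiv_chart_ne_zero (hφ : φ ∈ IsManifold.maximalAtlas (𝓡 n) ∞ M)
    {p : M} (hp : p ∈ φ.source) {v : TangentSpace (𝓡 n) p} (hv : v ≠ 0) :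
    mfderiv (𝓡 n) (𝓡 n) φ p v ≠ 0 := by
  obtain ⟨y, hy, rfl⟩ : ∃ y ∈ φ.target, φ.symm y = p := ⟨φ p, φ.map_source hp, φ.left_inv hp⟩
  intro h
  have h1 := mfderiv_chart_symm_of_mfderiv_chart hφ hy v
  rw [h] at h1
  exact hv (h1.symm.trans (map_zero _))

namespace IsAdaptedChart

theorem isSpacelikeLeafAt (h : IsAdaptedChart F N φ ψ L) (hw : w₀ ∈ N)
    (hpos : ∀ x, x ≠ 0 → 0 < componentsBilin φ g (φ (F w₀)) (L (x, 0)) (L (x, 0))) :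
    IsSpacelikeLeafAt (m := m) g F w₀ := by
  intro v hv
  have h1 := hpos _ (mfderiv_chart_ne_zero h.ψ_mem (h.mem_source _ hw) hv)
  rw [← h.mfderiv_leaf hw v] at h1
  exact lt_of_lt_of_eq h1 (componentsBilin_mfderiv h.φ_mem g (h.map_mem_source _ hw) _ _)

variable {κ : Type*} {l : Filter κ} {G : κ → BilinField n M} {w : κ → S × ℝ}

theorem eventually_isSpacelikeLeafAt (h : IsAdaptedChart F N φ ψ L) (hw₀ : w₀ ∈ N)
    (hw : Tendsto w l (𝓝 w₀))
    (hG : ∀ a b, Tendsto (fun q => componentsBilin φ (G q) (φ (F (w q))) a b) l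
      (𝓝 (componentsBilin φ g (φ (F w₀)) a b)))
    (hpos : IsSpacelikeLeafAt (m := m) g F w₀) :
    ∀ᶠ q in l, IsSpacelikeLeafAt (m := m) (G q) F (w q) := by
  filter_upwards [hw.eventually_mem (h.isOpen.mem_nhds hw₀),
    eventually_pos_of_tendsto hG (h.componentsBilin_leaf_pos hw₀ hpos)] with q h1 h2
  exact h.isSpacelikeLeafAt h1 h2

theorem eventually_timelike (h : IsAdaptedChart F N φ ψ L) (hw₀ : w₀ ∈ N)
    (hw : Tendsto w l (𝓝 w₀))
    (hG : ∀ a b, Tendsto (fun q => componentsBilin φ (G q) (φ (F (w q))) a b) l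
      (𝓝 (componentsBilin φ g (φ (F w₀)) a b)))
    (hX : IsSmoothVectorField X) (hneg : g (F w₀) (X (F w₀)) (X (F w₀)) < 0) :
    ∀ᶠ q in l, G q (F (w q)) (X (F (w q))) (X (F (w q))) < 0 := by
  have hp := h.map_mem_source _ hw₀
  have h1 := (continuousAt_mfderiv_vectorField h.φ_mem hX hp).tendsto.comp
    ((h.continuousAt hw₀).tendsto.comp hw)
  have h2 := tendsto_bilin_apply hG h1 h1
  filter_upwards [hw.eventually_mem (h.isOpen.mem_nhds hw₀),
    h2.eventually_lt_const ((componentsBilin_mfderiv h.φ_mem g hp _ _).trans_lt hneg)]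
    with q h3 h4
  exact lt_of_eq_of_lt (componentsBilin_mfderiv h.φ_mem (G q) (h.map_mem_source _ h3) _ _).symm h4

end IsAdaptedChart

variable {D : RegularisationData n M} {gc : ℝ → BilinField n M}

theorem IsLocallyLipschitz.eventually_isSpacelikeLeafAt (hg : IsLocallyLipschitz g)
    (L : (Euc m × ℝ) ≃L[ℝ] Euc n)
    (hF : IsLocalDiffeomorphAt ((𝓡 m).prod 𝓘(ℝ, ℝ)) (𝓡 n) ∞ F w₀)
    (hpos : IsSpacelikeLeafAt (m := m) g F w₀) :
    ∀ᶠ w in 𝓝 w₀, IsSpacelikeLeafAt (m := m) g F w := by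
  obtain ⟨N, φ, ψ, hN, h⟩ := exists_isAdaptedChart L hF
  exact h.eventually_isSpacelikeLeafAt hN tendsto_id (fun a b =>
    (hg.continuousAt_componentsBilin h.φ_mem (h.map_mem_source _ hN) a b).tendsto.comp
      (h.continuousAt hN)) hpos

theorem IsNarrowApproximation.eventually_leaf (hgc : IsNarrowApproximation D g gc)
    (hg : IsLocallyLipschitz g) (L : (Euc m × ℝ) ≃L[ℝ] Euc n)
    (hF : IsLocalDiffeomorphAt ((𝓡 m).prod 𝓘(ℝ, ℝ)) (𝓡 n) ∞ F w₀)
    (hpos : IsSpacelikeLeafAt (m := m) g F w₀)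
    (hX : IsSmoothVectorField X) (hneg : g (F w₀) (X (F w₀)) (X (F w₀)) < 0) :
    ∀ᶠ q : ℝ × (S × ℝ) in 𝓝[>] 0 ×ˢ 𝓝 w₀, IsSpacelikeLeafAt (m := m) (gc q.1) F q.2 ∧
      gc q.1 (F q.2) (X (F q.2)) (X (F q.2)) < 0 := by
  obtain ⟨N, φ, ψ, hN, h⟩ := exists_isAdaptedChart L hF
  have hF : Tendsto (fun q : ℝ × (S × ℝ) => (q.1, F q.2)) (𝓝[>] 0 ×ˢ 𝓝 w₀)
      (𝓝[>] 0 ×ˢ 𝓝 (F w₀)) :=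
    tendsto_fst.prodMk ((h.continuousAt hN).tendsto.comp tendsto_snd)
  have hG := fun a b =>
    (hgc.tendsto_componentsBilin hg h.φ_mem (h.map_mem_source _ hN) a b).comp hF
  exact Filter.Eventually.and (h.eventually_isSpacelikeLeafAt hN tendsto_snd hG hpos)
    (h.eventually_timelike hN tendsto_snd hG hX hneg)

end Leaves

/-! ### Existence of admissible sets. -/

section Existence

variable {m : ℕ} {M : Type*} [TopologicalSpace M] [ChartedSpace (Euc (m + 1)) M]
  [IsManifold (𝓡 (m + 1)) ∞ M]
  {S : Type*} [TopologicalSpace S] [ChartedSpace (Euc m) S] [IsManifold (𝓡 m) ∞ S]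
  {g : BilinField (m + 1) M} {X : VectorField (m + 1) M} {ι : S → M}

theorem isSpacelikeLeafAt_zero_iff (h : ∀ z : S, (z, (0 : ℝ)) ∈ flowOutDomain X ι) {z : S} :
    IsSpacelikeLeafAt (m := m) g (flowOut X ι) (z, 0) ↔
      ∀ v : TangentSpace (𝓡 m) z, v ≠ 0 →
        0 < g (ι z) (mfderiv (𝓡 m) (𝓡 (m + 1)) ι z v) (mfderiv (𝓡 m) (𝓡 (m + 1)) ι z v) := by
  have key : ∀ f : S → M, f = ι → ((∀ v : TangentSpace (𝓡 m) z, v ≠ 0 →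
      0 < g (f z) (mfderiv (𝓡 m) (𝓡 (m + 1)) f z v) (mfderiv (𝓡 m) (𝓡 (m + 1)) f z v)) ↔
      ∀ v : TangentSpace (𝓡 m) z, v ≠ 0 →
        0 < g (ι z) (mfderiv (𝓡 m) (𝓡 (m + 1)) ι z v) (mfderiv (𝓡 m) (𝓡 (m + 1)) ι z v)) := by
    rintro f rfl
    rfl
  exact key (fun z => flowOut X ι (z, 0)) (funext fun z => flowOut_zero (h z))

/-- A spacelike hypersurface has admissible neighbourhoods. -/
theorem exists_isAdmissible [T2Space M] [SecondCountableTopology M] (hg : IsLocallyLipschitz g)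
    (hX : IsSmoothVectorField X) (hXt : IsTimelike g X)
    (hι : Manifold.IsSmoothEmbedding (𝓡 m) (𝓡 (m + 1)) ∞ ι) (hιs : IsSpacelikeOn m g ι univ) :
    ∃ 𝒜 : Set (S × ℝ), IsAdmissible m g X ι univ 𝒜 := by
  have : LocallyCompactSpace M := ChartedSpace.locallyCompactSpace (Euc (m + 1)) M
  let _ : MetricSpace M := TopologicalSpace.metrizableSpaceMetric M
  choose Φ hΦ0 hΦ hΦdom using exists_flowBox hX hXt hι.contMDiff hιs
  have hdom : ∀ z : S, (z, (0 : ℝ)) ∈ flowOutDomain X ι := fun z => hΦdom z (hΦ0 z)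
  -- As ι is an embedding, nearness in `S` is measured by the metric of `M`. The factor 3 leaves
  -- room for the two triangle inequalities in the injectivity argument.
  have hr : ∀ z, ∃ r > 0, ∀ w : S × ℝ, dist (ι w.1) (ι z) < 3 * r → |w.2| < 3 * r →
      w ∈ (Φ z).source := by
    intro z
    have h1 := (Φ z).open_source.mem_nhds (hΦ0 z)
    rw [nhds_prod_eq, hι.isEmbedding.isInducing.nhds_eq_comap] at h1
    obtain ⟨r, ⟨hr1, hr2⟩, hr⟩ := ((Metric.nhds_basis_ball.comap ι).prod
      Metric.nhds_basis_ball).mem_iff.1 h1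
    refine ⟨min r.1 r.2 / 3, by positivity, fun w hw1 hw2 => hr ⟨?_, ?_⟩⟩
    · rw [mem_preimage, Metric.mem_ball]
      linarith [min_le_left r.1 r.2]
    · rw [Metric.mem_ball, Real.dist_0_eq_abs]
      linarith [min_le_right r.1 r.2]
  choose r hr0 hr using hr
  -- Besides w being close to (z, 0), its image is required to be close to ι z, so that equal images
  -- force the base points to be close to each other.
  let V : S → Set (S × ℝ) := fun z => {w | w ∈ (Φ z).source ∧ dist (ι w.1) (ι z) < r z ∧
    |w.2| < r z ∧ dist (flowOut X ι w) (ι z) < r z}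
  have hdiff : ∀ z, ∀ w ∈ (Φ z).source,
      IsLocalDiffeomorphAt ((𝓡 m).prod 𝓘(ℝ, ℝ)) (𝓡 (m + 1)) ∞ (flowOut X ι) w :=
    fun z w hw => ⟨Φ z, hw, hΦ z⟩
  have hV : ∀ z, ∀ w ∈ V z, V z ∈ 𝓝 w := by
    rintro z w ⟨h1, h2, h3, h4⟩
    have hF : ContinuousAt (flowOut X ι) w := (hdiff z w h1).contMDiffAt.continuousAt
    have hw1 : ContinuousAt (fun w : S × ℝ => dist (ι w.1) (ι z)) w :=
      ((hι.isEmbedding.continuous.comp continuous_fst).dist continuous_const).continuousAt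
    have hw2 : ContinuousAt (fun w : S × ℝ => |w.2|) w := continuous_snd.abs.continuousAt
    filter_upwards [(Φ z).open_source.mem_nhds h1, hw1.eventually_lt_const h2,
      hw2.eventually_lt_const h3, (hF.dist continuousAt_const).eventually_lt_const h4]
      with w' h5 h6 h7 h8 using ⟨h5, h6, h7, h8⟩
  -- If w and w' have the same image and `r z' ≤ r z`, then ι w'.1 is within 3 r z of ι z, via ι z'
  -- and the common image. Both points thus lie in the larger flow box around z, where the flow-out
  -- is injective.
  have hinj : ∀ z z' w w', w ∈ V z → w' ∈ V z' → r z' ≤ r z → flowOut X ι w = flowOut X ι w' →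
      w = w' := by
    rintro z z' w w' ⟨h1, -, -, h2⟩ ⟨-, h3, h4, h5⟩ hle heq
    have h6 : w' ∈ (Φ z).source := by
      refine hr z w' ?_ (by linarith [hr0 z])
      have h7 := dist_triangle (ι w'.1) (ι z') (ι z)
      have h8 := dist_triangle_left (ι z') (ι z) (flowOut X ι w')
      rw [heq] at h2
      linarith
    refine (Φ z).toPartialEquiv.injOn h1 h6 ?_
    exact (hΦ z h1).symm.trans (heq.trans (hΦ z h6))
  -- The union of the boxes is intersected with the condition of spacelike leaves, which is open
  -- there and holds at time 0.
  refine ⟨{w | (∃ z, w ∈ V z) ∧ IsSpacelikeLeafAt (m := m) g (flowOut X ι) w}, ?_, ?_, ?_, ?_, ?_,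
    ?_, ?_⟩
  · rw [isOpen_iff_mem_nhds]
    rintro w ⟨⟨z, hz⟩, hw⟩
    filter_upwards [hV z w hz,
      hg.eventually_isSpacelikeLeafAt (splitLast m) (hdiff z w hz.1) hw] with w' h1 h2
      using ⟨⟨z, h1⟩, h2⟩
  · rintro w ⟨⟨z, hz⟩, -⟩
    exact ⟨hΦdom z hz.1, mem_univ _, mem_univ _⟩
  · rintro ⟨z, t⟩ ⟨-, ht⟩
    obtain rfl : t = 0 := ht
    refine ⟨⟨z, hΦ0 z, ?_, ?_, ?_⟩,
      (isSpacelikeLeafAt_zero_iff hdom).2 (hιs z (mem_univ z))⟩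
    · rw [dist_self]
      exact hr0 z
    · rw [abs_zero]
      exact hr0 z
    · rw [flowOut_zero (hdom z), dist_self]
      exact hr0 z
  · rintro w ⟨⟨z, hz⟩, -⟩ w' ⟨⟨z', hz'⟩, -⟩ heq
    rcases le_total (r z') (r z) with h | h
    · exact hinj z z' w w' hz hz' h heq
    · exact (hinj z' z w' w hz' hz h heq.symm).symm
  · rintro ⟨w, ⟨z, hz⟩, -⟩
    exact hdiff z w hz.1
  · exact fun p _ => hXt p
  · exact fun w hw => hw.2

end Existence

/-! ### Uniform convergence on a tube, and upper bounds on the mean curvature. -/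

section Convergence

variable {m : ℕ} {M : Type*} [TopologicalSpace M] [ChartedSpace (Euc (m + 1)) M]
  [IsManifold (𝓡 (m + 1)) ∞ M]
  {S : Type*} [TopologicalSpace S] [ChartedSpace (Euc m) S] [IsManifold (𝓡 m) ∞ S]
  {g g' : BilinField (m + 1) M} {T X : VectorField (m + 1) M} {ι : S → M} {U : Set S}
  {𝒜 ℬ : Set (S × ℝ)} {D : RegularisationData (m + 1) M} {gc : ℝ → BilinField (m + 1) M}
  {ε : ℕ → ℝ}

theorem IsAdmissible.restrict (h : IsAdmissible m g X ι univ 𝒜) (hℬ : IsOpen ℬ) (hsub : ℬ ⊆ 𝒜)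
    (hU : ℬ ⊆ U ×ˢ univ) (h0 : U ×ˢ {(0 : ℝ)} ⊆ ℬ)
    (ht : ∀ w ∈ ℬ, g' (flowOut X ι w) (X (flowOut X ι w)) (X (flowOut X ι w)) < 0)
    (hl : ∀ w ∈ ℬ, IsSpacelikeLeafAt (m := m) g' (flowOut X ι) w) :
    IsAdmissible m g' X ι U ℬ where
  isOpen := hℬ
  subset_domain := fun w hw => ⟨(h.subset_domain (hsub hw)).1, hU hw⟩
  zero_mem := h0
  injOn := h.injOn.mono hsub
  isLocalDiffeomorphOn := fun w => h.isLocalDiffeomorphOn ⟨w, hsub w.2⟩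
  timelike := by
    rintro _ ⟨w, hw, rfl⟩
    exact ht w hw
  leaves_spacelike := hl

theorem IsAdmissible.eventually_leaf (h𝒜 : IsAdmissible m g X ι univ 𝒜)
    (hgl : IsLocallyLipschitz g) (hX : IsSmoothVectorField X)
    (hgc : IsNarrowApproximation D g gc) {C : Set (S × ℝ)} (hC : IsCompact C) (hCA : C ⊆ 𝒜) :
    ∀ᶠ η in 𝓝[>] 0, ∀ w ∈ C, IsSpacelikeLeafAt (m := m) (gc η) (flowOut X ι) w ∧
      gc η (flowOut X ι w) (X (flowOut X ι w)) (X (flowOut X ι w)) < 0 :=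
  eventually_forall_of_isCompact hC fun w hw =>
    hgc.eventually_leaf hgl (splitLast m) (h𝒜.isLocalDiffeomorphOn ⟨w, hCA hw⟩)
      (h𝒜.leaves_spacelike w (hCA hw)) hX (h𝒜.timelike _ (mem_image_of_mem _ (hCA hw)))

/-- A product tube around U with compact closure in `𝒜` serves all large k at once: the conditions
on the metrics and the convergence hold locally near each point of the closure, hence uniformly on
it. -/
theorem IsAdmissible.exists_tendstoUniformlyOn (h𝒜 : IsAdmissible m g X ι univ 𝒜)
    (hg : IsLorentzian g) (hgl : IsLocallyLipschitz g) (hT : IsSmoothVectorField T)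
    (hTt : IsTimelike g T) (hX : IsSmoothVectorField X) (hgc : IsNarrowApproximation D g gc)
    (hU : IsOpen U) (hUc : IsCompact (closure U)) (hε : Tendsto ε atTop (𝓝[>] 0)) :
    ∃ (k₀ : ℕ) (ℬ : Set (S × ℝ)), ℬ ⊆ 𝒜 ∧
      IsAdmissible m g X ι U ℬ ∧
      (∀ k ≥ k₀, IsAdmissible m (gc (ε k)) X ι U ℬ) ∧
      TendstoUniformlyOn
        (fun k p => slabMeanCurvature m (gc (ε k)) g T X ι ℬ p
          - D.conv (slabMeanCurvature m g g T X ι 𝒜) (ε k) p)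
        0 atTop (flowOut X ι '' ℬ) := by
  obtain ⟨u, v, -, hv, hu, h0, huv⟩ := generalized_tube_lemma hUc (isCompact_singleton (x := (0 : ℝ)))
    h𝒜.isOpen ((prod_mono_left (subset_univ _)).trans h𝒜.zero_mem)
  obtain ⟨δ, hδ, hδv⟩ := Metric.nhds_basis_closedBall.mem_iff.1 (hv.mem_nhds (h0 rfl))
  rw [Real.closedBall_eq_Icc, zero_sub, zero_add] at hδv
  have hC : IsCompact (closure U ×ˢ Icc (-δ) δ) := hUc.prod isCompact_Icc
  have hCA : closure U ×ˢ Icc (-δ) δ ⊆ 𝒜 := (prod_mono hu hδv).trans huv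
  have hBC : U ×ˢ Ioo (-δ) δ ⊆ closure U ×ˢ Icc (-δ) δ := prod_mono subset_closure Ioo_subset_Icc_self
  have hBo : IsOpen (U ×ˢ Ioo (-δ) δ) := hU.prod isOpen_Ioo
  have hB0 : U ×ˢ {(0 : ℝ)} ⊆ U ×ˢ Ioo (-δ) δ :=
    prod_mono_right (singleton_subset_iff.2 ⟨neg_lt_zero.2 hδ, hδ⟩)
  obtain ⟨k₀, hk₀⟩ := eventually_atTop.1 (hε.eventually (h𝒜.eventually_leaf hgl hX hgc hC hCA))
  refine ⟨k₀, U ×ˢ Ioo (-δ) δ, hBC.trans hCA, ?_, fun k hk => ?_, ?_⟩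
  · exact h𝒜.restrict hBo (hBC.trans hCA) (prod_mono_right (subset_univ _)) hB0
      (fun w hw => h𝒜.timelike _ (mem_image_of_mem _ (hCA (hBC hw))))
      (fun w hw => h𝒜.leaves_spacelike w (hCA (hBC hw)))
  · exact h𝒜.restrict hBo (hBC.trans hCA) (prod_mono_right (subset_univ _)) hB0
      (fun w hw => (hk₀ k hk w (hBC hw)).2) (fun w hw => (hk₀ k hk w (hBC hw)).1)
  · rw [Metric.tendstoUniformlyOn_iff]
    intro η hη
    have h1 := hε.eventually (eventually_forall_of_isCompact (P := fun η' w =>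
      dist (meanCurvature m (gc η') g T (fun z => flowOut X ι (z, w.2)) w.1 -
        D.conv (slabMeanCurvature m g g T X ι 𝒜) η' (flowOut X ι w)) 0 < η) hC fun w hw =>
      Metric.tendsto_nhds.1 (h𝒜.tendsto_meanCurvature_sub (hCA hw) hg hgl hT hTt hgc) η hη)
    filter_upwards [h1] with k hk
    rintro _ ⟨w, hw, rfl⟩
    rw [slabMeanCurvature_flowOut (h𝒜.injOn.mono (hBC.trans hCA)) hw, dist_comm]
    exact hk w (hBC hw)

theorem IsNullSet.eventuallyAE {f : M → ℝ} {A : Set M} {c : ℝ}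
    (h : IsNullSet (m + 1) {p ∈ A | c < f p}) {p : M} (hA : A ∈ 𝓝 p) :
    D.EventuallyAE (fun p => f p ≤ c) p := by
  intro α hα
  have h1 := h _ (D.chart_mem α)
  have h2 : ∀ᶠ y in 𝓝 (D.chart α p), (D.chart α).symm y ∈ A := by
    refine (D.chart α).continuousAt_symm ((D.chart α).map_source hα) |>.preimage_mem_nhds ?_
    rwa [(D.chart α).left_inv hα]
  filter_upwards [mem_inf_of_left h2,
    mem_inf_of_left ((D.chart α).open_target.mem_nhds ((D.chart α).map_source hα)),
    mem_inf_of_right (measure_eq_zero_iff_ae_notMem.1 h1)] with y h3 h4 h5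
  by_contra h6
  exact h5 ⟨_, ⟨⟨h3, not_le.1 h6⟩, (D.chart α).map_target h4⟩, (D.chart α).right_inv h4⟩

theorem IsAdmissible.image_mem_nhds (h𝒜 : IsAdmissible m g X ι univ 𝒜) {w : S × ℝ} (hw : w ∈ 𝒜) :
    flowOut X ι '' 𝒜 ∈ 𝓝 (flowOut X ι w) := by
  obtain ⟨N, φ, ψ, hN, h⟩ := exists_isAdaptedChart (splitLast m) (h𝒜.isLocalDiffeomorphOn ⟨w, hw⟩)
  exact h.nhds_le_map hN (image_mem_map (h𝒜.isOpen.mem_nhds hw))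

/-- Upper bounds on the mean curvature of the slab are inherited by the approximations. -/
theorem IsAdmissible.eventually_meanCurvature_lt (h𝒜 : IsAdmissible m g X ι univ 𝒜)
    (hg : IsLorentzian g) (hgl : IsLocallyLipschitz g) (hT : IsSmoothVectorField T)
    (hTt : IsTimelike g T) (hX : IsSmoothVectorField X) (hgc : IsNarrowApproximation D g gc)
    (hUc : IsCompact (closure U)) (hε : Tendsto ε atTop (𝓝[>] 0)) {b c : ℝ} (hcb : c < b)
    (hc : IsNullSet (m + 1) {p ∈ flowOut X ι '' 𝒜 | c < slabMeanCurvature m g g T X ι 𝒜 p}) :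
    ∀ᶠ k in atTop, IsSpacelikeOn m (gc (ε k)) ι U ∧
      ∀ z ∈ U, meanCurvature m (gc (ε k)) g T ι z < b := by
  have h0 : ∀ z : S, (z, (0 : ℝ)) ∈ 𝒜 := fun z => h𝒜.zero_mem ⟨mem_univ z, rfl⟩
  have hdom : ∀ z : S, (z, (0 : ℝ)) ∈ flowOutDomain X ι := fun z => (h𝒜.subset_domain (h0 z)).1
  have hleaf : (fun z => flowOut X ι (z, 0)) = ι := funext fun z => flowOut_zero (hdom z)
  have hC : IsCompact (closure U ×ˢ {(0 : ℝ)}) := hUc.prod isCompact_singleton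
  have hCA : closure U ×ˢ {(0 : ℝ)} ⊆ 𝒜 := (prod_mono_left (subset_univ _)).trans h𝒜.zero_mem
  have h1 : ∀ᶠ η in 𝓝[>] 0, ∀ w ∈ closure U ×ˢ {(0 : ℝ)},
      meanCurvature m (gc η) g T (fun z => flowOut X ι (z, w.2)) w.1 < b := by
    refine eventually_forall_of_isCompact hC fun w hw => ?_
    -- Convolution preserves the bound c only up to an arbitrarily small error, so the gap to b is
    -- shared: c' - c pays for the convolution and b - c' for the difference of the mean curvatures.
    obtain ⟨c', hc', hc'b⟩ := exists_between hcb
    have hF : ContinuousAt (flowOut X ι) w :=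
      (h𝒜.isLocalDiffeomorphOn ⟨w, hCA hw⟩).contMDiffAt.continuousAt
    have hF' : Tendsto (fun q : ℝ × (S × ℝ) => (q.1, flowOut X ι q.2)) (𝓝[>] 0 ×ˢ 𝓝 w)
        (𝓝[>] 0 ×ˢ 𝓝 (flowOut X ι w)) := tendsto_fst.prodMk (hF.tendsto.comp tendsto_snd)
    have h2 := hF'.eventually (D.eventually_conv_le (fun α hα =>
      h𝒜.locEssBounded_slabMeanCurvature hg hgl hT hTt (D.chart_mem α)
        (mem_image_of_mem _ (hCA hw)) hα) hc'
      (hc.eventuallyAE (h𝒜.image_mem_nhds (hCA hw))))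
    filter_upwards [h2, (h𝒜.tendsto_meanCurvature_sub (hCA hw) hg hgl hT hTt hgc).eventually_lt_const
      (sub_pos.2 hc'b)] with q h3 h4
    linarith
  filter_upwards [hε.eventually h1, hε.eventually (h𝒜.eventually_leaf hgl hX hgc hC hCA)]
    with k hk1 hk2
  have hz : ∀ z ∈ U, (z, (0 : ℝ)) ∈ closure U ×ˢ {(0 : ℝ)} := fun z hz => ⟨subset_closure hz, rfl⟩
  refine ⟨fun z hzU => (isSpacelikeLeafAt_zero_iff hdom).1 (hk2 _ (hz z hzU)).1, fun z hzU => ?_⟩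
  have h2 := hk1 _ (hz z hzU)
  rwa [hleaf] at h2

end Convergence

end LipschitzSlab

/-! ### The main theorem. -/

theorem mainTheorem7 {m : ℕ} (hm : 1 ≤ m)
    {M : Type*} [TopologicalSpace M] [T2Space M] [SecondCountableTopology M] [ConnectedSpace M]
    [ChartedSpace (Euc (m + 1)) M] [IsManifold (𝓡 (m + 1)) ∞ M]
    (g : BilinField (m + 1) M) (hg : IsLorentzian g) (hg_lip : IsLocallyLipschitz g)
    (T : VectorField (m + 1) M) (hT : IsSmoothVectorField T) (hT_timelike : IsTimelike g T)
    {S : Type*} [TopologicalSpace S] [ChartedSpace (Euc m) S] [IsManifold (𝓡 m) ∞ S]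
    (ι : S → M) (hι : Manifold.IsSmoothEmbedding (𝓡 m) (𝓡 (m + 1)) ∞ ι)
    (hι_spacelike : IsSpacelikeOn m g ι univ)
    (U : Set S) (hU : IsOpen U) (hU_compact : IsCompact (closure U))
    (D : RegularisationData (m + 1) M)
    (gc : ℝ → BilinField (m + 1) M) (hgc : IsNarrowApproximation D g gc)
    (ε : ℕ → ℝ) (hε : ∀ k, ε k ∈ Ioc (0 : ℝ) 1) (hε_lim : Tendsto ε atTop (𝓝 0)) :
    (∀ X : VectorField (m + 1) M, IsSmoothVectorField X → IsTimelike g X →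
      (∃ 𝒜 : Set (S × ℝ), IsAdmissible m g X ι univ 𝒜) ∧
      ∀ 𝒜 : Set (S × ℝ), IsAdmissible m g X ι univ 𝒜 →
        MemLinftyLoc (m + 1) (slabMeanCurvature m g g T X ι 𝒜) (flowOut X ι '' 𝒜) ∧
        ∃ (k₀ : ℕ) (ℬ : Set (S × ℝ)), ℬ ⊆ 𝒜 ∧
          IsAdmissible m g X ι U ℬ ∧
          (∀ k ≥ k₀, IsAdmissible m (gc (ε k)) X ι U ℬ) ∧
          TendstoUniformlyOn
            (fun k p => slabMeanCurvature m (gc (ε k)) g T X ι ℬ p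
              - D.conv (slabMeanCurvature m g g T X ι 𝒜) (ε k) p)
            0 atTop (flowOut X ι '' ℬ)) ∧
    ∀ b : ℝ, SlabMeanCurvatureLT m g T ι b →
      ∀ᶠ k in atTop, IsSpacelikeOn m (gc (ε k)) ι U ∧
        ∀ z ∈ U, meanCurvature m (gc (ε k)) g T ι z < b := by
  have hε' : Tendsto ε atTop (𝓝[>] 0) :=
    tendsto_nhdsWithin_iff.2 ⟨hε_lim, Eventually.of_forall fun k => (hε k).1⟩
  refine ⟨fun X hX hXt => ⟨exists_isAdmissible hg_lip hX hXt hι hι_spacelike, fun 𝒜 h𝒜 =>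
    ⟨h𝒜.memLinftyLoc hg hg_lip hT hT_timelike,
      h𝒜.exists_tendstoUniformlyOn hg hg_lip hT hT_timelike hX hgc hU hU_compact hε'⟩⟩, ?_⟩
  rintro b ⟨X, hX, -, 𝒜, h𝒜, c, hcb, hc⟩
  exact h𝒜.eventually_meanCurvature_lt hg hg_lip hT hT_timelike hX hgc hU_compact hε' hcb hc
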